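/- **Setting.** Finite types are generated from the type $0$ of natural numbers by $\sigma\to\tau$. $\mathsf{E\text{-}HA}^\omega$ is fully extensional Heyting arithmetic in all finite types: its terms are built by application from typed variables, $0$, successor, the combinators $\Pi,\Sigma$ and the recursors; equality is primitive at type $0$ and defined extensionally at higher types; it has intuitionistic logic, the defining equations of the constants, the successor axioms, the extensionality axioms and induction. Strong majorizability is the formula defined by: $x\le^*_0y$ is $x\le y$, and $x\le^*_{\rho\to\sigma}y$ is $\forall v\,\forall u\le^*_\rho v\,(xu\le^*_\sigma yv\wedge yu\le^*_\sigma yv)$. An element $x$ is monotone if $x\le^*x$. $\mathsf{E\text{-}HA}^\omega_{\mathrm{st}}$ has the same terms and, in addition, a predicate $\mathrm{st}^\sigma$ for each type. Formulas without $\mathrm{st}$ are called internal. The axioms are those of $\mathsf{E\text{-}HA}^\omega$ (induction for internal formulas only; logic for all formulas), the standardness axioms $x=_\sigma y\to(\mathrm{st}(x)\to\mathrm{st}(y))$, $\mathrm{st}(y)\to(x\le^*_\sigma y\to\mathrm{st}(x))$, $\mathrm{st}(t)$ for closed terms $t$, and $\mathrm{st}(z)\to(\mathrm{st}(x)\to\mathrm{st}(zx))$,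 and the external induction rule: from $\Phi(0)$ and $\forall^{\mathrm{st}}n^0(\Phi(n)\to\Phi(n+1))$ infer $\forall^{\mathrm{st}}n^0\,\Phi(n)$, for arbitrary $\Phi$. The superscript $\mathrm{st}$ on a quantifier relativizes it to standard elements and a tilde relativizes it to monotone elements. A formula is $\tilde\exists^{\mathrm{st}}$-free if it is built from atomic internal formulas by $\wedge,\vee,\to,\forall,\exists$ and $\tilde\forall^{\mathrm{st}}$. Consider the following schemes, where $x,y,z,f$ are finite tuples of variables and $\Phi,\Psi$ are arbitrary formulas, possibly with parameters: * $\mathsf{mAC}^\omega$: $\tilde\forall^{\mathrm{st}}x\,\tilde\exists^{\mathrm{st}}y\,\Phi(x,y)\to\tilde\exists^{\mathrm{st}}f\,\tilde\forall^{\mathrm{st}}x\,\tilde\exists y\le^*fx\,\Phi(x,y)$; * $\mathsf{R}^\omega$: $\forall x\,\exists^{\mathrm{st}}y\,\Phi(x,y)\to\tilde\exists^{\mathrm{st}}z\,\forall x\,\exists y\le^*z\,\Phi(x,y)$; * $\mathsf{IP}^\omega_{\tilde\exists^{\mathrm{st}}\text{-free}}$: $(A\to\tilde\exists^{\mathrm{st}}y\,\Psi(y))\to\tilde\exists^{\mathrm{st}}y\,(A\to\tilde\exists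 z\le^*y\,\Psi(z))$ for $A$ $\tilde\exists^{\mathrm{st}}$-free (and not containing $y$); * $\mathsf{MAJ}^\omega$: $\forall^{\mathrm{st}}x\,\exists^{\mathrm{st}}y\,(x\le^*y)$, for single variables of each type. To every formula $\Phi$ assign a tuple of types and a matrix $\Phi_{\mathrm{bn}}(c)$, with $c$ a tuple of these types (the bounded nonstandard realizability interpretation of $\Phi$ being $\tilde\exists^{\mathrm{st}}c\,\Phi_{\mathrm{bn}}(c)$): * for $\Phi$ atomic internal, the tuple is empty and $\Phi_{\mathrm{bn}}$ is $\Phi$; $\mathrm{st}(t)_{\mathrm{bn}}(c)$ is $t\le^*c$; * $(\Phi\wedge\Psi)_{\mathrm{bn}}(c,d)$ is $\Phi_{\mathrm{bn}}(c)\wedge\Psi_{\mathrm{bn}}(d)$, and $(\Phi\vee\Psi)_{\mathrm{bn}}(c,d)$ is $\Phi_{\mathrm{bn}}(c)\vee\Psi_{\mathrm{bn}}(d)$; * $(\Phi\to\Psi)_{\mathrm{bn}}(f)$ is $\tilde\forall^{\mathrm{st}}c\,[\Phi_{\mathrm{bn}}(c)\to\Psi_{\mathrm{bn}}(fc)]$,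 where the tuple $fc$ is formed by applying each component of $f$ to all of $c$; * $(\forall x\,\Phi(x))_{\mathrm{bn}}(c)$ is $\forall x\,\Phi_{\mathrm{bn}}(x,c)$, and $(\exists x\,\Phi(x))_{\mathrm{bn}}(c)$ is $\exists x\,\Phi_{\mathrm{bn}}(x,c)$. **Theorem (Soundness).** Let $\Phi(z)$ be an arbitrary formula of the language of $\mathsf{E\text{-}HA}^\omega_{\mathrm{st}}$ with free variables $z$, and suppose that $$\mathsf{E\text{-}HA}^\omega_{\mathrm{st}}+\mathsf{mAC}^\omega+\mathsf{R}^\omega+\mathsf{IP}^\omega_{\tilde\exists^{\mathrm{st}}\text{-free}}+\mathsf{MAJ}^\omega\vdash\Phi(z).$$ Then there is a tuple $t$ of closed terms of the appropriate types, each monotone (that is, $\mathsf{E\text{-}HA}^\omega_{\mathrm{st}}\vdash t_i\le^*t_i$ for each component $t_i$), such that $$\mathsf{E\text{-}HA}^\omega_{\mathrm{st}}\vdash\Phi_{\mathrm{bn}}(z,t).$$ -/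

import Mathlib

namespace BNR

/-! ## Finite types, contexts and terms -/

/-- Finite types: the ground type `0` of natural numbers and function types. -/
inductive Ty : Type
  | nat : Ty
  | arr : Ty → Ty → Ty

infixr:60 " ⇒ " => Ty.arr

/-- `arrs [σ₁, …, σₙ] τ` is the type `σ₁ ⇒ … ⇒ σₙ ⇒ τ`. -/
def arrs : List Ty → Ty → Ty
  | [], τ => τ
  | σ :: ρs, τ => σ ⇒ arrs ρs τ

/-- A context: the list of the types of the variables that may occur free. -/
abbrev Ctx : Type := List Ty

/-- `Var Γ σ`: the variables of type `σ` in the context `Γ` (de Bruijn indices). -/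
inductive Var : Ctx → Ty → Type
  | here {Γ : Ctx} {σ : Ty} : Var (σ :: Γ) σ
  | there {Γ : Ctx} {σ τ : Ty} : Var Γ σ → Var (τ :: Γ) σ

/-- The positions of the first list in a concatenation. -/
def Var.left {Γ : Ctx} {σ : Ty} : {ρs : List Ty} → Var ρs σ → Var (ρs ++ Γ) σ
  | _, .here => .here
  | _, .there x => .there x.left

/-- The positions of the second list in a concatenation. -/
def Var.right {Γ : Ctx} {σ : Ty} : (ρs : List Ty) → Var Γ σ → Var (ρs ++ Γ) σ
  | [], x => x
  | _ :: ρs, x => .there (x.right ρs)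

/-- The position in `ρs.map F` that corresponds to a position in `ρs`. -/
def Var.map (F : Ty → Ty) {σ : Ty} : {ρs : List Ty} → Var ρs σ → Var (ρs.map F) (F σ)
  | _, .here => .here
  | _, .there x => .there (x.map F)

/-- The terms of extensional Heyting arithmetic in all finite types: variables, zero, successor,
the combinators `Π` and `Σ`, the recursors, and application. -/
inductive Tm (Γ : Ctx) : Ty → Type
  | var {σ : Ty} : Var Γ σ → Tm Γ σ
  | zero : Tm Γ .nat
  | succ : Tm Γ (.nat ⇒ .nat)
  | combK (σ τ : Ty) : Tm Γ (σ ⇒ τ ⇒ σ)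
  | combS (ρ σ τ : Ty) : Tm Γ ((ρ ⇒ σ ⇒ τ) ⇒ (ρ ⇒ σ) ⇒ ρ ⇒ τ)
  | recur (σ : Ty) : Tm Γ (.nat ⇒ σ ⇒ (σ ⇒ .nat ⇒ σ) ⇒ σ)
  | app {σ τ : Ty} : Tm Γ (σ ⇒ τ) → Tm Γ σ → Tm Γ τ

/-- A substitution assigns to every variable of `Γ` a term of the same type in the context `Δ`. -/
abbrev Sub (Γ Δ : Ctx) : Type := ∀ ⦃σ : Ty⦄, Var Γ σ → Tm Δ σ

/-- A tuple of terms in the context `Γ`, of the types listed in `ρs`. -/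
abbrev Tms (Γ : Ctx) (ρs : List Ty) : Type := Sub ρs Γ

def Tm.subst {Γ Δ : Ctx} (θ : Sub Γ Δ) : {σ : Ty} → Tm Γ σ → Tm Δ σ
  | _, .var x => θ x
  | _, .zero => .zero
  | _, .succ => .succ
  | _, .combK σ τ => .combK σ τ
  | _, .combS ρ σ τ => .combS ρ σ τ
  | _, .recur σ => .recur σ
  | _, .app s t => .app (s.subst θ) (t.subst θ)

namespace Sub

protected def id {Γ : Ctx} : Sub Γ Γ := fun _ x => .var x

/-- First `θ`, then `η`. -/
def comp {Γ Δ Θ : Ctx} (θ : Sub Γ Δ) (η : Sub Δ Θ) : Sub Γ Θ := fun _ x => (θ x).subst η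

/-- Weakening by one variable. -/
def wk {Γ : Ctx} {ρ : Ty} : Sub Γ (ρ :: Γ) := fun _ x => .var x.there

/-- Weakening by a tuple of variables. -/
def wks {Γ : Ctx} (ρs : List Ty) : Sub Γ (ρs ++ Γ) := fun _ x => .var (x.right ρs)

/-- The embedding of closed terms. -/
def empty {Γ : Ctx} : Sub [] Γ := fun _ x => nomatch x

/-- Extend a substitution by a term for one more variable. -/
def cons {Γ Δ : Ctx} {ρ : Ty} (t : Tm Δ ρ) (θ : Sub Γ Δ) : Sub (ρ :: Γ) Δ
  | _, .here => t
  | _, .there x => θ x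

/-- The substitution under one binder. -/
def lift {Γ Δ : Ctx} {ρ : Ty} (θ : Sub Γ Δ) : Sub (ρ :: Γ) (ρ :: Δ) :=
  cons (.var .here) (θ.comp wk)

/-- The substitution under a tuple of binders. -/
def lifts {Γ Δ : Ctx} : (ρs : List Ty) → Sub Γ Δ → Sub (ρs ++ Γ) (ρs ++ Δ)
  | [], θ => θ
  | _ :: ρs, θ => (θ.lifts ρs).lift

end Sub

/-- The tuple of the first variables of the context `ρs ++ Γ`. -/
def vars {Γ : Ctx} (ρs : List Ty) : Tms (ρs ++ Γ) ρs := fun _ x => .var x.left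

/-- Application `t c₁ … cₙ` of a term to a tuple of terms. -/
def Tm.apps {Γ : Ctx} {τ : Ty} : (ρs : List Ty) → Tm Γ (arrs ρs τ) → Tms Γ ρs → Tm Γ τ
  | [], t, _ => t
  | _ :: ρs, t, c => Tm.apps ρs (.app t (c .here)) (fun _ x => c x.there)

/-- Application of a tuple of terms to a tuple of terms: the `i`-th component of the result is
`fᵢ c₁ … cₙ`. -/
def Tms.apps {Γ : Ctx} {ρs τs : List Ty} (f : Tms Γ (τs.map (arrs ρs))) (c : Tms Γ ρs) :
    Tms Γ τs :=
  fun _ x => Tm.apps ρs (f (x.map (arrs ρs))) c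

/-- Addition, `s + t`, by recursion on `t`; the step `Σ (Π Π) S` is `λ r k, S r`. -/
def Tm.add {Γ : Ctx} (s t : Tm Γ .nat) : Tm Γ .nat :=
  .app (.app (.app (.recur .nat) t) s)
    (.app (.app (.combS .nat .nat (.nat ⇒ .nat))
      (.app (.combK (.nat ⇒ .nat ⇒ .nat) .nat) (.combK .nat .nat))) .succ)

/-! ## Formulas -/

/-- Formulas with equality between terms of type `0` and the standardness predicates. -/
inductive Fm : Ctx → Type
  | eq {Γ : Ctx} : Tm Γ .nat → Tm Γ .nat → Fm Γ
  | st {Γ : Ctx} {σ : Ty} : Tm Γ σ → Fm Γ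
  | bot {Γ : Ctx} : Fm Γ
  | and {Γ : Ctx} : Fm Γ → Fm Γ → Fm Γ
  | or {Γ : Ctx} : Fm Γ → Fm Γ → Fm Γ
  | imp {Γ : Ctx} : Fm Γ → Fm Γ → Fm Γ
  | all {Γ : Ctx} (σ : Ty) : Fm (σ :: Γ) → Fm Γ
  | ex {Γ : Ctx} (σ : Ty) : Fm (σ :: Γ) → Fm Γ

namespace Fm

def subst : {Γ : Ctx} → Fm Γ → {Δ : Ctx} → Sub Γ Δ → Fm Δ
  | _, .eq s t, _, θ => .eq (s.subst θ) (t.subst θ)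
  | _, .st t, _, θ => .st (t.subst θ)
  | _, .bot, _, _ => .bot
  | _, .and A B, _, θ => .and (A.subst θ) (B.subst θ)
  | _, .or A B, _, θ => .or (A.subst θ) (B.subst θ)
  | _, .imp A B, _, θ => .imp (A.subst θ) (B.subst θ)
  | _, .all σ A, _, θ => .all σ (A.subst θ.lift)
  | _, .ex σ A, _, θ => .ex σ (A.subst θ.lift)

/-- `A.inst t` is `A(t)`, where `A = A(x)` and `x` is the last variable of the context. -/
def inst {Γ : Ctx} {σ : Ty} (A : Fm (σ :: Γ)) (t : Tm Γ σ) : Fm Γ :=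
  A.subst (Sub.cons t Sub.id)

/-- `A(n + 1)`, in the context in which `A = A(n)` lives. -/
def next {Γ : Ctx} (A : Fm (.nat :: Γ)) : Fm (.nat :: Γ) :=
  A.subst (Sub.cons (.app .succ (.var .here)) Sub.wk)

/-- Internal formulas: the standardness predicates do not occur. -/
def Internal : {Γ : Ctx} → Fm Γ → Prop
  | _, .eq _ _ => True
  | _, .st _ => False
  | _, .bot => True
  | _, .and A B => A.Internal ∧ B.Internal
  | _, .or A B => A.Internal ∧ B.Internal
  | _, .imp A B => A.Internal ∧ B.Internal
  | _, .all _ A => A.Internal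
  | _, .ex _ A => A.Internal

/-- Equality at all types: `x =_{ρ ⇒ σ} y` is `∀ v, x v =_σ y v`. -/
def eqv : {Γ : Ctx} → (σ : Ty) → Tm Γ σ → Tm Γ σ → Fm Γ
  | _, .nat, s, t => .eq s t
  | _, .arr ρ σ, s, t =>
      .all ρ (eqv σ (.app (s.subst Sub.wk) (.var .here)) (.app (t.subst Sub.wk) (.var .here)))

/-- `s ≤ t` at type `0`, that is, `∃ k, s + k = t`. -/
def le {Γ : Ctx} (s t : Tm Γ .nat) : Fm Γ :=
  .ex .nat (.eq (Tm.add (s.subst Sub.wk) (.var .here)) (t.subst Sub.wk))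

/-- Strong majorizability `s ≤* t`: it is `s ≤ t` at type `0`, and at type `ρ ⇒ σ` it is
`∀ v ∀ u ≤* v, s u ≤* t v ∧ t u ≤* t v`. -/
def maj : {Γ : Ctx} → (σ : Ty) → Tm Γ σ → Tm Γ σ → Fm Γ
  | _, .nat, s, t => le s t
  | _, .arr ρ σ, s, t =>
      let s' := (s.subst Sub.wk).subst Sub.wk
      let t' := (t.subst Sub.wk).subst Sub.wk
      let v := Tm.var (.there .here)
      let u := Tm.var .here
      .all ρ (.all ρ (.imp (maj ρ u v)
        (.and (maj σ (.app s' u) (.app t' v)) (maj σ (.app t' u) (.app t' v)))))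

/-- `x` is monotone: `x ≤* x`. -/
def mon {Γ : Ctx} {σ : Ty} (t : Tm Γ σ) : Fm Γ := maj σ t t

/-! ### Relativized quantifiers, for one variable and for tuples of variables

In the tuple versions `A` lives in the context `ρs ++ Γ`. -/

/-- `∀ˢᵗ x, A`. -/
def allSt {Γ : Ctx} {σ : Ty} (A : Fm (σ :: Γ)) : Fm Γ :=
  .all σ (.imp (.st (.var .here)) A)

/-- `∃ˢᵗ x, A`. -/
def exSt {Γ : Ctx} {σ : Ty} (A : Fm (σ :: Γ)) : Fm Γ :=
  .ex σ (.and (.st (.var .here)) A)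

/-- `∀̃ˢᵗ x, A`. -/
def allMonSt {Γ : Ctx} {σ : Ty} (A : Fm (σ :: Γ)) : Fm Γ :=
  .all σ (.imp (.and (.st (.var .here)) (mon (.var .here))) A)

/-- `∃̃ˢᵗ x, A`. -/
def exMonSt {Γ : Ctx} {σ : Ty} (A : Fm (σ :: Γ)) : Fm Γ :=
  .ex σ (.and (.and (.st (.var .here)) (mon (.var .here))) A)

/-- `∃ x ≤* t, A`. -/
def exLe {Γ : Ctx} {σ : Ty} (t : Tm Γ σ) (A : Fm (σ :: Γ)) : Fm Γ :=
  .ex σ (.and (maj σ (.var .here) (t.subst Sub.wk)) A)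

/-- `∃̃ x ≤* t, A`. -/
def exMonLe {Γ : Ctx} {σ : Ty} (t : Tm Γ σ) (A : Fm (σ :: Γ)) : Fm Γ :=
  .ex σ (.and (.and (mon (.var .here)) (maj σ (.var .here) (t.subst Sub.wk))) A)

def alls {Γ : Ctx} : (ρs : List Ty) → Fm (ρs ++ Γ) → Fm Γ
  | [], A => A
  | σ :: ρs, A => alls ρs (.all σ A)

def exSts {Γ : Ctx} : (ρs : List Ty) → Fm (ρs ++ Γ) → Fm Γ
  | [], A => A
  | _ :: ρs, A => exSts ρs (exSt A)

def allMonSts {Γ : Ctx} : (ρs : List Ty) → Fm (ρs ++ Γ) → Fm Γ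
  | [], A => A
  | _ :: ρs, A => allMonSts ρs (allMonSt A)

def exMonSts {Γ : Ctx} : (ρs : List Ty) → Fm (ρs ++ Γ) → Fm Γ
  | [], A => A
  | _ :: ρs, A => exMonSts ρs (exMonSt A)

def exLes {Γ : Ctx} : (ρs : List Ty) → Tms Γ ρs → Fm (ρs ++ Γ) → Fm Γ
  | [], _, A => A
  | _ :: ρs, t, A =>
      exLes ρs (fun _ x => t x.there) (exLe ((t .here).subst (Sub.wks ρs)) A)

def exMonLes {Γ : Ctx} : (ρs : List Ty) → Tms Γ ρs → Fm (ρs ++ Γ) → Fm Γ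
  | [], _, A => A
  | _ :: ρs, t, A =>
      exMonLes ρs (fun _ x => t x.there) (exMonLe ((t .here).subst (Sub.wks ρs)) A)

end Fm

/-- `∃̃ˢᵗ`-free formulas: built from atomic internal formulas by conjunction, disjunction,
implication, quantification and monotone standard universal quantification. -/
inductive ExFree : {Γ : Ctx} → Fm Γ → Prop
  | eq {Γ : Ctx} (s t : Tm Γ .nat) : ExFree (.eq s t)
  | bot {Γ : Ctx} : ExFree (.bot : Fm Γ)
  | and {Γ : Ctx} {A B : Fm Γ} : ExFree A → ExFree B → ExFree (.and A B)
  | or {Γ : Ctx} {A B : Fm Γ} : ExFree A → ExFree B → ExFree (.or A B)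
  | imp {Γ : Ctx} {A B : Fm Γ} : ExFree A → ExFree B → ExFree (.imp A B)
  | all {Γ : Ctx} {σ : Ty} {A : Fm (σ :: Γ)} : ExFree A → ExFree (.all σ A)
  | ex {Γ : Ctx} {σ : Ty} {A : Fm (σ :: Γ)} : ExFree A → ExFree (.ex σ A)
  | allMonSt {Γ : Ctx} {σ : Ty} {A : Fm (σ :: Γ)} : ExFree A → ExFree (Fm.allMonSt A)

/-! ## The theories -/

/-- Axioms of intuitionistic predicate logic. -/
inductive LogicAx : {Γ : Ctx} → Fm Γ → Prop
  | k {Γ : Ctx} (A B : Fm Γ) : LogicAx (.imp A (.imp B A))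
  | s {Γ : Ctx} (A B C : Fm Γ) :
      LogicAx (.imp (.imp A (.imp B C)) (.imp (.imp A B) (.imp A C)))
  | andI {Γ : Ctx} (A B : Fm Γ) : LogicAx (.imp A (.imp B (.and A B)))
  | andL {Γ : Ctx} (A B : Fm Γ) : LogicAx (.imp (.and A B) A)
  | andR {Γ : Ctx} (A B : Fm Γ) : LogicAx (.imp (.and A B) B)
  | orL {Γ : Ctx} (A B : Fm Γ) : LogicAx (.imp A (.or A B))
  | orR {Γ : Ctx} (A B : Fm Γ) : LogicAx (.imp B (.or A B))
  | orE {Γ : Ctx} (A B C : Fm Γ) :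
      LogicAx (.imp (.imp A C) (.imp (.imp B C) (.imp (.or A B) C)))
  | botE {Γ : Ctx} (A : Fm Γ) : LogicAx (.imp .bot A)
  | allE {Γ : Ctx} {σ : Ty} (A : Fm (σ :: Γ)) (t : Tm Γ σ) : LogicAx (.imp (.all σ A) (A.inst t))
  | exI {Γ : Ctx} {σ : Ty} (A : Fm (σ :: Γ)) (t : Tm Γ σ) : LogicAx (.imp (A.inst t) (.ex σ A))

/-- Non-logical axioms of extensional Heyting arithmetic in all finite types. -/
inductive ArithAx : {Γ : Ctx} → Fm Γ → Prop
  | eqRefl {Γ : Ctx} (s : Tm Γ .nat) : ArithAx (.eq s s)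
  | eqSymm {Γ : Ctx} (s t : Tm Γ .nat) : ArithAx (.imp (.eq s t) (.eq t s))
  | eqTrans {Γ : Ctx} (r s t : Tm Γ .nat) :
      ArithAx (.imp (.eq r s) (.imp (.eq s t) (.eq r t)))
  | extensionality {Γ : Ctx} {σ τ : Ty} (z : Tm Γ (σ ⇒ τ)) (x y : Tm Γ σ) :
      ArithAx (.imp (.eqv σ x y) (.eqv τ (.app z x) (.app z y)))
  | succNeZero {Γ : Ctx} (s : Tm Γ .nat) : ArithAx (.imp (.eq (.app .succ s) .zero) .bot)
  | succInj {Γ : Ctx} (s t : Tm Γ .nat) :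
      ArithAx (.imp (.eq (.app .succ s) (.app .succ t)) (.eq s t))
  | combK {Γ : Ctx} {σ τ : Ty} (x : Tm Γ σ) (y : Tm Γ τ) :
      ArithAx (.eqv σ (.app (.app (.combK σ τ) x) y) x)
  | combS {Γ : Ctx} {ρ σ τ : Ty} (x : Tm Γ (ρ ⇒ σ ⇒ τ)) (y : Tm Γ (ρ ⇒ σ)) (z : Tm Γ ρ) :
      ArithAx (.eqv τ (.app (.app (.app (.combS ρ σ τ) x) y) z) (.app (.app x z) (.app y z)))
  | recurZero {Γ : Ctx} {σ : Ty} (y : Tm Γ σ) (z : Tm Γ (σ ⇒ .nat ⇒ σ)) :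
      ArithAx (.eqv σ (.app (.app (.app (.recur σ) .zero) y) z) y)
  | recurSucc {Γ : Ctx} {σ : Ty} (n : Tm Γ .nat) (y : Tm Γ σ) (z : Tm Γ (σ ⇒ .nat ⇒ σ)) :
      ArithAx (.eqv σ (.app (.app (.app (.recur σ) (.app .succ n)) y) z)
        (.app (.app z (.app (.app (.app (.recur σ) n) y) z)) n))
  | induction {Γ : Ctx} (A : Fm (.nat :: Γ)) (hA : A.Internal) :
      ArithAx (.imp (A.inst .zero) (.imp (.all .nat (.imp A A.next)) (.all .nat A)))

/-- The standardness axioms. -/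
inductive StAx : {Γ : Ctx} → Fm Γ → Prop
  | eqv {Γ : Ctx} {σ : Ty} (x y : Tm Γ σ) : StAx (.imp (.eqv σ x y) (.imp (.st x) (.st y)))
  | maj {Γ : Ctx} {σ : Ty} (x y : Tm Γ σ) : StAx (.imp (.st y) (.imp (.maj σ x y) (.st x)))
  | closed {Γ : Ctx} {σ : Ty} (t : Tm [] σ) : StAx (.st (t.subst (Sub.empty : Sub [] Γ)))
  | app {Γ : Ctx} {σ τ : Ty} (z : Tm Γ (σ ⇒ τ)) (x : Tm Γ σ) :
      StAx (.imp (.st z) (.imp (.st x) (.st (.app z x))))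

/-- `Prov Ax A`: the formula `A` is provable in `E-HA^ω_st` together with the additional
axioms `Ax`. -/
inductive Prov (Ax : ∀ Γ : Ctx, Fm Γ → Prop) : {Γ : Ctx} → Fm Γ → Prop
  | logic {Γ : Ctx} {A : Fm Γ} : LogicAx A → Prov Ax A
  | arith {Γ : Ctx} {A : Fm Γ} : ArithAx A → Prov Ax A
  | standard {Γ : Ctx} {A : Fm Γ} : StAx A → Prov Ax A
  | extra {Γ : Ctx} {A : Fm Γ} : Ax Γ A → Prov Ax A
  | mp {Γ : Ctx} {A B : Fm Γ} : Prov Ax (.imp A B) → Prov Ax A → Prov Ax B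
  | allI {Γ : Ctx} {σ : Ty} {A : Fm Γ} {B : Fm (σ :: Γ)} :
      Prov Ax (.imp (A.subst Sub.wk) B) → Prov Ax (.imp A (.all σ B))
  | exE {Γ : Ctx} {σ : Ty} {A : Fm Γ} {B : Fm (σ :: Γ)} :
      Prov Ax (.imp B (A.subst Sub.wk)) → Prov Ax (.imp (.ex σ B) A)
  | extInduction {Γ : Ctx} {A : Fm (.nat :: Γ)} :
      Prov Ax (A.inst .zero) → Prov Ax (Fm.allSt (.imp A A.next)) → Prov Ax (Fm.allSt A)

/-- Provability in `E-HA^ω_st`. -/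
def EHAst {Γ : Ctx} (A : Fm Γ) : Prop := Prov (fun _ _ => False) A

/-! ## The characteristic principles, for tuples of variables

The parameters of an instance are the variables of `Γ`. -/

/-- Monotone choice: `∀̃ˢᵗx ∃̃ˢᵗy Φ(x,y) → ∃̃ˢᵗf ∀̃ˢᵗx ∃̃y ≤* f x, Φ(x,y)`. -/
def mAC {Γ : Ctx} (ρs τs : List Ty) (Φ : Fm (τs ++ (ρs ++ Γ))) : Fm Γ :=
  let fs := τs.map (arrs ρs)
  let f : Tms (ρs ++ (fs ++ Γ)) fs := Sub.comp (vars fs) (Sub.wks ρs)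
  .imp (.allMonSts ρs (.exMonSts τs Φ))
    (.exMonSts fs (.allMonSts ρs (.exMonLes τs (f.apps (vars ρs))
      (Φ.subst (((Sub.wks fs).lifts ρs).lifts τs)))))

/-- Realization: `∀x ∃ˢᵗy Φ(x,y) → ∃̃ˢᵗz ∀x ∃y ≤* z, Φ(x,y)`. -/
def realization {Γ : Ctx} (ρs τs : List Ty) (Φ : Fm (τs ++ (ρs ++ Γ))) : Fm Γ :=
  .imp (.alls ρs (.exSts τs Φ))
    (.exMonSts τs (.alls ρs (.exLes τs (Sub.comp (vars τs) (Sub.wks ρs))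
      (Φ.subst (((Sub.wks τs).lifts ρs).lifts τs)))))

/-- Independence of premises: `(A → ∃̃ˢᵗy Ψ(y)) → ∃̃ˢᵗy (A → ∃̃z ≤* y, Ψ(z))`. -/
def indepPremise {Γ : Ctx} (τs : List Ty) (A : Fm Γ) (Ψ : Fm (τs ++ Γ)) : Fm Γ :=
  .imp (.imp A (.exMonSts τs Ψ))
    (.exMonSts τs (.imp (A.subst (Sub.wks τs))
      (.exMonLes τs (vars τs) (Ψ.subst ((Sub.wks τs).lifts τs)))))

/-- Majorizability axiom: `∀ˢᵗx ∃ˢᵗy, x ≤* y`. -/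
def majAx {Γ : Ctx} (σ : Ty) : Fm Γ :=
  .allSt (σ := σ) (.exSt (σ := σ) (.maj σ (.var (.there .here)) (.var .here)))

/-- All instances of the characteristic principles. -/
inductive CharAx : (Γ : Ctx) → Fm Γ → Prop
  | mAC {Γ : Ctx} (ρs τs : List Ty) (Φ : Fm (τs ++ (ρs ++ Γ))) : CharAx Γ (mAC ρs τs Φ)
  | realization {Γ : Ctx} (ρs τs : List Ty) (Φ : Fm (τs ++ (ρs ++ Γ))) :
      CharAx Γ (realization ρs τs Φ)
  | indepPremise {Γ : Ctx} (τs : List Ty) (A : Fm Γ) (hA : ExFree A) (Ψ : Fm (τs ++ Γ)) :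
      CharAx Γ (indepPremise τs A Ψ)
  | majAx {Γ : Ctx} (σ : Ty) : CharAx Γ (majAx σ)

/-! ## Bounded nonstandard realizability -/

namespace Fm

/-- The types of the tuple `c` in `Φ^bn = ∃̃ˢᵗc Φ_bn(c)`. -/
def bnTypes : {Γ : Ctx} → Fm Γ → List Ty
  | _, .eq _ _ => []
  | _, .st (σ := σ) _ => [σ]
  | _, .bot => []
  | _, .and A B => A.bnTypes ++ B.bnTypes
  | _, .or A B => A.bnTypes ++ B.bnTypes
  | _, .imp A B => B.bnTypes.map (arrs A.bnTypes)
  | _, .all _ A => A.bnTypes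
  | _, .ex _ A => A.bnTypes

/-- The matrix of the interpretation. `Φ.bn θ c` is the formula `Φ_bn(θ, c)`: the matrix `Φ_bn` with
the terms `θ` for the free variables of `Φ` and the tuple of terms `c` for the tuple of realizers. -/
def bn : {Γ : Ctx} → (Φ : Fm Γ) → {Δ : Ctx} → Sub Γ Δ → Tms Δ Φ.bnTypes → Fm Δ
  | _, .eq s t, _, θ, _ => .eq (s.subst θ) (t.subst θ)
  | _, .st (σ := σ) t, _, θ, c => .maj σ (t.subst θ) (c .here)
  | _, .bot, _, _, _ => .bot
  | _, .and A B, _, θ, c =>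
      .and (A.bn θ (fun _ x => c x.left)) (B.bn θ (fun _ x => c (x.right A.bnTypes)))
  | _, .or A B, _, θ, c =>
      .or (A.bn θ (fun _ x => c x.left)) (B.bn θ (fun _ x => c (x.right A.bnTypes)))
  | _, .imp A B, _, θ, f =>
      .allMonSts A.bnTypes
        (.imp (A.bn (θ.comp (Sub.wks A.bnTypes)) (vars A.bnTypes))
          (B.bn (θ.comp (Sub.wks A.bnTypes))
            (Tms.apps (Sub.comp f (Sub.wks A.bnTypes)) (vars A.bnTypes))))
  | _, .all σ A, _, θ, c => .all σ (A.bn θ.lift (Sub.comp c Sub.wk))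
  | _, .ex σ A, _, θ, c => .ex σ (A.bn θ.lift (Sub.comp c Sub.wk))

/-- The interpretation `Φ^bn = ∃̃ˢᵗc Φ_bn(c)`. -/
def bnInterp {Γ : Ctx} (Φ : Fm Γ) : Fm Γ :=
  .exMonSts Φ.bnTypes (Φ.bn (Sub.wks Φ.bnTypes) (vars Φ.bnTypes))

end Fm

end BNR

/-! Realizers are only bounds. The matrix of an interpreted formula stays true when its realizers
are replaced by larger ones in the sense of `≤*` (`Fm.isMatrix_bn`). So a realizer need never be
exact: a β-conversion may be used as a majorization, the cases of a disjunction are covered by a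
maximum instead of being decided, and a recursion may be replaced by a monotone recursion that
dominates it.

Write `X ≤ Y` (`RPred.Le`) if fixed monotone terms turn standard monotone realizers of `X` into
realizers of `Y`. Interpreted formulas then obey the laws of a Heyting algebra, and the quantifiers
are adjoint to weakening because realizers do not depend on the quantified variable. This settles
intuitionistic logic. Internal formulas have no realizers and interpret themselves, which settles
arithmetic. A closed term is standard because it has a closed monotone majorant (`exists_majorant`);
the combinators are monotone themselves, and the recursor is dominated by `Tm.recMax`.

For the external induction rule, `exists_recursion` gives monotone terms `g` such that `g 0` bounds
the realizers of the base and `g (n + 1)` bounds what the step makes of `g n`. That `g n` realizes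
`Φ(n)` for standard `n` is proved by the external induction rule of the target theory, and
monotonicity replaces `g n` by `g c` for any bound `c` of `n`.

Each characteristic principle holds because a realizer of a standard existential contains a bound of
the witness. For monotone choice this bound is abstracted over `x`; in realization it is already
uniform in `x`; in independence of premises it is available before the premise, which has no
realizers; and a realizer of `st(x)` is itself the majorant that the majorizability axiom asks for.

Derivations in the target theory are organized as in Kripke semantics: `Ent H A` is truth at a stage
`H`, and truth persists along `Ext`, since provability is closed under substitution. -/

namespace BNR

/-! ## The calculus of substitutions -/

theorem Tm.subst_subst {Γ Δ Θ : Ctx} (θ : Sub Γ Δ) (η : Sub Δ Θ) {σ : Ty} (t : Tm Γ σ) :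
    (t.subst θ).subst η = t.subst (θ.comp η) := by
  induction t <;> simp_all [Tm.subst, Sub.comp]

theorem Tm.subst_id {Γ : Ctx} {σ : Ty} (t : Tm Γ σ) : t.subst Sub.id = t := by
  induction t <;> simp_all [Tm.subst, Sub.id]

/-- The substitution `c` on the first variables, `θ` on the others. -/
def Sub.append {Γ Δ : Ctx} : {ρs : List Ty} → Tms Δ ρs → Sub Γ Δ → Sub (ρs ++ Γ) Δ
  | [], _, θ => θ
  | _ :: _, c, θ => cons (c .here) (append (fun _ x => c x.there) θ)

/-- The first components of a tuple. -/
def Sub.fst {Δ : Ctx} {ρs τs : List Ty} (c : Tms Δ (ρs ++ τs)) : Tms Δ ρs := fun _ x => c x.left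

/-- The last components of a tuple. -/
def Sub.snd {Δ : Ctx} {ρs τs : List Ty} (c : Tms Δ (ρs ++ τs)) : Tms Δ τs :=
  fun _ x => c (x.right ρs)

theorem Var.append_cases {Γ : Ctx} {ρs : List Ty} {P : ∀ {σ : Ty}, Var (ρs ++ Γ) σ → Prop}
    (hl : ∀ {σ : Ty} (x : Var ρs σ), P (x.left : Var (ρs ++ Γ) σ))
    (hr : ∀ {σ : Ty} (x : Var Γ σ), P (x.right ρs)) {σ : Ty} (x : Var (ρs ++ Γ) σ) : P x := by
  induction ρs with
  | nil => exact hr x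
  | cons ρ ρs ih =>
    cases x with
    | here => exact hl .here
    | there x => exact ih (P := fun y => P (.there y)) (fun y => hl y.there) (fun y => hr y) x

namespace Sub
variable {Γ Δ Θ Ξ : Ctx} {ρ σ : Ty} {ρs τs : List Ty}

theorem comp_assoc (θ : Sub Γ Δ) (η : Sub Δ Θ) (ζ : Sub Θ Ξ) :
    (θ.comp η).comp ζ = θ.comp (η.comp ζ) := by
  funext σ x; exact Tm.subst_subst _ _ _

theorem id_comp (θ : Sub Γ Δ) : Sub.id.comp θ = θ := rfl

theorem comp_id (θ : Sub Γ Δ) : θ.comp Sub.id = θ := by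
  funext σ x; exact Tm.subst_id _

theorem wk_comp_cons (t : Tm Δ ρ) (θ : Sub Γ Δ) : wk.comp (cons t θ) = θ := rfl

theorem cons_comp (t : Tm Δ ρ) (θ : Sub Γ Δ) (η : Sub Δ Θ) :
    (cons t θ).comp η = cons (t.subst η) (θ.comp η) := by
  funext σ x; cases x <;> rfl

theorem cons_eta : cons (.var .here) wk = (Sub.id : Sub (ρ :: Γ) (ρ :: Γ)) := by
  funext σ x; cases x <;> rfl

theorem cons_here_wk_comp (θ : Sub (ρ :: Γ) Δ) : cons (θ .here) (wk.comp θ) = θ := by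
  funext σ x; cases x <;> rfl

theorem empty_comp (θ : Sub Γ Δ) : empty.comp θ = empty := by
  funext σ x; cases x

theorem eq_empty (θ : Sub [] Δ) : θ = empty := by
  funext σ x; cases x

theorem lift_comp (θ : Sub Γ Δ) (η : Sub Δ Θ) :
    (θ.comp η).lift (ρ := ρ) = θ.lift.comp η.lift := by
  simp only [lift, cons_comp, comp_assoc, wk_comp_cons]; rfl

theorem lift_id : (Sub.id : Sub Γ Γ).lift = (Sub.id : Sub (ρ :: Γ) (ρ :: Γ)) := cons_eta

theorem append_left (c : Tms Δ ρs) (θ : Sub Γ Δ) (x : Var ρs σ) : append c θ x.left = c x := by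
  induction x with
  | here => rfl
  | there x ih => exact ih (fun _ y => c y.there)

theorem append_right (c : Tms Δ ρs) (θ : Sub Γ Δ) (x : Var Γ σ) :
    append c θ (x.right ρs) = θ x := by
  induction ρs with
  | nil => rfl
  | cons ρ ρs ih => exact ih (fun _ y => c y.there)

theorem append_ext {θ η : Sub (ρs ++ Γ) Δ}
    (hl : ∀ {σ : Ty} (x : Var ρs σ), θ x.left = η x.left)
    (hr : ∀ {σ : Ty} (x : Var Γ σ), θ (x.right ρs) = η (x.right ρs)) : θ = η := by
  funext σ x
  exact Var.append_cases (P := fun y => θ y = η y) hl hr x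

theorem append_comp (c : Tms Δ ρs) (θ : Sub Γ Δ) (η : Sub Δ Θ) :
    (append c θ).comp η = append (Sub.comp c η) (θ.comp η) :=
  append_ext (fun x => by simp [comp, append_left]) (fun x => by simp [comp, append_right])

theorem wks_comp_append (c : Tms Δ ρs) (θ : Sub Γ Δ) : (wks ρs).comp (append c θ) = θ := by
  funext σ x; exact append_right c θ x

theorem vars_comp_append (c : Tms Δ ρs) (θ : Sub Γ Δ) : Sub.comp (vars ρs) (append c θ) = c := by
  funext σ x; exact append_left c θ x

theorem fst_append (c : Tms Δ ρs) (θ : Sub τs Δ) : fst (append c θ) = c := by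
  funext σ x; exact append_left c θ x

theorem snd_append (c : Tms Δ ρs) (θ : Sub τs Δ) : snd (append c θ) = θ := by
  funext σ x; exact append_right c θ x

theorem fst_comp (c : Tms Δ (ρs ++ τs)) (η : Sub Δ Θ) :
    fst (Sub.comp c η) = Sub.comp (fst c) η := rfl

theorem snd_comp (c : Tms Δ (ρs ++ τs)) (η : Sub Δ Θ) :
    snd (Sub.comp c η) = Sub.comp (snd c) η := rfl

theorem lifts_eq (θ : Sub Γ Δ) : θ.lifts ρs = append (vars ρs) (θ.comp (wks ρs)) := by
  induction ρs with
  | nil => exact (comp_id θ).symm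
  | cons ρ ρs ih =>
    simp only [lifts, lift, ih, append, append_comp, comp_assoc]
    rfl

theorem lifts_comp_append (θ : Sub Γ Δ) (η : Sub Δ Θ) (c : Tms Θ ρs) :
    (θ.lifts ρs).comp (append c η) = append c (θ.comp η) := by
  simp only [lifts_eq, append_comp, comp_assoc, wks_comp_append, vars_comp_append]

theorem lift_comp_cons (θ : Sub Γ Δ) (η : Sub Δ Θ) (t : Tm Θ ρ) :
    θ.lift.comp (cons t η) = cons t (θ.comp η) := by
  simp only [lift, cons_comp, comp_assoc, wk_comp_cons]; rfl

end Sub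

theorem Tm.subst_wk_cons {Γ Δ : Ctx} {ρ σ : Ty} (s : Tm Γ σ) (t : Tm Δ ρ) (θ : Sub Γ Δ) :
    (s.subst Sub.wk).subst (Sub.cons t θ) = s.subst θ := by
  rw [Tm.subst_subst, Sub.wk_comp_cons]

theorem Tm.subst_wk_lift {Γ Δ : Ctx} {ρ σ : Ty} (s : Tm Γ σ) (θ : Sub Γ Δ) :
    (s.subst (Sub.wk (ρ := ρ))).subst θ.lift = (s.subst θ).subst Sub.wk := by
  rw [Tm.subst_subst, Tm.subst_subst]; rfl

theorem Tm.apps_subst {Γ Δ : Ctx} {τ : Ty} {ρs : List Ty} (t : Tm Γ (arrs ρs τ)) (c : Tms Γ ρs)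
    (θ : Sub Γ Δ) : (Tm.apps ρs t c).subst θ = Tm.apps ρs (t.subst θ) (Sub.comp c θ) := by
  induction ρs with
  | nil => rfl
  | cons ρ ρs ih => exact ih _ _

theorem Tms.apps_comp {Γ Δ : Ctx} {ρs τs : List Ty} (f : Tms Γ (τs.map (arrs ρs))) (c : Tms Γ ρs)
    (θ : Sub Γ Δ) : Sub.comp (f.apps c) θ = Tms.apps (Sub.comp f θ) (Sub.comp c θ) := by
  funext σ x; exact Tm.apps_subst _ _ _

theorem Tm.add_subst {Γ Δ : Ctx} (s t : Tm Γ .nat) (θ : Sub Γ Δ) :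
    (Tm.add s t).subst θ = Tm.add (s.subst θ) (t.subst θ) := rfl

namespace Fm
variable {Γ Δ Θ : Ctx} {ρ σ : Ty} {ρs τs : List Ty}

theorem subst_subst (A : Fm Γ) (θ : Sub Γ Δ) (η : Sub Δ Θ) :
    (A.subst θ).subst η = A.subst (θ.comp η) := by
  induction A generalizing Δ Θ with
  | eq s t => simp [subst, Tm.subst_subst]
  | st t => simp [subst, Tm.subst_subst]
  | bot => rfl
  | and A B ihA ihB => simp [subst, ihA, ihB]
  | or A B ihA ihB => simp [subst, ihA, ihB]
  | imp A B ihA ihB => simp [subst, ihA, ihB]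
  | all σ A ih => simp [subst, ih, Sub.lift_comp]
  | ex σ A ih => simp [subst, ih, Sub.lift_comp]

theorem subst_id (A : Fm Γ) : A.subst Sub.id = A := by
  induction A with
  | eq s t => simp [subst, Tm.subst_id]
  | st t => simp [subst, Tm.subst_id]
  | bot => rfl
  | and A B ihA ihB => simp [subst, ihA, ihB]
  | or A B ihA ihB => simp [subst, ihA, ihB]
  | imp A B ihA ihB => simp [subst, ihA, ihB]
  | all σ A ih => simp [subst, ih, Sub.lift_id]
  | ex σ A ih => simp [subst, ih, Sub.lift_id]

theorem subst_wk_lift (A : Fm Γ) (θ : Sub Γ Δ) :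
    (A.subst (Sub.wk (ρ := ρ))).subst θ.lift = (A.subst θ).subst Sub.wk := by
  rw [subst_subst, subst_subst]; rfl

theorem inst_subst (A : Fm (σ :: Γ)) (t : Tm Γ σ) (θ : Sub Γ Δ) :
    (A.inst t).subst θ = (A.subst θ.lift).inst (t.subst θ) := by
  simp only [inst, subst_subst, Sub.cons_comp, Sub.lift_comp_cons, Sub.id_comp, Sub.comp_id]

theorem next_subst (A : Fm (.nat :: Γ)) (θ : Sub Γ Δ) :
    A.next.subst θ.lift = (A.subst θ.lift).next := by
  simp only [next, subst_subst, Sub.lift_comp_cons, Sub.cons_comp]; rfl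

theorem eqv_subst (s t : Tm Γ σ) (θ : Sub Γ Δ) :
    (eqv σ s t).subst θ = eqv σ (s.subst θ) (t.subst θ) := by
  induction σ generalizing Γ Δ with
  | nat => rfl
  | arr ρ σ _ ih => simp only [eqv, subst, ih, Tm.subst, Tm.subst_wk_lift]; rfl

theorem maj_subst (s t : Tm Γ σ) (θ : Sub Γ Δ) :
    (maj σ s t).subst θ = maj σ (s.subst θ) (t.subst θ) := by
  induction σ generalizing Γ Δ with
  | nat => simp only [maj, le, subst, Tm.add_subst, Tm.subst_wk_lift]; rfl
  | arr ρ σ ih₁ ih₂ => simp only [maj, subst, ih₁, ih₂, Tm.subst, Tm.subst_wk_lift]; rfl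

theorem mon_subst (t : Tm Γ σ) (θ : Sub Γ Δ) : (mon t).subst θ = mon (t.subst θ) :=
  maj_subst _ _ _

theorem allSt_subst (A : Fm (σ :: Γ)) (θ : Sub Γ Δ) :
    (allSt A).subst θ = allSt (A.subst θ.lift) := rfl

theorem allMonSt_subst (A : Fm (σ :: Γ)) (θ : Sub Γ Δ) :
    (allMonSt A).subst θ = allMonSt (A.subst θ.lift) := by
  simp only [allMonSt, subst, mon_subst]; rfl

theorem allMonSts_subst (A : Fm (ρs ++ Γ)) (θ : Sub Γ Δ) :
    (allMonSts ρs A).subst θ = allMonSts ρs (A.subst (θ.lifts ρs)) := by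
  induction ρs with
  | nil => rfl
  | cons ρ ρs ih => simp only [allMonSts, ih, allMonSt_subst]; rfl

theorem Internal.subst {A : Fm Γ} (hA : A.Internal) (θ : Sub Γ Δ) : (A.subst θ).Internal := by
  induction A generalizing Δ with
  | eq s t => trivial
  | st t => exact hA.elim
  | bot => trivial
  | and A B ihA ihB => exact ⟨ihA hA.1 θ, ihB hA.2 θ⟩
  | or A B ihA ihB => exact ⟨ihA hA.1 θ, ihB hA.2 θ⟩
  | imp A B ihA ihB => exact ⟨ihA hA.1 θ, ihB hA.2 θ⟩
  | all σ A ih => exact ih hA _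
  | ex σ A ih => exact ih hA _

theorem eqv_internal (s t : Tm Γ σ) : (eqv σ s t).Internal := by
  induction σ generalizing Γ with
  | nat => trivial
  | arr ρ σ _ ih => exact ih _ _

theorem maj_internal (s t : Tm Γ σ) : (maj σ s t).Internal := by
  induction σ generalizing Γ with
  | nat => trivial
  | arr ρ σ ih₁ ih₂ => exact ⟨ih₁ _ _, ih₂ _ _, ih₂ _ _⟩

end Fm

/-! ## Provability is closed under substitution -/

theorem LogicAx.subst {Γ Δ : Ctx} {A : Fm Γ} (h : LogicAx A) (θ : Sub Γ Δ) :
    LogicAx (A.subst θ) := by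
  cases h with
  | k => exact .k _ _
  | s => exact .s _ _ _
  | andI => exact .andI _ _
  | andL => exact .andL _ _
  | andR => exact .andR _ _
  | orL => exact .orL _ _
  | orR => exact .orR _ _
  | orE => exact .orE _ _ _
  | botE => exact .botE _
  | allE A t => simp only [Fm.subst, Fm.inst_subst]; exact .allE _ _
  | exI A t => simp only [Fm.subst, Fm.inst_subst]; exact .exI _ _

theorem ArithAx.subst {Γ Δ : Ctx} {A : Fm Γ} (h : ArithAx A) (θ : Sub Γ Δ) :
    ArithAx (A.subst θ) := by
  cases h with
  | eqRefl => exact .eqRefl _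
  | eqSymm => exact .eqSymm _ _
  | eqTrans => exact .eqTrans _ _ _
  | extensionality z x y =>
    simp only [Fm.subst, Fm.eqv_subst]; exact .extensionality _ _ _
  | succNeZero => exact .succNeZero _
  | succInj => exact .succInj _ _
  | combK => simp only [Fm.eqv_subst]; exact .combK _ _
  | combS => simp only [Fm.eqv_subst]; exact .combS _ _ _
  | recurZero => simp only [Fm.eqv_subst]; exact .recurZero _ _
  | recurSucc => simp only [Fm.eqv_subst]; exact .recurSucc _ _ _
  | induction A hA =>
    simp only [Fm.subst, Fm.inst_subst, Fm.next_subst]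
    exact .induction _ (hA.subst _)

theorem StAx.subst {Γ Δ : Ctx} {A : Fm Γ} (h : StAx A) (θ : Sub Γ Δ) : StAx (A.subst θ) := by
  cases h with
  | eqv => simp only [Fm.subst, Fm.eqv_subst]; exact .eqv _ _
  | maj => simp only [Fm.subst, Fm.maj_subst]; exact .maj _ _
  | closed t => simp only [Fm.subst, Tm.subst_subst, Sub.empty_comp]; exact .closed _
  | app => exact .app _ _

/-- All axiom schemes are stable under substitution, so a derivation can be substituted step by
step. This is the persistence of truth on passing to a later stage. -/
theorem EHAst.subst {Γ Δ : Ctx} {A : Fm Γ} (h : EHAst A) (θ : Sub Γ Δ) : EHAst (A.subst θ) := by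
  unfold EHAst at *
  induction h generalizing Δ with
  | logic h => exact .logic (h.subst θ)
  | arith h => exact .arith (h.subst θ)
  | standard h => exact .standard (h.subst θ)
  | extra h => exact h.elim
  | mp _ _ ih₁ ih₂ => exact .mp (ih₁ θ) (ih₂ θ)
  | allI _ ih =>
    refine .allI ?_
    have := ih θ.lift
    rwa [Fm.subst, Fm.subst_wk_lift] at this
  | exE _ ih =>
    refine .exE ?_
    have := ih θ.lift
    rwa [Fm.subst, Fm.subst_wk_lift] at this
  | extInduction _ _ ih₁ ih₂ =>
    refine .extInduction ?_ ?_
    · have := ih₁ θ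
      rwa [Fm.inst_subst] at this
    · have := ih₂ θ
      rwa [Fm.allSt_subst, Fm.subst, Fm.next_subst] at this

@[simp] theorem Sub.cons_here {Γ Δ : Ctx} {ρ : Ty} (t : Tm Δ ρ) (θ : Sub Γ Δ) :
    Sub.cons t θ .here = t := rfl

@[simp] theorem Sub.cons_there {Γ Δ : Ctx} {ρ σ : Ty} (t : Tm Δ ρ) (θ : Sub Γ Δ) (x : Var Γ σ) :
    Sub.cons t θ x.there = θ x := rfl

@[simp] theorem Sub.lift_here {Γ Δ : Ctx} {ρ : Ty} (θ : Sub Γ Δ) :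
    (θ.lift (ρ := ρ)) .here = .var .here := rfl

@[simp] theorem Sub.lift_there {Γ Δ : Ctx} {ρ σ : Ty} (θ : Sub Γ Δ) (x : Var Γ σ) :
    (θ.lift (ρ := ρ)) x.there = (θ x).subst Sub.wk := rfl

attribute [simp] Tm.subst Fm.subst Tm.subst_subst Tm.subst_id Fm.subst_subst Fm.subst_id
  Sub.id_comp Sub.comp_id Sub.wk_comp_cons Sub.cons_comp Sub.cons_eta Sub.empty_comp Sub.comp_assoc
  Tm.add_subst Fm.eqv_subst Fm.maj_subst Fm.mon_subst Sub.append_comp Sub.wks_comp_append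
  Sub.vars_comp_append Sub.append_left Sub.append_right Sub.lift_comp_cons
  Sub.lifts_comp_append Sub.fst_append Sub.snd_append

/-! ## Entailment -/

/-- `H` entails `A` in `E-HA^ω_st`. -/
def Ent {Γ : Ctx} (H A : Fm Γ) : Prop := EHAst (.imp H A)

/-- `H'` is a stage of knowledge that extends `H` along the substitution `η`. -/
def Ext {Γ Δ : Ctx} (H : Fm Γ) (H' : Fm Δ) (η : Sub Γ Δ) : Prop := Ent H' (H.subst η)

theorem EHAst.mp {Γ : Ctx} {A B : Fm Γ} (h : EHAst (.imp A B)) (h' : EHAst A) : EHAst B :=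
  Prov.mp h h'

namespace Ent
variable {Γ Δ Θ : Ctx} {H H' A B C : Fm Γ} {σ τ : Ty}

theorem of (h : EHAst A) : Ent H A := EHAst.mp (.logic (.k _ _)) h

theorem mp (h : Ent H (.imp A B)) (h' : Ent H A) : Ent H B :=
  EHAst.mp (EHAst.mp (.logic (.s _ _ _)) h) h'

theorem logic (h : LogicAx A) : Ent H A := of (.logic h)
theorem arith (h : ArithAx A) : Ent H A := of (.arith h)
theorem standard (h : StAx A) : Ent H A := of (.standard h)

theorem refl : Ent H H :=
  EHAst.mp (EHAst.mp (.logic (.s H (.imp H H) H)) (.logic (.k _ _))) (.logic (.k _ _))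

theorem cut (h : Ent H A) (h' : Ent A B) : Ent H B := mp (of h') h

theorem and_left (h : Ent H (.and A B)) : Ent H A := mp (logic (.andL _ _)) h
theorem and_right (h : Ent H (.and A B)) : Ent H B := mp (logic (.andR _ _)) h
theorem and_intro (h : Ent H A) (h' : Ent H B) : Ent H (.and A B) :=
  mp (mp (logic (.andI _ _)) h) h'

theorem curry (h : Ent (.and H A) B) : Ent H (.imp A B) :=
  have h₁ : Ent H (.imp A (.imp (.and H A) B)) := of (of h)
  have h₂ : Ent H (.imp A (.and H A)) := Prov.logic (.andI _ _)
  mp (mp (logic (.s _ _ _)) h₁) h₂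

theorem imp_intro (h : ∀ H' : Fm Γ, Ent H' H → Ent H' A → Ent H' B) : Ent H (.imp A B) :=
  curry (h _ (and_left refl) (and_right refl))

theorem or_left (h : Ent H A) : Ent H (.or A B) := mp (logic (.orL _ _)) h
theorem or_right (h : Ent H B) : Ent H (.or A B) := mp (logic (.orR _ _)) h
theorem or_elim (h : Ent H (.or A B)) (hA : ∀ H' : Fm Γ, Ent H' H → Ent H' A → Ent H' C)
    (hB : ∀ H' : Fm Γ, Ent H' H → Ent H' B → Ent H' C) : Ent H C :=
  mp (mp (mp (logic (.orE _ _ _)) (imp_intro hA)) (imp_intro hB)) h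

theorem bot_elim (h : Ent H .bot) : Ent H A := mp (logic (.botE _)) h

theorem subst (h : Ent H A) (θ : Sub Γ Δ) : Ent (H.subst θ) (A.subst θ) := EHAst.subst h θ

theorem ext (h : Ent H A) {H' : Fm Δ} {η : Sub Γ Δ} (e : Ext H H' η) : Ent H' (A.subst η) :=
  cut e (h.subst η)

theorem all_elim {A : Fm (σ :: Γ)} (h : Ent H (.all σ A)) (t : Tm Γ σ) :
    Ent H (A.subst (Sub.cons t Sub.id)) := mp (logic (.allE _ _)) h

/-- Only the generic stage, with one fresh variable, is used. Asking for all later stages and all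
terms lets applications avoid weakening by hand. -/
theorem all_intro {A : Fm (σ :: Γ)}
    (h : ∀ (Δ : Ctx) (H' : Fm Δ) (η : Sub Γ Δ), Ext H H' η → ∀ t : Tm Δ σ,
      Ent H' (A.subst (Sub.cons t η))) : Ent H (.all σ A) := by
  refine Prov.allI ?_
  have := h _ (H.subst Sub.wk) Sub.wk refl (.var .here)
  rw [Sub.cons_eta, Fm.subst_id] at this
  exact this

theorem ex_intro {A : Fm (σ :: Γ)} (t : Tm Γ σ) (h : Ent H (A.subst (Sub.cons t Sub.id))) :
    Ent H (.ex σ A) := mp (logic (.exI _ _)) h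

theorem ex_elim {A : Fm (σ :: Γ)} (h : Ent H (.ex σ A))
    (hA : ∀ (Δ : Ctx) (H' : Fm Δ) (η : Sub Γ Δ), Ext H H' η → ∀ t : Tm Δ σ,
      Ent H' (A.subst (Sub.cons t η)) → Ent H' (C.subst η)) : Ent H C := by
  -- The rule for `∃` in the calculus has no side hypotheses, so `H` is moved into the conclusion
  -- and discharged afterwards.
  refine mp (?_ : Ent H (.imp H C)) refl
  refine mp (of (Prov.exE (A := .imp H C) ?_)) h
  have := hA (σ :: Γ) (.and A (H.subst Sub.wk)) Sub.wk (and_right refl) (.var .here)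
    (by simpa using and_left refl)
  exact curry this

end Ent

namespace Ext
variable {Γ Δ Θ : Ctx}

theorem comp {H : Fm Γ} {H' : Fm Δ} {H'' : Fm Θ} {η : Sub Γ Δ} {ζ : Sub Δ Θ} (e : Ext H H' η)
    (e' : Ext H' H'' ζ) : Ext H H'' (η.comp ζ) := by
  have := Ent.ext e e'
  rwa [Fm.subst_subst] at this

theorem refl (H : Fm Γ) : Ext H H Sub.id := by
  unfold Ext; rw [Fm.subst_id]; exact Ent.refl

theorem of_ent {H H' : Fm Γ} (h : Ent H' H) : Ext H H' Sub.id := by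
  unfold Ext; rwa [Fm.subst_id]

end Ext

/-! ## Equality and majorizability at all types -/

namespace Ent
variable {Γ Δ : Ctx} {H : Fm Γ} {ρ σ τ : Ty}

theorem eqv_intro {s t : Tm Γ (ρ ⇒ σ)}
    (h : ∀ (Δ : Ctx) (H' : Fm Δ) (η : Sub Γ Δ), Ext H H' η → ∀ u : Tm Δ ρ,
      Ent H' (.eqv σ (.app (s.subst η) u) (.app (t.subst η) u))) : Ent H (.eqv (ρ ⇒ σ) s t) := by
  refine all_intro fun Δ H' η e u => ?_
  simpa using h Δ H' η e u

theorem eqv_elim {s t : Tm Γ (ρ ⇒ σ)} (h : Ent H (.eqv (ρ ⇒ σ) s t)) (u : Tm Γ ρ) :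
    Ent H (.eqv σ (.app s u) (.app t u)) := by
  simpa using all_elim h u

theorem maj_intro {s t : Tm Γ (ρ ⇒ σ)}
    (h : ∀ (Δ : Ctx) (H' : Fm Δ) (η : Sub Γ Δ), Ext H H' η → ∀ u v : Tm Δ ρ,
      Ent H' (.maj ρ u v) → Ent H' (.maj σ (.app (s.subst η) u) (.app (t.subst η) v)) ∧
        Ent H' (.maj σ (.app (t.subst η) u) (.app (t.subst η) v))) :
    Ent H (.maj (ρ ⇒ σ) s t) := by
  refine all_intro fun Δ₁ H₁ η₁ e₁ v => all_intro fun Δ₂ H₂ η₂ e₂ u => imp_intro fun H₃ h₃ huv => ?_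
  have e₃ := (e₁.comp e₂).comp (Ext.of_ent h₃)
  have := h _ _ _ e₃ u (v.subst η₂) (by simpa using huv)
  refine and_intro ?_ ?_
  · simpa using this.1
  · simpa using this.2

theorem maj_app {s t : Tm Γ (ρ ⇒ σ)} {u v : Tm Γ ρ} (h : Ent H (.maj (ρ ⇒ σ) s t))
    (h' : Ent H (.maj ρ u v)) : Ent H (.maj σ (.app s u) (.app t v)) := by
  have := all_elim (all_elim h v) u
  simp only [Fm.subst] at this
  have := and_left (mp this (by simpa using h'))
  simpa using this

theorem maj_app_right {s t : Tm Γ (ρ ⇒ σ)} {u v : Tm Γ ρ} (h : Ent H (.maj (ρ ⇒ σ) s t))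
    (h' : Ent H (.maj ρ u v)) : Ent H (.maj σ (.app t u) (.app t v)) := by
  have := all_elim (all_elim h v) u
  simp only [Fm.subst] at this
  have := and_right (mp this (by simpa using h'))
  simpa using this

theorem ext_maj {s t : Tm Γ σ} (h : Ent H (.maj σ s t)) {H' : Fm Δ} {η : Sub Γ Δ}
    (e : Ext H H' η) : Ent H' (.maj σ (s.subst η) (t.subst η)) := by
  simpa using h.ext e

theorem ext_eqv {s t : Tm Γ σ} (h : Ent H (.eqv σ s t)) {H' : Fm Δ} {η : Sub Γ Δ}
    (e : Ext H H' η) : Ent H' (.eqv σ (s.subst η) (t.subst η)) := by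
  simpa using h.ext e

theorem eqv_refl (t : Tm Γ σ) : Ent H (.eqv σ t t) := by
  induction σ generalizing Γ with
  | nat => exact arith (.eqRefl t)
  | arr ρ σ _ ih => exact eqv_intro fun _ _ _ _ _ => ih _

theorem eqv_symm {s t : Tm Γ σ} (h : Ent H (.eqv σ s t)) : Ent H (.eqv σ t s) := by
  induction σ generalizing Γ with
  | nat => exact mp (arith (.eqSymm s t)) h
  | arr ρ σ _ ih => exact eqv_intro fun _ _ _ e _ => ih (eqv_elim (h.ext_eqv e) _)

theorem eqv_trans {r s t : Tm Γ σ} (h : Ent H (.eqv σ r s)) (h' : Ent H (.eqv σ s t)) :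
    Ent H (.eqv σ r t) := by
  induction σ generalizing Γ with
  | nat => exact mp (mp (arith (.eqTrans r s t)) h) h'
  | arr ρ σ _ ih =>
    exact eqv_intro fun _ _ _ e _ => ih (eqv_elim (h.ext_eqv e) _) (eqv_elim (h'.ext_eqv e) _)

theorem eqv_app {s t : Tm Γ (ρ ⇒ σ)} {u v : Tm Γ ρ} (h : Ent H (.eqv (ρ ⇒ σ) s t))
    (h' : Ent H (.eqv ρ u v)) : Ent H (.eqv σ (.app s u) (.app t v)) :=
  eqv_trans (mp (arith (.extensionality s u v)) h') (eqv_elim h v)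

theorem eqv_subst_congr (t : Tm Γ σ) {H : Fm Δ} {θ η : Sub Γ Δ}
    (h : ∀ ⦃ρ⦄ (x : Var Γ ρ), Ent H (.eqv ρ (θ x) (η x))) :
    Ent H (.eqv σ (t.subst θ) (t.subst η)) := by
  induction t with
  | var x => exact h x
  | app s t ihs iht => exact eqv_app ihs iht
  | _ => exact eqv_refl _

theorem eqv_apps {ρs : List Ty} {s t : Tm Γ (arrs ρs τ)} (h : Ent H (.eqv _ s t)) (c : Tms Γ ρs) :
    Ent H (.eqv τ (Tm.apps ρs s c) (Tm.apps ρs t c)) := by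
  induction ρs with
  | nil => exact h
  | cons ρ ρs ih => exact ih (eqv_elim h _) _

/-! ### Addition and the order at type `0` -/

theorem add_zero (s : Tm Γ .nat) : Ent H (.eqv .nat (s.add .zero) s) := arith (.recurZero _ _)

theorem add_succ (s t : Tm Γ .nat) :
    Ent H (.eqv .nat (s.add (.app .succ t)) (.app .succ (s.add t))) := by
  refine eqv_trans (arith (.recurSucc t s _)) ?_
  refine eqv_trans (eqv_elim (arith (.combS _ _ _)) _) ?_
  refine eqv_trans (eqv_elim (eqv_elim (arith (.combK _ _)) _) _) ?_
  exact arith (.combK _ _)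

end Ent
namespace Ent
variable {Γ Δ : Ctx} {H : Fm Γ} {ρ σ τ : Ty}

theorem induction (A : Fm (.nat :: Γ)) (hA : A.Internal)
    (h₀ : Ent H (A.subst (Sub.cons .zero Sub.id)))
    (hS : ∀ (Δ : Ctx) (H' : Fm Δ) (η : Sub Γ Δ), Ext H H' η → ∀ n : Tm Δ .nat,
      Ent H' (A.subst (Sub.cons n η)) → Ent H' (A.subst (Sub.cons (.app .succ n) η)))
    (n : Tm Γ .nat) : Ent H (A.subst (Sub.cons n Sub.id)) := by
  refine all_elim (mp (mp (arith (.induction A hA)) h₀) (all_intro fun Δ₁ H₁ η e m => ?_)) n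
  refine imp_intro fun H₂ h₂ hm => ?_
  have := hS _ H₂ η (h₂.cut e) m hm
  simpa [Fm.next] using this

theorem eqv_succ {s t : Tm Γ .nat} (h : Ent H (.eqv .nat s t)) :
    Ent H (.eqv .nat (.app .succ s) (.app .succ t)) := eqv_app (eqv_refl _) h

theorem eqv_add {s s' t t' : Tm Γ .nat} (h : Ent H (.eqv .nat s s'))
    (h' : Ent H (.eqv .nat t t')) : Ent H (.eqv .nat (s.add t) (s'.add t')) :=
  eqv_app (eqv_app (eqv_app (eqv_refl _) h') h) (eqv_refl _)

theorem zero_add (t : Tm Γ .nat) : Ent H (.eqv .nat (Tm.add .zero t) t) := by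
  have := induction (H := H) (.eqv .nat (Tm.add .zero (.var .here)) (.var .here)) trivial
    (by simpa using add_zero _)
    (fun Δ H' η e n ih => by
      simp at ih ⊢
      exact eqv_trans (add_succ _ _) (eqv_succ ih)) t
  simpa using this

theorem succ_add (s t : Tm Γ .nat) :
    Ent H (.eqv .nat (Tm.add (.app .succ s) t) (.app .succ (s.add t))) := by
  have := induction (H := H) (.eqv .nat (Tm.add (.app .succ (s.subst Sub.wk)) (.var .here))
    (.app .succ ((s.subst Sub.wk).add (.var .here)))) trivial
    (by simpa using eqv_trans (add_zero _) (eqv_succ (eqv_symm (add_zero _))))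
    (fun Δ H' η e n ih => by
      simp at ih ⊢
      exact eqv_trans (add_succ _ _) (eqv_succ (eqv_trans ih (eqv_symm (add_succ _ _))))) t
  simpa using this

theorem add_comm (s t : Tm Γ .nat) : Ent H (.eqv .nat (s.add t) (t.add s)) := by
  have := induction (H := H) (.eqv .nat ((s.subst Sub.wk).add (.var .here))
    (Tm.add (.var .here) (s.subst Sub.wk))) trivial
    (by simpa using eqv_trans (add_zero _) (eqv_symm (zero_add _)))
    (fun Δ H' η e n ih => by
      simp at ih ⊢
      exact eqv_trans (add_succ _ _) (eqv_trans (eqv_succ ih) (eqv_symm (succ_add _ _)))) t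
  simpa using this

theorem add_assoc (r s t : Tm Γ .nat) :
    Ent H (.eqv .nat ((r.add s).add t) (r.add (s.add t))) := by
  have := induction (H := H) (.eqv .nat
    (((r.subst Sub.wk).add (s.subst Sub.wk)).add (.var .here))
    ((r.subst Sub.wk).add ((s.subst Sub.wk).add (.var .here)))) trivial
    (by simpa using eqv_trans (add_zero _) (eqv_add (eqv_refl _) (eqv_symm (add_zero _))))
    (fun Δ H' η e n ih => by
      simp at ih ⊢
      refine eqv_trans (add_succ _ _) (eqv_trans (eqv_succ ih) ?_)
      exact eqv_symm (eqv_trans (eqv_add (eqv_refl _) (add_succ _ _)) (add_succ _ _))) t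
  simpa using this

theorem add_add_add_comm (a b c d : Tm Γ .nat) :
    Ent H (.eqv .nat ((a.add b).add (c.add d)) ((a.add c).add (b.add d))) := by
  refine eqv_trans (add_assoc _ _ _) (eqv_trans (eqv_add (eqv_refl _) ?_)
    (eqv_symm (add_assoc _ _ _)))
  exact eqv_trans (eqv_symm (add_assoc _ _ _)) (eqv_trans (eqv_add (add_comm _ _) (eqv_refl _))
    (add_assoc _ _ _))

theorem le_intro {s t : Tm Γ .nat} (k : Tm Γ .nat) (h : Ent H (.eqv .nat (s.add k) t)) :
    Ent H (.maj .nat s t) := ex_intro k (by simpa [Fm.eqv] using h)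

theorem le_elim {s t : Tm Γ .nat} {C : Fm Γ} (h : Ent H (.maj .nat s t))
    (hC : ∀ (Δ : Ctx) (H' : Fm Δ) (η : Sub Γ Δ), Ext H H' η → ∀ k : Tm Δ .nat,
      Ent H' (.eqv .nat ((s.subst η).add k) (t.subst η)) → Ent H' (C.subst η)) : Ent H C :=
  ex_elim h fun Δ H' η e k hk => hC Δ H' η e k (by simpa [Fm.eqv] using hk)

theorem le_refl (s : Tm Γ .nat) : Ent H (.maj .nat s s) := le_intro .zero (add_zero s)

theorem le_trans {r s t : Tm Γ .nat} (h : Ent H (.maj .nat r s)) (h' : Ent H (.maj .nat s t)) :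
    Ent H (.maj .nat r t) := by
  refine le_elim h fun Δ₁ H₁ η₁ e₁ k hk => ?_
  have h' := h'.ext_maj e₁
  rw [Fm.maj_subst]
  refine le_elim h' fun Δ₂ H₂ η₂ e₂ l hl => ?_
  have hk := hk.ext_eqv e₂
  simp at hk hl ⊢
  refine le_intro ((k.subst η₂).add l) ?_
  exact eqv_trans (eqv_symm (add_assoc _ _ _)) (eqv_trans (eqv_add hk (eqv_refl _)) hl)

theorem le_add_right (s t : Tm Γ .nat) : Ent H (.maj .nat s (s.add t)) := le_intro t (eqv_refl _)

theorem le_add_left (s t : Tm Γ .nat) : Ent H (.maj .nat t (s.add t)) :=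
  le_intro s (add_comm _ _)

theorem add_le_add {a b c d : Tm Γ .nat} (h : Ent H (.maj .nat a b)) (h' : Ent H (.maj .nat c d)) :
    Ent H (.maj .nat (a.add c) (b.add d)) := by
  refine le_elim h fun Δ₁ H₁ η₁ e₁ k hk => ?_
  have h' := h'.ext_maj e₁
  rw [Fm.maj_subst]
  refine le_elim h' fun Δ₂ H₂ η₂ e₂ l hl => ?_
  have hk := hk.ext_eqv e₂
  simp at hk hl ⊢
  refine le_intro ((k.subst η₂).add l) ?_
  exact eqv_trans (add_add_add_comm _ _ _ _) (eqv_add hk hl)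

theorem succ_le_succ {s t : Tm Γ .nat} (h : Ent H (.maj .nat s t)) :
    Ent H (.maj .nat (.app .succ s) (.app .succ t)) := by
  refine le_elim h fun Δ₁ H₁ η₁ e₁ k hk => ?_
  rw [Fm.maj_subst]
  exact le_intro k (eqv_trans (succ_add _ _) (eqv_succ hk))

/-! ### Majorizability -/

/-- This lets the defining equations of the constants and β-conversion, which hold only as
extensional equalities, act on majorizations. -/
theorem maj_congr {s s' t t' : Tm Γ σ} (h : Ent H (.maj σ s t)) (hs : Ent H (.eqv σ s s'))
    (ht : Ent H (.eqv σ t t')) : Ent H (.maj σ s' t') := by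
  induction σ generalizing Γ with
  | nat =>
    refine le_elim h fun Δ₁ H₁ η₁ e₁ k hk => ?_
    have hs := hs.ext_eqv e₁
    have ht := ht.ext_eqv e₁
    rw [Fm.maj_subst]
    exact le_intro k (eqv_trans (eqv_add (eqv_symm hs) (eqv_refl _)) (eqv_trans hk ht))
  | arr ρ σ _ ih =>
    refine maj_intro fun Δ H' η e u v huv => ?_
    have h := h.ext_maj e
    have hs := hs.ext_eqv e
    have ht := ht.ext_eqv e
    exact ⟨ih (maj_app h huv) (eqv_elim hs _) (eqv_elim ht _),
      ih (maj_app_right h huv) (eqv_elim ht _) (eqv_elim ht _)⟩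

/-- At a function type this is the second conjunct of strong majorizability, at type `0` it is
reflexivity; no induction on the type is needed. -/
theorem maj_right {s t : Tm Γ σ} (h : Ent H (.maj σ s t)) : Ent H (.maj σ t t) := by
  cases σ with
  | nat => exact le_refl t
  | arr ρ σ =>
    refine maj_intro fun Δ H' η e u v huv => ?_
    have := maj_app_right (h.ext_maj e) huv
    exact ⟨this, this⟩

/-- For `u ≤* v` also `v ≤* v`, so that `r u ≤* s v ≤* t v` and the induction hypothesis applies. -/
theorem maj_trans {r s t : Tm Γ σ} (h : Ent H (.maj σ r s)) (h' : Ent H (.maj σ s t)) :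
    Ent H (.maj σ r t) := by
  induction σ generalizing Γ with
  | nat => exact le_trans h h'
  | arr ρ σ ihρ ih =>
    refine maj_intro fun Δ H' η e u v huv => ?_
    have h := h.ext_maj e
    have h' := h'.ext_maj e
    exact ⟨ih (maj_app h huv) (maj_app h' (maj_right huv)), maj_app_right h' huv⟩

end Ent

/-! ## Tuples of standard and of monotone terms -/

/-- `c ≤* d` for tuples. -/
def MajT {Δ κ : Ctx} (H : Fm Δ) (c d : Tms Δ κ) : Prop :=
  ∀ ⦃σ : Ty⦄ (x : Var κ σ), Ent H (.maj σ (c x) (d x))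

def StT {Δ κ : Ctx} (H : Fm Δ) (c : Tms Δ κ) : Prop := ∀ ⦃σ : Ty⦄ (x : Var κ σ), Ent H (.st (c x))

/-- Tuples of standard monotone terms. -/
def MonSt {Δ κ : Ctx} (H : Fm Δ) (c : Tms Δ κ) : Prop := StT H c ∧ MajT H c c

namespace MajT
variable {Δ Θ κ μ : Ctx} {H : Fm Δ} {ρ : Ty}

theorem ext {c d : Tms Δ κ} (h : MajT H c d) {H' : Fm Θ} {η : Sub Δ Θ} (e : Ext H H' η) :
    MajT H' (Sub.comp c η) (Sub.comp d η) := fun _ x => (h x).ext_maj e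

theorem right {c d : Tms Δ κ} (h : MajT H c d) : MajT H d d := fun _ x => (h x).maj_right

theorem cons {s t : Tm Δ ρ} {c d : Tms Δ κ} (ht : Ent H (.maj ρ s t)) (h : MajT H c d) :
    MajT H (Sub.cons s c) (Sub.cons t d) := by
  intro σ x
  cases x with
  | here => exact ht
  | there x => exact h x

theorem append {c d : Tms Δ κ} {c' d' : Tms Δ μ} (h : MajT H c d) (h' : MajT H c' d') :
    MajT H (Sub.append c c') (Sub.append d d') := by
  intro σ x
  refine Var.append_cases
    (P := fun {σ} x => Ent H (.maj σ (Sub.append c c' x) (Sub.append d d' x)))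
    (fun x => ?_) (fun x => ?_) x
  · simpa using h x
  · simpa using h' x

theorem apps {τ : Ty} {ρs : List Ty} {s t : Tm Δ (arrs ρs τ)} {c d : Tms Δ ρs}
    (hs : Ent H (.maj _ s t)) (h : MajT H c d) :
    Ent H (.maj τ (Tm.apps ρs s c) (Tm.apps ρs t d)) := by
  induction ρs with
  | nil => exact hs
  | cons ρ ρs ih => exact ih (Ent.maj_app hs (h .here)) (fun _ x => h x.there)

end MajT

namespace StT
variable {Δ Θ κ μ : Ctx} {H : Fm Δ} {ρ : Ty}

theorem ext {c : Tms Δ κ} (h : StT H c) {H' : Fm Θ} {η : Sub Δ Θ} (e : Ext H H' η) :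
    StT H' (Sub.comp c η) := fun _ x => (h x).ext e

theorem of_maj {c d : Tms Δ κ} (hd : StT H d) (h : MajT H c d) : StT H c :=
  fun _ x => .mp (.mp (.standard (.maj _ _)) (hd x)) (h x)

theorem cons {t : Tm Δ ρ} {c : Tms Δ κ} (ht : Ent H (.st t)) (h : StT H c) :
    StT H (Sub.cons t c) := by
  intro σ x
  cases x with
  | here => exact ht
  | there x => exact h x

theorem append {c : Tms Δ κ} {d : Tms Δ μ} (h : StT H c) (h' : StT H d) :
    StT H (Sub.append c d) := by
  intro σ x
  refine Var.append_cases (P := fun {σ} x => Ent H (.st (Sub.append c d x)))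
    (fun x => ?_) (fun x => ?_) x
  · simpa using h x
  · simpa using h' x

theorem subst {c : Tms Δ κ} (h : StT H c) {σ : Ty} (t : Tm κ σ) : Ent H (.st (t.subst c)) := by
  induction t with
  | var x => exact h x
  | app s t ihs iht => exact .mp (.mp (.standard (.app _ _)) ihs) iht
  | zero => exact .standard (.closed .zero)
  | succ => exact .standard (.closed .succ)
  | combK σ τ => exact .standard (.closed (.combK σ τ))
  | combS ρ σ τ => exact .standard (.closed (.combS ρ σ τ))
  | recur σ => exact .standard (.closed (.recur σ))

theorem comp {c : Tms Δ κ} (h : StT H c) (s : Sub μ κ) : StT H (s.comp c) :=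
  fun _ x => h.subst (s x)

end StT

/-! ## Monotone terms -/

/-- The open term `t` is monotone in all its variables. -/
def SelfMaj {κ : Ctx} {σ : Ty} (t : Tm κ σ) : Prop :=
  ∀ ⦃Δ : Ctx⦄ ⦃H : Fm Δ⦄ ⦃c d : Tms Δ κ⦄, MajT H c d →
    Ent H (.maj σ (t.subst c) (t.subst d))

/-- All components of the tuple of open terms `s` are monotone in all variables. -/
def SelfMajT {κ μ : Ctx} (s : Sub κ μ) : Prop := ∀ ⦃σ : Ty⦄ (x : Var κ σ), SelfMaj (s x)

theorem SelfMajT.comp_maj {Δ κ μ : Ctx} {H : Fm Δ} {s : Sub κ μ} (hs : SelfMajT s)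
    {c d : Tms Δ μ} (h : MajT H c d) : MajT H (s.comp c) (s.comp d) := fun _ x => hs x h

theorem MonSt.comp {Δ κ μ : Ctx} {H : Fm Δ} {c : Tms Δ μ} (h : MonSt H c) {s : Sub κ μ}
    (hs : SelfMajT s) : MonSt H (s.comp c) := ⟨h.1.comp s, hs.comp_maj h.2⟩

theorem MonSt.ext {Δ Θ κ : Ctx} {H : Fm Δ} {c : Tms Δ κ} (h : MonSt H c) {H' : Fm Θ}
    {η : Sub Δ Θ} (e : Ext H H' η) : MonSt H' (Sub.comp c η) := ⟨h.1.ext e, h.2.ext e⟩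

theorem MonSt.append {Δ κ μ : Ctx} {H : Fm Δ} {c : Tms Δ κ} {d : Tms Δ μ} (h : MonSt H c)
    (h' : MonSt H d) : MonSt H (Sub.append c d) := ⟨h.1.append h'.1, h.2.append h'.2⟩

theorem MonSt.cons {Δ κ : Ctx} {H : Fm Δ} {ρ : Ty} {t : Tm Δ ρ} {d : Tms Δ κ}
    (ht : Ent H (.st t)) (ht' : Ent H (.maj ρ t t)) (h' : MonSt H d) :
    MonSt H (Sub.cons t d) := ⟨h'.1.cons ht, h'.2.cons ht'⟩

theorem monSt_nil {Δ : Ctx} {H : Fm Δ} (c : Tms Δ []) : MonSt H c :=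
  ⟨(fun _ x => nomatch x), (fun _ x => nomatch x)⟩

namespace SelfMaj
variable {κ μ : Ctx} {ρ σ τ : Ty}

theorem var (x : Var κ σ) : SelfMaj (.var x) := fun _ _ _ _ h => h x

theorem app {s : Tm κ (σ ⇒ τ)} {t : Tm κ σ} (hs : SelfMaj s) (ht : SelfMaj t) :
    SelfMaj (.app s t) := fun _ _ _ _ h => .maj_app (hs h) (ht h)

theorem subst {t : Tm κ σ} (ht : SelfMaj t) {s : Sub κ μ} (hs : SelfMajT s) :
    SelfMaj (t.subst s) := by
  intro Δ H c d h
  simpa using ht (hs.comp_maj h)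

theorem zero : SelfMaj (.zero : Tm κ .nat) := fun _ _ _ _ _ => .le_refl _

theorem succ : SelfMaj (.succ : Tm κ (.nat ⇒ .nat)) := fun _ _ _ _ _ =>
  .maj_intro fun _ _ _ _ _ _ h => ⟨.succ_le_succ h, .succ_le_succ h⟩

theorem combK : SelfMaj (.combK σ τ : Tm κ _) := by
  intro Δ H c d _
  refine .maj_intro fun Δ₁ H₁ η₁ e₁ u v huv => ?_
  have : Ent H₁ (.maj (τ ⇒ σ) (.app (.combK σ τ) u) (.app (.combK σ τ) v)) := by
    refine .maj_intro fun Δ₂ H₂ η₂ e₂ a b hab => ?_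
    have huv := huv.ext_maj e₂
    have key {u v a b} (huv : Ent H₂ (.maj σ u v)) : Ent H₂ (.maj σ
        (.app (.app (.combK σ τ) u) a) (.app (.app (.combK σ τ) v) b)) :=
      .maj_congr huv (.eqv_symm (.arith (.combK _ _))) (.eqv_symm (.arith (.combK _ _)))
    exact ⟨key huv, key huv.maj_right⟩
  exact ⟨this, this⟩

theorem combS : SelfMaj (.combS ρ σ τ : Tm κ _) := by
  intro Δ H c d _
  refine .maj_intro fun Δ₁ H₁ η₁ e₁ x x' hx => ?_
  have : Ent H₁ (.maj ((ρ ⇒ σ) ⇒ ρ ⇒ τ) (.app (.combS ρ σ τ) x) (.app (.combS ρ σ τ) x')) := by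
    have key {Δ} {H : Fm Δ} {x x' y y' z z'} (hx : Ent H (.maj (ρ ⇒ σ ⇒ τ) x x'))
        (hy : Ent H (.maj (ρ ⇒ σ) y y')) (hz : Ent H (.maj ρ z z')) : Ent H (.maj τ
        (.app (.app (.app (.combS ρ σ τ) x) y) z) (.app (.app (.app (.combS ρ σ τ) x') y') z')) :=
      .maj_congr (.maj_app (.maj_app hx hz) (.maj_app hy hz))
        (.eqv_symm (.arith (.combS _ _ _))) (.eqv_symm (.arith (.combS _ _ _)))
    have key' {Δ} {H : Fm Δ} {x x' y y'} (hx : Ent H (.maj (ρ ⇒ σ ⇒ τ) x x'))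
        (hy : Ent H (.maj (ρ ⇒ σ) y y')) : Ent H (.maj (ρ ⇒ τ)
        (.app (.app (.combS ρ σ τ) x) y) (.app (.app (.combS ρ σ τ) x') y')) :=
      .maj_intro fun _ _ _ e _ _ hz => ⟨key (hx.ext_maj e) (hy.ext_maj e) hz,
        key (hx.ext_maj e).maj_right (hy.ext_maj e).maj_right hz⟩
    exact .maj_intro fun _ _ _ e _ _ hy => ⟨key' (hx.ext_maj e) hy, key' (hx.ext_maj e).maj_right hy⟩
  exact ⟨this, this⟩

end SelfMaj

namespace SelfMajT
variable {κ μ ν : Ctx} {ρ : Ty}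

theorem id : SelfMajT (Sub.id : Sub κ κ) := fun _ x => .var x
theorem wk : SelfMajT (Sub.wk : Sub κ (ρ :: κ)) := fun _ x => .var x.there
theorem wks (ρs : List Ty) : SelfMajT (Sub.wks ρs : Sub κ (ρs ++ κ)) := fun _ _ => .var _
theorem vars (ρs : List Ty) : SelfMajT (vars ρs : Sub ρs (ρs ++ κ)) := fun _ _ => .var _

theorem comp {s : Sub κ μ} {r : Sub μ ν} (hs : SelfMajT s) (hr : SelfMajT r) :
    SelfMajT (s.comp r) := fun _ x => (hs x).subst hr

theorem cons {t : Tm μ ρ} {s : Sub κ μ} (ht : SelfMaj t) (hs : SelfMajT s) :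
    SelfMajT (Sub.cons t s) := by
  intro σ x
  cases x with
  | here => exact ht
  | there x => exact hs x

theorem append {ρs : List Ty} {s : Sub ρs μ} {r : Sub κ μ} (hs : SelfMajT s) (hr : SelfMajT r) :
    SelfMajT (Sub.append s r) := by
  intro σ x
  refine Var.append_cases (P := fun {σ} x => SelfMaj (Sub.append s r x)) (fun x => ?_)
    (fun x => ?_) x
  · simpa using hs x
  · simpa using hr x

theorem nil (s : Sub [] κ) : SelfMajT s := fun _ x => by cases x

end SelfMajT

/-! ## Abstraction -/

/-- The abstraction of a variable. -/
def Var.lam {Γ : Ctx} {ρ : Ty} : {σ : Ty} → Var (ρ :: Γ) σ → Tm Γ (ρ ⇒ σ)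
  | _, .here => .app (.app (.combS ρ (ρ ⇒ ρ) ρ) (.combK ρ (ρ ⇒ ρ))) (.combK ρ ρ)
  | _, .there x => .app (.combK _ ρ) (.var x)

/-- Abstraction of the last variable of the context. -/
def Tm.lam {Γ : Ctx} {ρ : Ty} : {σ : Ty} → Tm (ρ :: Γ) σ → Tm Γ (ρ ⇒ σ)
  | _, .var x => x.lam
  | _, .zero => .app (.combK _ ρ) .zero
  | _, .succ => .app (.combK _ ρ) .succ
  | _, .combK σ τ => .app (.combK _ ρ) (.combK σ τ)
  | _, .combS ρ' σ τ => .app (.combK _ ρ) (.combS ρ' σ τ)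
  | _, .recur σ => .app (.combK _ ρ) (.recur σ)
  | _, .app s t => .app (.app (.combS ρ _ _) s.lam) t.lam

/-- The substitution `θ` for the remaining variables is built in, so that the conversion is
available at every later stage. -/
theorem Ent.beta {Γ Δ : Ctx} {H : Fm Δ} {ρ σ : Ty} (t : Tm (ρ :: Γ) σ) (θ : Sub Γ Δ)
    (u : Tm Δ ρ) : Ent H (.eqv σ (.app (t.lam.subst θ) u) (t.subst (Sub.cons u θ))) := by
  induction t with
  | var x =>
    cases x with
    | here => exact .eqv_trans (.arith (.combS _ _ _)) (.arith (.combK _ _))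
    | there x => exact .arith (.combK _ _)
  | app s t ihs iht => exact .eqv_trans (.arith (.combS _ _ _)) (.eqv_app ihs iht)
  | _ => exact .arith (.combK _ _)

theorem SelfMaj.lam {κ : Ctx} {ρ σ : Ty} {t : Tm (ρ :: κ) σ} (ht : SelfMaj t) :
    SelfMaj t.lam := by
  intro Δ H c d h
  refine .maj_intro fun Δ' H' η e u v huv => ?_
  have key {c d : Tms Δ' κ} (h : MajT H' c d) : Ent H' (.maj σ (.app (t.lam.subst c) u)
      (.app (t.lam.subst d) v)) :=
    .maj_congr (ht (h.cons huv)) (.eqv_symm (.beta _ _ _)) (.eqv_symm (.beta _ _ _))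
  simp only [Tm.subst_subst]
  exact ⟨key (h.ext e), key (h.ext e).right⟩

/-- The permutation of variables used to abstract a tuple. -/
def Sub.rotate {κ : Ctx} (ρ : Ty) (ρs : List Ty) : Sub (ρ :: (ρs ++ κ)) (ρs ++ (ρ :: κ)) :=
  cons (.var (Var.here.right ρs)) (append (vars ρs) (wk.comp (wks ρs)))

/-- Abstraction of a tuple of variables. -/
def Tm.lams {κ : Ctx} {τ : Ty} : (ρs : List Ty) → Tm (ρs ++ κ) τ → Tm κ (arrs ρs τ)
  | [], t => t
  -- The argument of type `ρ` comes first, so its variable has to be abstracted last; it is moved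
  -- behind the tuple beforehand.
  | ρ :: ρs, t => (Tm.lams (κ := ρ :: κ) ρs (t.subst (Sub.rotate ρ ρs))).lam

theorem SelfMaj.lams {κ : Ctx} {τ : Ty} {ρs : List Ty} {t : Tm (ρs ++ κ) τ} (ht : SelfMaj t) :
    SelfMaj (Tm.lams ρs t) := by
  induction ρs generalizing κ with
  | nil => exact ht
  | cons ρ ρs ih =>
    exact (ih (ht.subst (.cons (.var _) (.append (.vars _) (.comp .wk (.wks _)))))).lam

theorem Ent.betas {κ Δ : Ctx} {H : Fm Δ} {τ : Ty} {ρs : List Ty} (t : Tm (ρs ++ κ) τ)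
    (θ : Sub κ Δ) (c : Tms Δ ρs) : Ent H (.eqv τ (Tm.apps ρs ((Tm.lams ρs t).subst θ) c)
      (t.subst (Sub.append c θ))) := by
  induction ρs generalizing κ with
  | nil => exact .eqv_refl _
  | cons ρ ρs ih =>
    refine .eqv_trans (.eqv_apps (.beta _ _ _) _) (.eqv_trans (ih _ _ _) ?_)
    rw [Tm.subst_subst, Sub.rotate, Sub.cons_comp, Sub.append_comp, Sub.comp_assoc,
      Sub.wks_comp_append, Sub.vars_comp_append, Sub.wk_comp_cons, Tm.subst, Sub.append_right]
    exact .eqv_refl _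

/-! ### Maps of positions -/

theorem Var.map_cases {F : Ty → Ty} {ρs : List Ty} {P : ∀ {σ : Ty}, Var (ρs.map F) σ → Prop}
    (h : ∀ {σ : Ty} (x : Var ρs σ), P (x.map F)) {σ : Ty} (x : Var (ρs.map F) σ) : P x := by
  induction ρs with
  | nil => cases x
  | cons ρ ρs ih =>
    cases x with
    | here => exact h .here
    | there x => exact ih (P := fun y => P (.there y)) (fun y => h y.there) x

/-- The tuple with the component `g x` in the position that corresponds to `x`. -/
def Sub.ofMap {κ : Ctx} {F : Ty → Ty} : {ρs : List Ty} →
    (∀ ⦃σ : Ty⦄, Var ρs σ → Tm κ (F σ)) → Sub (ρs.map F) κ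
  | [], _ => fun _ x => nomatch x
  | _ :: _, g => cons (g .here) (ofMap fun _ x => g x.there)

theorem Sub.ofMap_map {κ : Ctx} {F : Ty → Ty} {ρs : List Ty}
    (g : ∀ ⦃σ : Ty⦄, Var ρs σ → Tm κ (F σ)) {σ : Ty} (x : Var ρs σ) :
    ofMap g (x.map F) = g x := by
  induction x with
  | here => rfl
  | there x ih => exact ih fun _ y => g y.there

/-- Componentwise abstraction of a tuple of variables. -/
def Sub.lams {κ : Ctx} {τs : List Ty} (ρs : List Ty) (s : Sub τs (ρs ++ κ)) :
    Sub (τs.map (arrs ρs)) κ := ofMap fun _ x => (s x).lams ρs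

theorem SelfMajT.lams {κ : Ctx} {τs ρs : List Ty} {s : Sub τs (ρs ++ κ)} (hs : SelfMajT s) :
    SelfMajT (Sub.lams ρs s) := by
  intro σ x
  refine Var.map_cases (P := fun {σ} x => SelfMaj (Sub.lams ρs s x)) (fun x => ?_) x
  rw [Sub.lams, Sub.ofMap_map]
  exact (hs x).lams

/-- Equality of tuples. -/
def EqvT {Δ κ : Ctx} (H : Fm Δ) (c d : Tms Δ κ) : Prop :=
  ∀ ⦃σ : Ty⦄ (x : Var κ σ), Ent H (.eqv σ (c x) (d x))

theorem EqvT.symm {Δ κ : Ctx} {H : Fm Δ} {c d : Tms Δ κ} (h : EqvT H c d) : EqvT H d c :=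
  fun _ x => (h x).eqv_symm

theorem EqvT.trans {Δ κ : Ctx} {H : Fm Δ} {c d e : Tms Δ κ} (h : EqvT H c d) (h' : EqvT H d e) :
    EqvT H c e := fun _ x => (h x).eqv_trans (h' x)

theorem MajT.congr {Δ κ : Ctx} {H : Fm Δ} {c c' d d' : Tms Δ κ} (h : MajT H c d)
    (hc : EqvT H c c') (hd : EqvT H d d') : MajT H c' d' :=
  fun _ x => (h x).maj_congr (hc x) (hd x)

theorem EqvT.refl {Δ κ : Ctx} {H : Fm Δ} (c : Tms Δ κ) : EqvT H c c :=
  fun _ _ => .eqv_refl _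

theorem EqvT.comp {Δ κ μ : Ctx} {H : Fm Δ} {c d : Tms Δ κ} (h : EqvT H c d) (s : Sub μ κ) :
    EqvT H (s.comp c) (s.comp d) := fun _ x => .eqv_subst_congr (s x) h

theorem EqvT.cons {Δ κ : Ctx} {H : Fm Δ} {ρ : Ty} {s t : Tm Δ ρ} {c d : Tms Δ κ}
    (ht : Ent H (.eqv ρ s t)) (h : EqvT H c d) : EqvT H (Sub.cons s c) (Sub.cons t d) := by
  intro σ x
  cases x with
  | here => exact ht
  | there x => exact h x

theorem eqvT_betas {κ Δ : Ctx} {H : Fm Δ} {ρs τs : List Ty} (s : Sub τs (ρs ++ κ))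
    (θ : Sub κ Δ) (c : Tms Δ ρs) :
    EqvT H (Tms.apps ((Sub.lams ρs s).comp θ) c) (s.comp (Sub.append c θ)) := by
  intro σ x
  simp only [Tms.apps, Sub.comp, Sub.lams, Sub.ofMap_map]
  exact .betas _ _ _

/-- The definition of `≤*` unfolded over a whole tuple of arguments. The second conjunct carries the
monotonicity of `t`, which each arrow demands anew. -/
theorem Ent.maj_of_apps {Γ : Ctx} {H : Fm Γ} {τ : Ty} {ρs : List Ty} {s t : Tm Γ (arrs ρs τ)}
    (h : ∀ (Δ : Ctx) (H' : Fm Δ) (η : Sub Γ Δ), Ext H H' η → ∀ c d : Tms Δ ρs, MajT H' c d →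
      Ent H' (.maj τ (Tm.apps ρs (s.subst η) c) (Tm.apps ρs (t.subst η) d)) ∧
        Ent H' (.maj τ (Tm.apps ρs (t.subst η) c) (Tm.apps ρs (t.subst η) d))) :
    Ent H (.maj (arrs ρs τ) s t) := by
  induction ρs generalizing Γ with
  | nil =>
    have := (h Γ H Sub.id (.refl H) (fun _ x => nomatch x) (fun _ x => nomatch x)
      (fun _ x => nomatch x)).1
    simp only [Tm.apps, Tm.subst_id] at this
    exact this
  | cons ρ ρs ih =>
    refine maj_intro fun Δ H' η e u v huv => ?_
    have key {u v : Tm Δ ρ} (huv : Ent H' (.maj ρ u v)) {Δ₂ : Ctx} {H₂ : Fm Δ₂} {η₂ : Sub Δ Δ₂}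
        (e₂ : Ext H' H₂ η₂) {c d : Tms Δ₂ ρs} (hcd : MajT H₂ c d) :=
      h Δ₂ H₂ (η.comp η₂) (e.comp e₂) (Sub.cons (u.subst η₂) c) (Sub.cons (v.subst η₂) d)
        (.cons (huv.ext_maj e₂) hcd)
    simp only [← Tm.subst_subst] at key
    exact ⟨ih fun _ _ _ e₂ c d hcd => ⟨(key huv e₂ hcd).1, (key huv.maj_right e₂ hcd).2⟩,
      ih fun _ _ _ e₂ c d hcd => ⟨(key huv e₂ hcd).2, (key huv.maj_right e₂ hcd).2⟩⟩

/-- A functional is majorized by the abstraction of a monotone term that majorizes its values. -/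
theorem Ent.maj_lams {κ Δ : Ctx} {H : Fm Δ} {τ : Ty} {ρs : List Ty} {s : Tm Δ (arrs ρs τ)}
    {r : Tm (ρs ++ κ) τ} (hr : SelfMaj r) {d : Tms Δ κ} (hd : MajT H d d)
    (h : ∀ (Θ : Ctx) (H' : Fm Θ) (η : Sub Δ Θ), Ext H H' η → ∀ u v : Tms Θ ρs, MajT H' u v →
      Ent H' (.maj τ (Tm.apps ρs (s.subst η) u) (r.subst (Sub.append v (Sub.comp d η))))) :
    Ent H (.maj (arrs ρs τ) s ((Tm.lams ρs r).subst d)) := by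
  refine maj_of_apps fun Θ H' η e u v huv => ?_
  rw [Tm.subst_subst]
  exact ⟨maj_congr (h Θ H' η e u v huv) (eqv_refl _) (eqv_symm (betas _ _ _)),
    MajT.apps (hr.lams (hd.ext e)) huv⟩

/-! ## Zero functionals -/

/-- The functional of type `σ` that is constantly zero. -/
def Tm.zeroAt {Γ : Ctx} : (σ : Ty) → Tm Γ σ
  | .nat => .zero
  | .arr ρ σ => .app (.combK σ ρ) (zeroAt σ)

theorem SelfMaj.zeroAt {κ : Ctx} (σ : Ty) : SelfMaj (.zeroAt σ : Tm κ σ) := by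
  induction σ with
  | nat => exact .zero
  | arr ρ σ _ ih => exact .app .combK ih

/-! ## Upper bounds of two monotone functionals -/

/-- An upper bound of the two variables of the context. -/
def maxTm : (σ : Ty) → Tm [σ, σ] σ
  | .nat => Tm.add (.var .here) (.var (.there .here))
  | .arr _ σ => ((maxTm σ).subst (Sub.cons (.app (.var (.there .here)) (.var .here))
      (Sub.cons (.app (.var (.there (.there .here))) (.var .here)) Sub.empty))).lam

/-- An upper bound of `s` and `t`. -/
def Tm.max {Γ : Ctx} {σ : Ty} (s t : Tm Γ σ) : Tm Γ σ :=
  (maxTm σ).subst (Sub.cons s (Sub.cons t Sub.empty))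

@[simp] theorem Tm.max_subst {Γ Δ : Ctx} {σ : Ty} (s t : Tm Γ σ) (θ : Sub Γ Δ) :
    (s.max t).subst θ = (s.subst θ).max (t.subst θ) := by simp [Tm.max]

theorem SelfMaj.maxTm (σ : Ty) : SelfMaj (maxTm σ) := by
  induction σ with
  | nat => exact fun _ _ _ _ h => .add_le_add (h _) (h _)
  | arr ρ σ _ ih =>
    exact (ih.subst (.cons (.app (.var _) (.var _)) (.cons (.app (.var _) (.var _)) (.nil _)))).lam

namespace Ent
variable {Γ : Ctx} {H : Fm Γ} {ρ σ : Ty}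

theorem max_app (s t : Tm Γ (ρ ⇒ σ)) (u : Tm Γ ρ) :
    Ent H (.eqv σ (.app (s.max t) u) (Tm.max (.app s u) (.app t u))) := by
  refine eqv_trans (beta _ _ _) ?_
  simpa [Tm.max] using eqv_refl _

theorem max_maj {s s' t t' : Tm Γ σ} (hs : Ent H (.maj σ s s')) (ht : Ent H (.maj σ t t')) :
    Ent H (.maj σ (s.max t) (s'.max t')) :=
  SelfMaj.maxTm σ (.cons hs (.cons ht fun _ x => nomatch x))

/-- At type `0` a sum bounds its summands. At a function type `s u` is compared with the maximum of
`s' v` and `t v`, and the induction needs `t v ≤* t v`; this is where monotonicity of `t` enters. -/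
theorem maj_max_left {s s' t : Tm Γ σ} (hs : Ent H (.maj σ s s')) (ht : Ent H (.maj σ t t)) :
    Ent H (.maj σ s (s'.max t)) := by
  induction σ generalizing Γ with
  | nat => exact le_trans hs (le_add_right _ _)
  | arr ρ σ _ ih =>
    refine maj_intro fun Δ H' η e u v huv => ?_
    have hs := hs.ext_maj e
    have ht := ht.ext_maj e
    rw [Tm.max_subst]
    refine ⟨?_, maj_app (max_maj hs.maj_right ht) huv⟩
    exact maj_congr (ih (maj_app hs huv) (maj_app ht huv.maj_right)) (eqv_refl _)
      (eqv_symm (max_app _ _ _))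

theorem maj_max_right {s t t' : Tm Γ σ} (hs : Ent H (.maj σ s s)) (ht : Ent H (.maj σ t t')) :
    Ent H (.maj σ t (s.max t')) := by
  induction σ generalizing Γ with
  | nat => exact le_trans ht (le_add_left _ _)
  | arr ρ σ _ ih =>
    refine maj_intro fun Δ H' η e u v huv => ?_
    have hs := hs.ext_maj e
    have ht := ht.ext_maj e
    rw [Tm.max_subst]
    refine ⟨?_, maj_app (max_maj hs ht.maj_right) huv⟩
    exact maj_congr (ih (maj_app hs huv.maj_right) (maj_app ht huv)) (eqv_refl _)
      (eqv_symm (max_app _ _ _))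

end Ent

/-! ## A monotone recursor -/

/-- The step `λ r k, max r (z r k)` of the monotone recursor, where `z` is the variable of the
context. -/
def stepTm (σ : Ty) : Tm [σ ⇒ .nat ⇒ σ] (σ ⇒ .nat ⇒ σ) :=
  (Tm.lam (Tm.max (.var (.there .here)) (.app (.app (.var (.there (.there .here)))
    (.var (.there .here))) (.var .here)))).lam

theorem SelfMaj.max {κ : Ctx} {σ : Ty} {s t : Tm κ σ} (hs : SelfMaj s) (ht : SelfMaj t) :
    SelfMaj (s.max t) := (SelfMaj.maxTm σ).subst (.cons hs (.cons ht (.nil _)))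

/-- Monotone recursion: `f 0 = y` and `f (n + 1) = max (f n) (z (f n) n)`. -/
def Tm.recMax {Γ : Ctx} {σ : Ty} (n : Tm Γ .nat) (y : Tm Γ σ) (z : Tm Γ (σ ⇒ .nat ⇒ σ)) :
    Tm Γ σ :=
  .app (.app (.app (.recur σ) n) y) ((stepTm σ).subst (Sub.cons z Sub.empty))

@[simp] theorem Tm.recMax_subst {Γ Δ : Ctx} {σ : Ty} (n : Tm Γ .nat) (y : Tm Γ σ)
    (z : Tm Γ (σ ⇒ .nat ⇒ σ)) (θ : Sub Γ Δ) :
    (recMax n y z).subst θ = recMax (n.subst θ) (y.subst θ) (z.subst θ) := by simp [recMax]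

namespace Ent
variable {Γ : Ctx} {H : Fm Γ} {σ : Ty}

theorem recMax_zero (y : Tm Γ σ) (z : Tm Γ (σ ⇒ .nat ⇒ σ)) :
    Ent H (.eqv σ (Tm.recMax .zero y z) y) := arith (.recurZero _ _)

theorem recMax_succ (n : Tm Γ .nat) (y : Tm Γ σ) (z : Tm Γ (σ ⇒ .nat ⇒ σ)) :
    Ent H (.eqv σ (Tm.recMax (.app .succ n) y z)
      (Tm.max (Tm.recMax n y z) (.app (.app z (Tm.recMax n y z)) n))) := by
  refine eqv_trans (arith (.recurSucc _ _ _)) ?_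
  refine eqv_trans (eqv_elim (beta _ _ _) _) (eqv_trans (beta _ _ _) ?_)
  simpa [Tm.recMax] using eqv_refl _

theorem recMax_maj_of_eq (n : Tm Γ .nat) {y y' : Tm Γ σ} {z z' : Tm Γ (σ ⇒ .nat ⇒ σ)}
    (hy : Ent H (.maj _ y y')) (hz : Ent H (.maj _ z z')) :
    Ent H (.maj σ (.recMax n y z) (.recMax n y' z')) := by
  have := induction (H := H) (.maj σ (.recMax (.var .here) (y.subst Sub.wk) (z.subst Sub.wk))
    (.recMax (.var .here) (y'.subst Sub.wk) (z'.subst Sub.wk))) (Fm.maj_internal _ _)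
    (by simpa using maj_congr hy (eqv_symm (recMax_zero _ _)) (eqv_symm (recMax_zero _ _)))
    (fun Δ H' η e n ih => by
      simp at ih ⊢
      have hz := hz.ext_maj e
      exact maj_congr (max_maj ih (maj_app (maj_app hz ih) (le_refl n)))
        (eqv_symm (recMax_succ _ _ _)) (eqv_symm (recMax_succ _ _ _))) n
  simpa using this

/-- At each successor the second entry of the maximum dominates the step of the ordinary recursor.
The induction is legitimate because `≤*` is internal. -/
theorem recur_maj_recMax (n : Tm Γ .nat) {y y' : Tm Γ σ} {z z' : Tm Γ (σ ⇒ .nat ⇒ σ)}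
    (hy : Ent H (.maj _ y y')) (hz : Ent H (.maj _ z z')) :
    Ent H (.maj σ (.app (.app (.app (.recur σ) n) y) z) (.recMax n y' z')) := by
  have := induction (H := H) (.maj σ
    (.app (.app (.app (.recur σ) (.var .here)) (y.subst Sub.wk)) (z.subst Sub.wk))
    (.recMax (.var .here) (y'.subst Sub.wk) (z'.subst Sub.wk))) (Fm.maj_internal _ _)
    (by simpa using maj_congr hy (eqv_symm (arith (.recurZero _ _))) (eqv_symm (recMax_zero _ _)))
    (fun Δ H' η e n ih => by
      simp at ih ⊢
      have hz := hz.ext_maj e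
      exact maj_congr (maj_max_right ih.maj_right (maj_app (maj_app hz ih) (le_refl n)))
        (eqv_symm (arith (.recurSucc _ _ _))) (eqv_symm (recMax_succ _ _ _))) n
  simpa using this

/-- The reason for the maximum in the step: its first entry makes the values increase with the
argument. The induction is on the difference `k`. -/
theorem recMax_maj_add (n k : Tm Γ .nat) {y : Tm Γ σ} {z : Tm Γ (σ ⇒ .nat ⇒ σ)}
    (hy : Ent H (.maj _ y y)) (hz : Ent H (.maj _ z z)) :
    Ent H (.maj σ (.recMax n y z) (.recMax (n.add k) y z)) := by
  have congr {Δ : Ctx} {H' : Fm Δ} {m m' : Tm Δ .nat} {y z} (h : Ent H' (.eqv .nat m m')) :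
      Ent H' (.eqv σ (.recMax m y z) (.recMax m' y z)) :=
    eqv_app (eqv_app (eqv_app (eqv_refl _) h) (eqv_refl _)) (eqv_refl _)
  have := induction (H := H) (.maj σ
    (.recMax (n.subst Sub.wk) (y.subst Sub.wk) (z.subst Sub.wk))
    (.recMax ((n.subst Sub.wk).add (.var .here)) (y.subst Sub.wk) (z.subst Sub.wk)))
    (Fm.maj_internal _ _)
    (by
      simpa using maj_congr (recMax_maj_of_eq n hy hz) (eqv_refl _)
        (eqv_symm (congr (add_zero _))))
    (fun Δ H' η e k ih => by
      simp at ih ⊢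
      have hz := hz.ext_maj e
      exact maj_congr (maj_max_left ih (maj_app (maj_app hz ih.maj_right) (le_refl _)))
        (eqv_refl _) (eqv_symm (eqv_trans (congr (add_succ _ _)) (recMax_succ _ _ _)))) k
  simpa using this

theorem recMax_maj {n n' : Tm Γ .nat} {y y' : Tm Γ σ} {z z' : Tm Γ (σ ⇒ .nat ⇒ σ)}
    (hn : Ent H (.maj _ n n')) (hy : Ent H (.maj _ y y')) (hz : Ent H (.maj _ z z')) :
    Ent H (.maj σ (.recMax n y z) (.recMax n' y' z')) := by
  refine le_elim hn fun Δ H' η e k hk => ?_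
  have hy := hy.ext_maj e
  have hz := hz.ext_maj e
  simp only [Fm.maj_subst, Tm.recMax_subst]
  refine maj_trans (recMax_maj_of_eq _ hy hz)
    (maj_congr (recMax_maj_add _ k hy.maj_right hz.maj_right) (eqv_refl _) ?_)
  exact eqv_app (eqv_app (eqv_app (eqv_refl _) hk) (eqv_refl _)) (eqv_refl _)

end Ent

theorem SelfMaj.recMax {κ : Ctx} {σ : Ty} {n : Tm κ .nat} {y : Tm κ σ} {z : Tm κ (σ ⇒ .nat ⇒ σ)}
    (hn : SelfMaj n) (hy : SelfMaj y) (hz : SelfMaj z) : SelfMaj (.recMax n y z) := by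
  intro Δ H c d h
  simpa using Ent.recMax_maj (hn h) (hy h) (hz h)

/-- Every term has a monotone majorant. -/
theorem exists_majorant {κ : Ctx} {σ : Ty} (t : Tm κ σ) : ∃ t' : Tm κ σ, SelfMaj t' ∧
    ∀ ⦃Δ : Ctx⦄ ⦃H : Fm Δ⦄ ⦃c d : Tms Δ κ⦄, MajT H c d →
      Ent H (.maj σ (t.subst c) (t'.subst d)) := by
  induction t with
  | var x => exact ⟨_, SelfMaj.var x, SelfMaj.var x⟩
  | zero => exact ⟨_, SelfMaj.zero, SelfMaj.zero⟩
  | succ => exact ⟨_, SelfMaj.succ, SelfMaj.succ⟩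
  | combK σ τ => exact ⟨_, SelfMaj.combK, SelfMaj.combK⟩
  | combS ρ σ τ => exact ⟨_, SelfMaj.combS, SelfMaj.combS⟩
  | app s t ihs iht =>
    obtain ⟨s', hs', hs⟩ := ihs
    obtain ⟨t', ht', ht⟩ := iht
    exact ⟨_, .app hs' ht', fun _ _ _ _ h => .maj_app (hs h) (ht h)⟩
  | recur σ =>
    let r : Tm ([.nat, σ, σ ⇒ .nat ⇒ σ] ++ κ) σ :=
      .recMax (.var .here) (.var (.there .here)) (.var (.there (.there .here)))
    have hr : SelfMaj r := .recMax (.var _) (.var _) (.var _)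
    refine ⟨Tm.lams [.nat, σ, σ ⇒ .nat ⇒ σ] r, hr.lams, fun Δ H c d h => ?_⟩
    refine Ent.maj_lams hr h.right fun Θ H' η e u v huv => ?_
    simp only [r, Tm.recMax_subst]
    -- First the functional parameters are enlarged at the same numerical argument, then this
    -- argument is enlarged for the monotone recursor.
    exact (Ent.recur_maj_recMax (u .here) (huv (.there .here)) (huv (.there (.there .here)))).maj_trans
      (Ent.recMax_maj (huv .here) (huv (.there .here)).maj_right
        (huv (.there (.there .here))).maj_right)

/-! ## Quantification over standard monotone tuples -/

namespace Ent
variable {Γ : Ctx} {H : Fm Γ} {ρs : List Ty}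

theorem allMonSts_intro {A : Fm (ρs ++ Γ)}
    (h : ∀ (Δ : Ctx) (H' : Fm Δ) (η : Sub Γ Δ), Ext H H' η → ∀ c : Tms Δ ρs, MonSt H' c →
      Ent H' (A.subst (Sub.append c η))) : Ent H (.allMonSts ρs A) := by
  induction ρs with
  | nil =>
    have := h Γ H Sub.id (.refl H) (fun _ x => nomatch x) (monSt_nil _)
    simp only [Sub.append, Fm.subst_id] at this
    exact this
  | cons ρ ρs ih =>
    refine ih fun Δ₁ H₁ η₁ e₁ c hc => all_intro fun Δ₂ H₂ η₂ e₂ t => imp_intro fun H₃ h₃ ht => ?_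
    have e₃ := e₂.comp (Ext.of_ent h₃)
    simp only [Fm.subst, Tm.subst, Sub.lift_here, Sub.cons_here, Fm.mon_subst] at ht
    have := h _ H₃ _ (e₁.comp e₃) (Sub.cons t (Sub.comp c (η₂.comp Sub.id)))
      ((hc.ext e₃).cons ht.and_left ht.and_right)
    simp only [Sub.comp_id] at this
    rw [Fm.subst_subst, Sub.lift_comp_cons, Sub.append_comp]
    exact this

theorem allMonSts_elim {A : Fm (ρs ++ Γ)} (h : Ent H (.allMonSts ρs A)) {c : Tms Γ ρs}
    (hc : MonSt H c) : Ent H (A.subst (Sub.append c Sub.id)) := by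
  induction ρs with
  | nil =>
    simp only [Sub.append, Fm.subst_id]
    exact h
  | cons ρ ρs ih =>
    have := ih h (c := fun _ x => c x.there) ⟨fun _ x => hc.1 x.there, fun _ x => hc.2 x.there⟩
    rw [Fm.allMonSt_subst] at this
    have := (all_elim this (c .here)).mp (and_intro (hc.1 .here) (by
      simpa [Fm.mon] using hc.2 .here))
    rwa [Fm.subst_subst, Sub.lift_comp_cons, Sub.comp_id] at this

end Ent

theorem MonSt.of_ent {Δ κ : Ctx} {H H' : Fm Δ} {c : Tms Δ κ} (hc : MonSt H c) (h : Ent H' H) :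
    MonSt H' c := ⟨fun _ x => h.cut (hc.1 x), fun _ x => h.cut (hc.2 x)⟩

/-! ## Realizability predicates -/

/-- The laws of the matrix of an interpreted formula: it is compatible with substitution and
monotone in the realizers. -/
structure IsMatrix {Γ : Ctx} {ρs : List Ty} (m : ∀ {Δ : Ctx}, Sub Γ Δ → Tms Δ ρs → Fm Δ) :
    Prop where
  subst : ∀ {Δ Θ : Ctx} (θ : Sub Γ Δ) (c : Tms Δ ρs) (η : Sub Δ Θ),
    (m θ c).subst η = m (θ.comp η) (Sub.comp c η)
  mono : ∀ {Δ : Ctx} {H : Fm Δ} {θ : Sub Γ Δ} {c d : Tms Δ ρs}, Ent H (m θ c) → MajT H c d →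
    Ent H (m θ d)

/-- An abstract interpreted formula: a tuple of types and a matrix. -/
structure RPred (Γ : Ctx) where
  ty : List Ty
  mat : ∀ {Δ : Ctx}, Sub Γ Δ → Tms Δ ty → Fm Δ
  isMatrix : IsMatrix mat

theorem Sub.wks_comp_lifts {Γ Δ : Ctx} (ρs : List Ty) (η : Sub Γ Δ) :
    (wks ρs).comp (η.lifts ρs) = η.comp (wks ρs) := by
  rw [lifts_eq, wks_comp_append]

theorem Sub.vars_comp_lifts {Γ Δ : Ctx} (ρs : List Ty) (η : Sub Γ Δ) :
    Sub.comp (vars ρs) (η.lifts ρs) = vars ρs := by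
  rw [lifts_eq, vars_comp_append]

theorem MajT.tmsApps {Δ : Ctx} {H : Fm Δ} {ρs τs : List Ty} {f g : Tms Δ (τs.map (arrs ρs))}
    {c d : Tms Δ ρs} (hf : MajT H f g) (hc : MajT H c d) : MajT H (f.apps c) (g.apps d) :=
  fun _ _ => MajT.apps (hf _) hc

namespace IsMatrix
variable {Γ : Ctx} {ρs τs : List Ty} {m : ∀ {Δ : Ctx}, Sub Γ Δ → Tms Δ ρs → Fm Δ}
  {m' : ∀ {Δ : Ctx}, Sub Γ Δ → Tms Δ τs → Fm Δ}

theorem and (h : IsMatrix m) (h' : IsMatrix m') : IsMatrix (ρs := ρs ++ τs)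
    fun θ c => .and (m θ (Sub.fst c)) (m' θ (Sub.snd c)) where
  subst θ c η := by simp only [Fm.subst, h.subst, h'.subst, Sub.fst_comp, Sub.snd_comp]
  mono hc hd := .and_intro (h.mono hc.and_left fun _ x => hd _) (h'.mono hc.and_right fun _ x => hd _)

theorem or (h : IsMatrix m) (h' : IsMatrix m') : IsMatrix (ρs := ρs ++ τs)
    fun θ c => .or (m θ (Sub.fst c)) (m' θ (Sub.snd c)) where
  subst θ c η := by simp only [Fm.subst, h.subst, h'.subst, Sub.fst_comp, Sub.snd_comp]
  mono hc hd := .or_elim hc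
    (fun _ e hc => .or_left (h.mono hc fun _ _ => e.cut (hd _)))
    (fun _ e hc => .or_right (h'.mono hc fun _ _ => e.cut (hd _)))

theorem imp_intro (h : IsMatrix m) (h' : IsMatrix m') {Δ : Ctx} {H : Fm Δ} {θ : Sub Γ Δ}
    {f : Tms Δ (τs.map (arrs ρs))}
    (hf : ∀ (Θ : Ctx) (H' : Fm Θ) (η : Sub Δ Θ), Ext H H' η → ∀ c : Tms Θ ρs, MonSt H' c →
      Ent H' (m (θ.comp η) c) → Ent H' (m' (θ.comp η) (Tms.apps (Sub.comp f η) c))) :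
    Ent H (.allMonSts ρs (.imp (m (θ.comp (Sub.wks ρs)) (vars ρs))
      (m' (θ.comp (Sub.wks ρs)) (Tms.apps (Sub.comp f (Sub.wks ρs)) (vars ρs))))) := by
  refine .allMonSts_intro fun Θ H' η e c hc => .imp_intro fun H'' h'' hm => ?_
  simp only [h.subst, h'.subst, Tms.apps_comp, Sub.comp_assoc, Sub.wks_comp_append,
    Sub.vars_comp_append] at hm ⊢
  exact hf Θ H'' η (h''.cut e) c (hc.of_ent h'') hm

theorem imp_elim (h : IsMatrix m) (h' : IsMatrix m') {Δ : Ctx} {H : Fm Δ} {θ : Sub Γ Δ}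
    {f : Tms Δ (τs.map (arrs ρs))}
    (hf : Ent H (.allMonSts ρs (.imp (m (θ.comp (Sub.wks ρs)) (vars ρs))
      (m' (θ.comp (Sub.wks ρs)) (Tms.apps (Sub.comp f (Sub.wks ρs)) (vars ρs))))))
    {c : Tms Δ ρs} (hc : MonSt H c) (hm : Ent H (m θ c)) : Ent H (m' θ (f.apps c)) := by
  have := hf.allMonSts_elim hc
  simp only [Fm.subst, h.subst, h'.subst, Tms.apps_comp, Sub.comp_assoc, Sub.wks_comp_append,
    Sub.vars_comp_append, Sub.comp_id] at this
  exact this.mp hm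

/-- The realizer `f` of an implication occurs only in the conclusion, so no contravariance arises.
Since the premise ranges over monotone `c` only, `f ≤* g` gives `f c ≤* g c`. -/
theorem imp (h : IsMatrix m) (h' : IsMatrix m') : IsMatrix (ρs := τs.map (arrs ρs))
    fun θ f => .allMonSts ρs (.imp (m (θ.comp (Sub.wks ρs)) (vars ρs))
      (m' (θ.comp (Sub.wks ρs)) (Tms.apps (Sub.comp f (Sub.wks ρs)) (vars ρs)))) where
  subst θ c η := by
    simp only [Fm.allMonSts_subst, Fm.subst, h.subst, h'.subst, Tms.apps_comp, Sub.comp_assoc,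
      Sub.wks_comp_lifts, Sub.vars_comp_lifts]
  mono {Δ H θ f g} hf hfg := h.imp_intro h' fun Θ H' η e c hc hm => by
    have hf := hf.ext e
    simp only [Fm.allMonSts_subst, Fm.subst, h.subst, h'.subst, Tms.apps_comp, Sub.comp_assoc,
      Sub.wks_comp_lifts, Sub.vars_comp_lifts] at hf
    simp only [← Sub.comp_assoc] at hf
    exact h'.mono (h.imp_elim h' hf hc hm) ((hfg.ext e).tmsApps hc.2)

variable {σ : Ty} {n : ∀ {Δ : Ctx}, Sub (σ :: Γ) Δ → Tms Δ ρs → Fm Δ}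

theorem subst_lift (h : IsMatrix n) {Δ Θ : Ctx} (θ : Sub Γ Δ) (c : Tms Δ ρs) (η : Sub Δ Θ)
    (t : Tm Θ σ) : (n θ.lift (Sub.comp c Sub.wk)).subst (Sub.cons t η) =
      n (Sub.cons t (θ.comp η)) (Sub.comp c η) := by
  simp only [h.subst, Sub.lift_comp_cons, Sub.comp_assoc, Sub.wk_comp_cons]

theorem all (h : IsMatrix n) : IsMatrix (ρs := ρs) (Γ := Γ)
    fun θ c => .all σ (n θ.lift (Sub.comp c Sub.wk)) where
  subst θ c η := by
    simp only [Fm.subst, h.subst, Sub.lift_comp, Sub.comp_assoc]; rfl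
  mono hc hd := .all_intro fun Θ H' η e t => by
    have := (hc.ext e).all_elim t
    rw [h.subst_lift]
    simp only [Fm.subst_subst, Sub.lift_comp_cons, Sub.comp_id, h.subst_lift] at this
    exact h.mono this (hd.ext e)

theorem ex (h : IsMatrix n) : IsMatrix (ρs := ρs) (Γ := Γ)
    fun θ c => .ex σ (n θ.lift (Sub.comp c Sub.wk)) where
  subst θ c η := by
    simp only [Fm.subst, h.subst, Sub.lift_comp, Sub.comp_assoc]; rfl
  mono hc hd := .ex_elim hc fun Θ H' η e t ht => .ex_intro t (by
    rw [h.subst_lift] at ht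
    simp only [Fm.subst_subst, Sub.lift_comp_cons, Sub.comp_id, h.subst_lift]
    exact h.mono ht (hd.ext e))

end IsMatrix

theorem Fm.isMatrix_bn {Γ : Ctx} (A : Fm Γ) : IsMatrix (ρs := A.bnTypes) fun θ c => A.bn θ c := by
  induction A with
  | eq s t => exact ⟨fun _ _ _ => by simp [bn], fun h _ => h⟩
  | st t => exact ⟨fun _ _ _ => by simp [bn, Sub.comp], fun h h' => h.maj_trans (h' _)⟩
  | bot => exact ⟨fun _ _ _ => rfl, fun h _ => h⟩
  | and A B ihA ihB => exact ihA.and ihB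
  | or A B ihA ihB => exact ihA.or ihB
  | imp A B ihA ihB => exact ihA.imp ihB
  | all σ A ih => exact ih.all
  | ex σ A ih => exact ih.ex

/-- The interpretation of a formula. -/
def Fm.interp {Γ : Ctx} (A : Fm Γ) : RPred Γ := ⟨A.bnTypes, fun θ c => A.bn θ c, A.isMatrix_bn⟩

namespace RPred
variable {Γ Δ : Ctx} {σ : Ty}

abbrev bot : RPred Γ := ⟨[], fun _ _ => .bot, ⟨fun _ _ _ => rfl, fun h _ => h⟩⟩
abbrev and (X Y : RPred Γ) : RPred Γ := ⟨_, _, X.isMatrix.and Y.isMatrix⟩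
abbrev or (X Y : RPred Γ) : RPred Γ := ⟨_, _, X.isMatrix.or Y.isMatrix⟩
abbrev imp (X Y : RPred Γ) : RPred Γ := ⟨_, _, X.isMatrix.imp Y.isMatrix⟩
abbrev all (X : RPred (σ :: Γ)) : RPred Γ := ⟨_, _, X.isMatrix.all⟩
abbrev ex (X : RPred (σ :: Γ)) : RPred Γ := ⟨_, _, X.isMatrix.ex⟩

/-- Substitution for the parameters. -/
abbrev sub (X : RPred Γ) (θ : Sub Γ Δ) : RPred Δ :=
  ⟨X.ty, fun η c => X.mat (θ.comp η) c,
    ⟨fun η c ζ => by rw [X.isMatrix.subst, Sub.comp_assoc], fun h h' => X.isMatrix.mono h h'⟩⟩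

theorem imp_sub (X Y : RPred Γ) (θ : Sub Γ Δ) : (X.imp Y).sub θ = (X.sub θ).imp (Y.sub θ) := by
  simp only [sub, imp, Sub.comp_assoc]

theorem all_sub (X : RPred (σ :: Γ)) (θ : Sub Γ Δ) : X.all.sub θ = (X.sub θ.lift).all := by
  simp only [sub, all, Sub.lift_comp]

theorem ex_sub (X : RPred (σ :: Γ)) (θ : Sub Γ Δ) : X.ex.sub θ = (X.sub θ.lift).ex := by
  simp only [sub, ex, Sub.lift_comp]

end RPred

/-- The equation is between pairs of types and matrix: the types of realizers of `A.subst θ` and of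
`A` agree only by induction, so the matrices cannot be compared by themselves. -/
theorem Fm.interp_subst {Γ Δ : Ctx} (A : Fm Γ) (θ : Sub Γ Δ) :
    (A.subst θ).interp = A.interp.sub θ := by
  induction A generalizing Δ with
  | eq s t => simp [interp, RPred.sub, bnTypes, bn]
  | st t => simp [interp, RPred.sub, bnTypes, bn]
  | bot => rfl
  | and A B ihA ihB => exact congrArg₂ RPred.and (ihA θ) (ihB θ)
  | or A B ihA ihB => exact congrArg₂ RPred.or (ihA θ) (ihB θ)
  | imp A B ihA ihB =>
    exact (congrArg₂ RPred.imp (ihA θ) (ihB θ)).trans (RPred.imp_sub _ _ _).symm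
  | all σ A ih => exact (congrArg RPred.all (ih θ.lift)).trans (RPred.all_sub _ _).symm
  | ex σ A ih => exact (congrArg RPred.ex (ih θ.lift)).trans (RPred.ex_sub _ _).symm

theorem SelfMajT.tmsApps {κ : Ctx} {ρs τs : List Ty} {f : Sub (τs.map (arrs ρs)) κ}
    {c : Sub ρs κ} (hf : SelfMajT f) (hc : SelfMajT c) : SelfMajT (Tms.apps f c) := by
  intro σ x Δ H d e h
  simp only [Tms.apps, Tm.apps_subst]
  exact MajT.apps (hf _ h) (hc.comp_maj h)

/-- Componentwise upper bounds of two tuples. -/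
def Sub.max {κ μ : Ctx} (s t : Sub κ μ) : Sub κ μ := fun _ x => (s x).max (t x)

theorem Sub.max_comp {κ μ ν : Ctx} (s t : Sub κ μ) (c : Sub μ ν) :
    (max s t).comp c = max (s.comp c) (t.comp c) := by
  funext σ x; exact Tm.max_subst _ _ _

/-! ### The Heyting algebra of interpreted formulas -/

namespace RPred
variable {Γ Δ : Ctx} {σ : Ty} {X Y Z W : RPred Γ}

/-- Realizers of `Y` are computed from realizers of `X` by monotone terms. -/
def Le (X Y : RPred Γ) : Prop := ∃ s : Sub Y.ty X.ty, SelfMajT s ∧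
  ∀ ⦃Δ : Ctx⦄ (H : Fm Δ) (θ : Sub Γ Δ) (c : Tms Δ X.ty), MonSt H c → Ent H (X.mat θ c) →
    Ent H (Y.mat θ (s.comp c))

/-- Some monotone closed terms realize `X`. -/
def Valid (X : RPred Γ) : Prop := ∃ s : Sub X.ty [], SelfMajT s ∧
  ∀ ⦃Δ : Ctx⦄ (H : Fm Δ) (θ : Sub Γ Δ), Ent H (X.mat θ (s.comp Sub.empty))

theorem Le.refl (X : RPred Γ) : X.Le X := ⟨Sub.id, .id, fun _ _ _ _ _ h => h⟩

theorem Le.trans (h : X.Le Y) (h' : Y.Le Z) : X.Le Z := by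
  obtain ⟨s, hs, h⟩ := h
  obtain ⟨s', hs', h'⟩ := h'
  refine ⟨s'.comp s, hs'.comp hs, fun Δ H θ c hc hX => ?_⟩
  rw [Sub.comp_assoc]
  exact h' H θ _ (hc.comp hs) (h H θ c hc hX)

theorem Valid.mono (hX : X.Valid) (h : X.Le Y) : Y.Valid := by
  obtain ⟨s, hs, hX⟩ := hX
  obtain ⟨s', hs', h⟩ := h
  refine ⟨s'.comp s, hs'.comp hs, fun Δ H θ => ?_⟩
  rw [Sub.comp_assoc]
  exact h H θ _ ((monSt_nil _).comp hs) (hX H θ)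

theorem Valid.le (hX : X.Valid) (Y : RPred Γ) : Y.Le X := by
  obtain ⟨s, hs, hX⟩ := hX
  refine ⟨s.comp Sub.empty, hs.comp (.nil _), fun Δ H θ c _ _ => ?_⟩
  rw [Sub.comp_assoc, Sub.empty_comp]
  exact hX H θ

theorem and_le_left : (X.and Y).Le X :=
  ⟨vars X.ty, .vars _, fun _ _ _ _ _ h => h.and_left⟩

theorem and_le_right : (X.and Y).Le Y :=
  ⟨Sub.wks X.ty, .wks _, fun _ _ _ _ _ h => h.and_right⟩

theorem le_and (h : X.Le Y) (h' : X.Le Z) : X.Le (Y.and Z) := by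
  obtain ⟨s, hs, h⟩ := h
  obtain ⟨s', hs', h'⟩ := h'
  refine ⟨Sub.append s s', hs.append hs', fun Δ H θ c hc hX => ?_⟩
  rw [Sub.append_comp]
  refine .and_intro ?_ ?_
  · rw [Sub.fst_append]; exact h H θ c hc hX
  · rw [Sub.snd_append]; exact h' H θ c hc hX

theorem imp_intro {Δ : Ctx} {H : Fm Δ} {θ : Sub Γ Δ} {f : Tms Δ (X.imp Y).ty}
    (hf : ∀ (Θ : Ctx) (H' : Fm Θ) (η : Sub Δ Θ), Ext H H' η → ∀ c : Tms Θ X.ty, MonSt H' c →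
      Ent H' (X.mat (θ.comp η) c) → Ent H' (Y.mat (θ.comp η) (Tms.apps (Sub.comp f η) c))) :
    Ent H ((X.imp Y).mat θ f) := X.isMatrix.imp_intro Y.isMatrix hf

theorem imp_elim {Δ : Ctx} {H : Fm Δ} {θ : Sub Γ Δ} {f : Tms Δ (X.imp Y).ty}
    (hf : Ent H ((X.imp Y).mat θ f)) {c : Tms Δ X.ty} (hc : MonSt H c)
    (hX : Ent H (X.mat θ c)) : Ent H (Y.mat θ (Tms.apps f c)) :=
  X.isMatrix.imp_elim Y.isMatrix hf hc hX

theorem ext {Δ Θ : Ctx} {H : Fm Δ} {H' : Fm Θ} {θ : Sub Γ Δ} {c : Tms Δ X.ty} {η : Sub Δ Θ}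
    (h : Ent H (X.mat θ c)) (e : Ext H H' η) : Ent H' (X.mat (θ.comp η) (Sub.comp c η)) := by
  rw [← X.isMatrix.subst]; exact h.ext e

/-- Realizers of an implication, from terms that compute realizers of the conclusion. -/
theorem imp_intro_lams {κ : Ctx} {s : Sub Y.ty (X.ty ++ κ)} (hs : SelfMajT s) {Δ : Ctx} {H : Fm Δ}
    {θ : Sub Γ Δ} {d : Tms Δ κ} (hd : MonSt H d)
    (h : ∀ (Θ : Ctx) (H' : Fm Θ) (η : Sub Δ Θ), Ext H H' η → ∀ c : Tms Θ X.ty, MonSt H' c →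
      Ent H' (X.mat (θ.comp η) c) →
        Ent H' (Y.mat (θ.comp η) (s.comp (Sub.append c (Sub.comp d η))))) :
    Ent H ((X.imp Y).mat θ ((Sub.lams X.ty s).comp d)) := by
  refine imp_intro fun Θ H' η e c hc hX => ?_
  -- β-conversion yields only an extensional equality of realizers. As the terms are monotone, it
  -- becomes a majorization, which the matrix tolerates.
  refine Y.isMatrix.mono (h Θ H' η e c hc hX) ?_
  rw [Sub.comp_assoc]
  exact (hs.comp_maj (hc.append (hd.ext e)).2).congr (.refl _) (eqvT_betas _ _ _).symm

theorem Le.curry (h : (X.and Y).Le Z) : X.Le (Y.imp Z) := by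
  obtain ⟨s, hs, h⟩ := h
  have hs' : SelfMajT (s.comp (Sub.append (Sub.wks Y.ty : Sub X.ty _) (vars Y.ty))) :=
    hs.comp ((SelfMajT.wks _).append (.vars _))
  refine ⟨_, hs'.lams, fun Δ H θ c hc hX => imp_intro_lams hs' hc fun Θ H' η e d hd hY => ?_⟩
  rw [Sub.comp_assoc, Sub.append_comp, Sub.wks_comp_append, Sub.vars_comp_append]
  refine h H' _ _ ((hc.ext e).append hd) (.and_intro ?_ ?_)
  · rw [Sub.fst_append]; exact ext hX e
  · rw [Sub.snd_append]; exact hY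

theorem Le.uncurry (h : X.Le (Y.imp Z)) : (X.and Y).Le Z := by
  obtain ⟨s, hs, h⟩ := h
  refine ⟨Tms.apps (s.comp (vars X.ty)) (Sub.wks X.ty), (hs.comp (.vars _)).tmsApps (.wks _),
    fun Δ H θ c hc hXY => ?_⟩
  rw [Tms.apps_comp, Sub.comp_assoc]
  exact imp_elim (h H θ _ (hc.comp (.vars _)) hXY.and_left) (hc.comp (.wks _)) hXY.and_right

theorem Valid.imp (h : X.Le Y) : (X.imp Y).Valid := by
  obtain ⟨s, hs, h⟩ := h
  have hs' : SelfMajT (s.comp (vars X.ty : Sub X.ty (X.ty ++ []))) := hs.comp (.vars _)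
  refine ⟨_, hs'.lams, fun Δ H θ => imp_intro_lams hs' (monSt_nil _) fun Θ H' η e d hd hX => ?_⟩
  rw [Sub.comp_assoc, Sub.vars_comp_append]
  exact h H' _ d hd hX

theorem Valid.le_of_imp (h : (X.imp Y).Valid) : X.Le Y :=
  (le_and (h.le X) (.refl X)).trans (Le.refl (X.imp Y)).uncurry

/-- Any monotone terms serve as realizers here; the zero functionals supply them at every type. -/
theorem bot_le : bot.Le X :=
  ⟨fun σ _ => .zeroAt σ, fun _ _ => .zeroAt _, fun _ _ _ _ _ h => h.bot_elim⟩

theorem le_or_left : X.Le (X.or Y) := by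
  refine ⟨Sub.append Sub.id (fun σ _ => .zeroAt σ), .append .id (fun _ _ => .zeroAt _),
    fun Δ H θ c _ h => .or_left ?_⟩
  rw [Sub.append_comp, Sub.fst_append]
  exact h

theorem le_or_right : Y.Le (X.or Y) := by
  refine ⟨Sub.append (fun σ _ => .zeroAt σ) Sub.id, .append (fun _ _ => .zeroAt _) .id,
    fun Δ H θ c _ h => .or_right ?_⟩
  rw [Sub.append_comp, Sub.snd_append]
  exact h

/-- A realizer of a disjunction does not say which side holds. The maximum of the two candidate
realizers of `Z` majorizes both, hence works in either case. -/
theorem or_le (h : X.Le Z) (h' : Y.Le Z) : (X.or Y).Le Z := by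
  obtain ⟨s, hs, h⟩ := h
  obtain ⟨s', hs', h'⟩ := h'
  have hl : SelfMajT (s.comp (vars X.ty) : Sub Z.ty (X.ty ++ Y.ty)) := hs.comp (.vars _)
  have hr : SelfMajT (s'.comp (Sub.wks X.ty)) := hs'.comp (.wks _)
  refine ⟨Sub.max (s.comp (vars X.ty)) (s'.comp (Sub.wks X.ty)),
    fun _ x => (hl x).max (hr x), fun Δ H θ c hc hXY => ?_⟩
  have hl := hl.comp_maj hc.2
  have hr := hr.comp_maj hc.2
  rw [Sub.comp_assoc] at hl hr
  rw [Sub.max_comp, Sub.comp_assoc, Sub.comp_assoc]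
  refine .or_elim hXY (fun H' e hX => ?_) (fun H' e hY => ?_)
  · exact Z.isMatrix.mono (h H' θ _ ((hc.of_ent e).comp (.vars _)) hX) fun _ x =>
      .maj_max_left (e.cut (hl x)) (e.cut (hr x))
  · exact Z.isMatrix.mono (h' H' θ _ ((hc.of_ent e).comp (.wks _)) hY) fun _ x =>
      .maj_max_right (e.cut (hl x)) (e.cut (hr x))

theorem all_intro {X : RPred (σ :: Γ)} {Δ : Ctx} {H : Fm Δ} {θ : Sub Γ Δ} {c : Tms Δ X.ty}
    (h : ∀ (Θ : Ctx) (H' : Fm Θ) (η : Sub Δ Θ), Ext H H' η → ∀ t : Tm Θ σ,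
      Ent H' (X.mat (Sub.cons t (θ.comp η)) (Sub.comp c η))) : Ent H (X.all.mat θ c) :=
  .all_intro fun Θ H' η e t => by
    rw [X.isMatrix.subst_lift]; exact h Θ H' η e t

theorem all_elim {X : RPred (σ :: Γ)} {Δ : Ctx} {H : Fm Δ} {θ : Sub Γ Δ} {c : Tms Δ X.ty}
    (h : Ent H (X.all.mat θ c)) (t : Tm Δ σ) : Ent H (X.mat (Sub.cons t θ) c) := by
  simpa only [X.isMatrix.subst_lift, Sub.comp_id] using Ent.all_elim h t

theorem ex_intro {X : RPred (σ :: Γ)} {Δ : Ctx} {H : Fm Δ} {θ : Sub Γ Δ} {c : Tms Δ X.ty}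
    (t : Tm Δ σ) (h : Ent H (X.mat (Sub.cons t θ) c)) : Ent H (X.ex.mat θ c) := by
  refine Ent.ex_intro t ?_
  simpa only [X.isMatrix.subst_lift, Sub.comp_id] using h

theorem ex_elim {X : RPred (σ :: Γ)} {Δ : Ctx} {H C : Fm Δ} {θ : Sub Γ Δ} {c : Tms Δ X.ty}
    (h : Ent H (X.ex.mat θ c)) (hC : ∀ (Θ : Ctx) (H' : Fm Θ) (η : Sub Δ Θ), Ext H H' η →
      ∀ t : Tm Θ σ, Ent H' (X.mat (Sub.cons t (θ.comp η)) (Sub.comp c η)) →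
        Ent H' (C.subst η)) : Ent H C :=
  Ent.ex_elim h fun Θ H' η e t ht => hC Θ H' η e t (by rwa [X.isMatrix.subst_lift] at ht)

/-- The terms `s` act on realizers alone and never see the parameters `θ`, so the same `s` serve for
all values of the new variable. -/
theorem le_all {Y : RPred (σ :: Γ)} (h : (X.sub Sub.wk).Le Y) : X.Le Y.all := by
  obtain ⟨s, hs, h⟩ := h
  refine ⟨s, hs, fun Δ H θ c hc hX => all_intro fun Θ H' η e t => ?_⟩
  rw [Sub.comp_assoc]
  exact h H' _ _ (hc.ext e) (ext hX e)

theorem ex_le {X : RPred (σ :: Γ)} {Y : RPred Γ} (h : X.Le (Y.sub Sub.wk)) : X.ex.Le Y := by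
  obtain ⟨s, hs, h⟩ := h
  refine ⟨s, hs, fun Δ H θ c hc hX => ex_elim hX fun Θ H' η e t ht => ?_⟩
  rw [Y.isMatrix.subst, Sub.comp_assoc]
  exact h H' _ _ (hc.ext e) ht

theorem all_le {X : RPred (σ :: Γ)} (t : Tm Γ σ) : X.all.Le (X.sub (Sub.cons t Sub.id)) := by
  refine ⟨Sub.id, .id, fun Δ H θ c hc hX => ?_⟩
  have := all_elim hX (t.subst θ)
  simpa [sub] using this

theorem le_ex {X : RPred (σ :: Γ)} (t : Tm Γ σ) : (X.sub (Sub.cons t Sub.id)).Le X.ex := by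
  refine ⟨Sub.id, .id, fun Δ H θ c hc hX => ex_intro (t.subst θ) ?_⟩
  simpa [sub] using hX

end RPred

open RPred

/-- The axioms of intuitionistic logic are realized. -/
theorem LogicAx.valid {Γ : Ctx} {A : Fm Γ} (h : LogicAx A) : A.interp.Valid := by
  cases h with
  | k A B => exact .imp (X := A.interp) (Y := B.interp.imp A.interp) (.curry and_le_left)
  | s A B C =>
    refine .imp (X := A.interp.imp (B.interp.imp C.interp))
      (Y := (A.interp.imp B.interp).imp (A.interp.imp C.interp)) (.curry (.curry ?_))
    have h₁ := ((and_le_left.trans and_le_left).uncurry.uncurry : ((((A.interp.imp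
      (B.interp.imp C.interp)).and (A.interp.imp B.interp)).and A.interp).and A.interp).and
        B.interp |>.Le C.interp)
    have h₂ := (and_le_right.uncurry : ((A.interp.imp (B.interp.imp C.interp)).and
      (A.interp.imp B.interp)).and A.interp |>.Le B.interp)
    exact (le_and (le_and (.refl _) and_le_right) h₂).trans h₁
  | andI A B => exact .imp (X := A.interp) (Y := B.interp.imp _) (.curry (.refl (A.interp.and _)))
  | andL A B => exact .imp (X := A.interp.and B.interp) and_le_left
  | andR A B => exact .imp (X := A.interp.and B.interp) and_le_right
  | orL A B => exact .imp (Y := A.interp.or B.interp) le_or_left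
  | orR A B => exact .imp (Y := A.interp.or B.interp) le_or_right
  | orE A B C =>
    refine .imp (X := A.interp.imp C.interp) (Y := (B.interp.imp C.interp).imp
      ((A.interp.or B.interp).imp C.interp)) (.curry (.curry ?_))
    have comm {X Y Z : RPred Γ} (h : (X.and Y).Le Z) : (Y.and X).Le Z :=
      (le_and and_le_right and_le_left).trans h
    refine comm (.uncurry (or_le (.curry ?_) (.curry ?_)))
    · exact comm and_le_left.uncurry
    · exact comm and_le_right.uncurry
  | botE A => exact .imp (X := .bot) (Y := A.interp) bot_le
  | allE A t =>
    refine .imp (X := A.interp.all) (Y := (A.inst t).interp) ?_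
    rw [Fm.inst, Fm.interp_subst]
    exact all_le t
  | exI A t =>
    refine .imp (X := (A.inst t).interp) (Y := A.interp.ex) ?_
    rw [Fm.inst, Fm.interp_subst]
    exact le_ex t

/-! ## Internal formulas and the arithmetical axioms -/

namespace RPred
variable {Γ Δ : Ctx} {σ : Ty}

/-- A formula as a predicate without realizers. -/
abbrev internal (A : Fm Γ) : RPred Γ :=
  ⟨[], fun θ _ => A.subst θ, ⟨fun _ _ _ => Fm.subst_subst _ _ _, fun h _ => h⟩⟩

/-- The interpretation of standardness. -/
abbrev st (t : Tm Γ σ) : RPred Γ :=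
  ⟨[σ], fun θ c => .maj σ (t.subst θ) (c .here), (Fm.st t).isMatrix_bn⟩

theorem Valid.all {X : RPred (σ :: Γ)} (h : X.Valid) : X.all.Valid := by
  obtain ⟨s, hs, h⟩ := h
  refine ⟨s, hs, fun Δ H θ => all_intro fun Θ H' η e t => ?_⟩
  rw [Sub.comp_assoc, Sub.empty_comp]
  exact h H' _

theorem Valid.of_all {X : RPred (σ :: Γ)} (h : X.all.Valid) : X.Valid := by
  obtain ⟨s, hs, h⟩ := h
  refine ⟨s, hs, fun Δ H θ => ?_⟩
  have := all_elim (h H (Sub.wk.comp θ)) (θ .here)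
  rwa [Sub.cons_here_wk_comp] at this

end RPred

/-- Only `st` contributes types of realizers. Over the empty tuple the quantifier prefix in the
clause for implication disappears. -/
theorem Fm.Internal.interp_eq {Γ : Ctx} {A : Fm Γ} (hA : A.Internal) :
    A.interp = RPred.internal A := by
  induction A with
  | eq s t => rfl
  | st t => exact hA.elim
  | bot => rfl
  | and A B ihA ihB => exact congrArg₂ RPred.and (ihA hA.1) (ihB hA.2)
  | or A B ihA ihB => exact congrArg₂ RPred.or (ihA hA.1) (ihB hA.2)
  | imp A B ihA ihB =>
    refine (congrArg₂ RPred.imp (ihA hA.1) (ihB hA.2)).trans ?_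
    have : ∀ {Γ Δ : Ctx} (θ : Sub Γ Δ), θ.comp (Sub.wks []) = θ := fun θ => Sub.comp_id θ
    simp only [RPred.imp, RPred.internal, this, Fm.allMonSts]
    rfl
  | all σ A ih => exact congrArg RPred.all (ih hA)
  | ex σ A ih => exact congrArg RPred.ex (ih hA)

theorem ArithAx.internal {Γ : Ctx} {A : Fm Γ} (h : ArithAx A) : A.Internal := by
  cases h with
  | eqRefl => trivial
  | eqSymm => exact ⟨trivial, trivial⟩
  | eqTrans => exact ⟨trivial, trivial, trivial⟩
  | extensionality => exact ⟨Fm.eqv_internal _ _, Fm.eqv_internal _ _⟩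
  | succNeZero => exact ⟨trivial, trivial⟩
  | succInj => exact ⟨trivial, trivial⟩
  | combK => exact Fm.eqv_internal _ _
  | combS => exact Fm.eqv_internal _ _
  | recurZero => exact Fm.eqv_internal _ _
  | recurSucc => exact Fm.eqv_internal _ _
  | induction A hA => exact ⟨hA.subst _, ⟨hA, hA.subst _⟩, hA⟩

theorem ArithAx.valid {Γ : Ctx} {A : Fm Γ} (h : ArithAx A) : A.interp.Valid := by
  rw [h.internal.interp_eq]
  exact ⟨Sub.empty, .nil _, fun Δ H θ => .arith (h.subst θ)⟩

/-! ## The standardness axioms -/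

/-- A realizer of `st(x)` is a bound of `x`. Bounds pass to equal and to majorized objects
unchanged, bounds of `z` and `x` apply to give one of `z x`, and a closed term is bounded by its
monotone majorant. -/
theorem StAx.valid {Γ : Ctx} {A : Fm Γ} (h : StAx A) : A.interp.Valid := by
  cases h with
  | @eqv σ x y =>
    refine .imp (X := (Fm.eqv σ x y).interp) (Y := (RPred.st x).imp (.st y)) (.curry ?_)
    rw [(Fm.eqv_internal x y).interp_eq]
    refine ⟨Sub.id, .id, fun Δ H θ c hc h => ?_⟩
    have h₁ := h.and_left
    simp only [Fm.eqv_subst] at h₁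
    exact .maj_congr h.and_right h₁ (.eqv_refl _)
  | @maj σ x y =>
    refine .imp (X := .st y) (Y := (Fm.maj σ x y).interp.imp (.st x)) (.curry ?_)
    rw [(Fm.maj_internal x y).interp_eq]
    refine ⟨Sub.id, .id, fun Δ H θ c hc h => ?_⟩
    have h₁ := h.and_right
    simp only [Fm.maj_subst] at h₁
    exact .maj_trans h₁ h.and_left
  | @closed σ t =>
    obtain ⟨t', ht', ht⟩ := exists_majorant t
    refine ⟨Sub.cons t' Sub.empty, .cons ht' (.nil _), fun Δ H θ => ?_⟩
    change Ent H (.maj σ ((t.subst Sub.empty).subst θ) (t'.subst Sub.empty))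
    rw [Tm.subst_subst, Sub.empty_comp]
    exact ht fun _ x => nomatch x
  | @app σ τ z x =>
    refine .imp (X := .st z) (Y := (RPred.st x).imp (.st (.app z x))) (.curry ?_)
    refine ⟨Sub.cons (.app (.var .here) (.var (.there .here))) Sub.empty,
      .cons (.app (.var _) (.var _)) (.nil _), fun Δ H θ c hc h => ?_⟩
    exact .maj_app h.and_left h.and_right

/-! ## Simultaneous recursion

Tuples of the types `κ` are coded by functionals of type `(κ → 0) → 0`. -/

/-- The code of the tuple of variables. -/
def tupleTm (κ : Ctx) : Tm κ (arrs κ .nat ⇒ .nat) :=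
  (Tm.apps κ (.var .here) (fun _ x => .var x.there)).lam

theorem SelfMaj.tupleTm (κ : Ctx) : SelfMaj (tupleTm κ) := by
  refine .lam fun Δ H c d h => ?_
  simp only [Tm.apps_subst]
  exact MajT.apps (h _) fun _ x => h x.there

theorem Ent.tupleTm_app {Δ κ : Ctx} {H : Fm Δ} (c : Tms Δ κ) (k : Tm Δ (arrs κ .nat)) :
    Ent H (.eqv .nat (.app ((tupleTm κ).subst c) k) (Tm.apps κ k c)) := by
  refine .eqv_trans (.beta _ _ _) ?_
  rw [Tm.apps_subst]
  exact .eqv_refl _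

/-- Every monotone function of a tuple is a function of its code. -/
theorem exists_decode {κ : Ctx} : ∀ {σ : Ty} {Γ : Ctx} {t : Tm (κ ++ Γ) σ}, SelfMaj t →
    ∃ p : Tm ((arrs κ .nat ⇒ .nat) :: Γ) σ, SelfMaj p ∧
      ∀ ⦃Δ : Ctx⦄ (H : Fm Δ) (c : Tms Δ κ) (θ : Sub Γ Δ), Ent H (.eqv σ
        (p.subst (Sub.cons ((tupleTm κ).subst c) θ)) (t.subst (Sub.append c θ)))
  | .nat, Γ, t, ht => by
    -- At type `0` the code is evaluated at the abstraction of `t`.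
    refine ⟨.app (.var .here) ((t.lams κ).subst Sub.wk), .app (.var _) (ht.lams.subst .wk),
      fun Δ H c θ => ?_⟩
    rw [Tm.subst, Tm.subst_wk_cons]
    exact .eqv_trans (.tupleTm_app _ _) (.betas _ _ _)
  | .arr ρ σ, Γ, t, ht => by
    -- Codes take values of type `0` only. At a function type the argument is made a parameter, the
    -- value is decoded by recursion on the type, and the parameter is abstracted again.
    obtain ⟨p, hp, h⟩ := exists_decode (σ := σ) (Γ := ρ :: Γ)
      (t := .app (t.subst (Sub.append (vars κ) (Sub.wk.comp (Sub.wks κ))))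
        (.var (Var.here.right κ)))
      (.app (ht.subst (.append (.vars _) (.comp .wk (.wks _)))) (.var _))
    refine ⟨(p.subst (Sub.cons (.var (.there .here)) (Sub.cons (.var .here)
      (Sub.wk.comp Sub.wk)))).lam,
      (hp.subst (.cons (.var _) (.cons (.var _) (.comp .wk .wk)))).lam, fun Δ H c θ => ?_⟩
    refine .eqv_intro fun Θ H' η e u => ?_
    simp only [Tm.subst_subst]
    refine .eqv_trans (.beta _ _ _) ?_
    have := h H' (Sub.comp c η) (Sub.cons u (θ.comp η))
    simpa using this

theorem exists_components (κ : Ctx) : ∃ p : Sub κ [arrs κ .nat ⇒ .nat], SelfMajT p ∧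
    ∀ ⦃Δ : Ctx⦄ (H : Fm Δ) (c : Tms Δ κ),
      EqvT H (p.comp (Sub.cons ((tupleTm κ).subst c) Sub.empty)) c := by
  have key {σ : Ty} (x : Var κ σ) := exists_decode (κ := κ) (Γ := []) (SelfMaj.var x.left)
  refine ⟨fun _ x => (key x).choose, fun _ x => (key x).choose_spec.1, fun Δ H c σ x => ?_⟩
  have := (key x).choose_spec.2 H c Sub.empty
  rwa [Tm.subst, Sub.append_left] at this

/-- Simultaneous monotone recursion. -/
theorem exists_recursion {κ : Ctx} {a : Sub κ []} {s : Sub κ (.nat :: κ)} (ha : SelfMajT a)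
    (hs : SelfMajT s) : ∃ g : Sub κ [.nat], SelfMajT g ∧ ∀ ⦃Δ : Ctx⦄ (H : Fm Δ),
      MajT H (a.comp Sub.empty) (g.comp (Sub.cons .zero Sub.empty)) ∧
      ∀ n : Tm Δ .nat, MajT H (s.comp (Sub.cons n (g.comp (Sub.cons n Sub.empty))))
        (g.comp (Sub.cons (.app .succ n) Sub.empty)) := by
  obtain ⟨p, hp, hpc⟩ := exists_components κ
  -- One step of the recursion on codes: decode the tuple, apply `s`, and encode the result.
  let b : Tm [.nat, arrs κ .nat ⇒ .nat] (arrs κ .nat ⇒ .nat) :=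
    (tupleTm κ).subst (s.comp (Sub.cons (.var .here) (p.comp (Sub.cons (.var (.there .here))
      Sub.empty))))
  have hb : SelfMaj b := (SelfMaj.tupleTm κ).subst (hs.comp (.cons (.var _)
    (hp.comp (.cons (.var _) (.nil _)))))
  let y : Tm [] (arrs κ .nat ⇒ .nat) := (tupleTm κ).subst a
  have hy : SelfMaj y := (SelfMaj.tupleTm κ).subst ha
  let r : Tm [.nat] (arrs κ .nat ⇒ .nat) :=
    .recMax (.var .here) (y.subst Sub.empty) (b.lam.lam.subst Sub.empty)
  have hr : SelfMaj r := .recMax (.var _) (hy.subst (.nil _)) (hb.lam.lam.subst (.nil _))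
  refine ⟨p.comp (Sub.cons r Sub.empty), hp.comp (.cons hr (.nil _)), fun Δ H => ⟨?_, fun n => ?_⟩⟩
  · have h₁ : MajT H (a.comp Sub.empty) (a.comp (Sub.empty : Sub [] Δ)) :=
      ha.comp_maj fun _ x => nomatch x
    refine h₁.congr (.refl _) (EqvT.symm ?_)
    rw [Sub.comp_assoc, Sub.cons_comp, Sub.empty_comp]
    refine EqvT.trans (EqvT.comp (.cons (d := Sub.empty) ?_ fun _ x => nomatch x) p) (hpc H _)
    simp only [r, y, Tm.recMax_subst, Tm.subst_subst, Sub.comp_assoc, Sub.empty_comp]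
    exact .recMax_zero _ _
  · have hn : MajT H (Sub.cons n Sub.empty : Tms Δ [.nat]) (Sub.cons n Sub.empty) :=
      .cons (.le_refl n) fun _ x => nomatch x
    have hrn := hr hn
    rw [Sub.comp_assoc, Sub.comp_assoc]
    -- The code of the new tuple is, up to conversion, the second entry of the maximum in the
    -- monotone recursor. Applying the monotone projections `p` afterwards brings the inequality
    -- back to tuples.
    have h₁ : Ent H (.maj _ ((tupleTm κ).subst (s.comp (Sub.cons n
        (p.comp (Sub.cons (r.subst (Sub.cons n Sub.empty)) Sub.empty)))))
        (r.subst (Sub.cons (.app .succ n) Sub.empty))) := by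
      have hz : Ent H (.maj _ (b.lam.lam.subst Sub.empty) (b.lam.lam.subst Sub.empty)) :=
        hb.lam.lam fun _ x => nomatch x
      have h₂ := Ent.maj_app (Ent.maj_app hz hrn) (.le_refl n)
      simp only [r, Tm.recMax_subst, Tm.subst_subst, Sub.empty_comp] at hrn h₂ ⊢
      refine .maj_congr (.maj_max_right hrn h₂) ?_ (.eqv_symm (.recMax_succ _ _ _))
      refine .eqv_trans (.eqv_elim (.beta _ _ _) _) (.eqv_trans (.beta _ _ _) ?_)
      simpa [b] using Ent.eqv_refl _
    have h₃ : MajT H _ _ := hp.comp_maj (.cons h₁ (c := Sub.empty) (d := Sub.empty) fun _ x => nomatch x)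
    refine h₃.congr ((hpc H _).trans ?_) ?_
    all_goals simpa using EqvT.refl _

/-! ## External induction -/

theorem EHAst.of_ent {Γ : Ctx} {A : Fm Γ} (h : ∀ H : Fm Γ, Ent H A) : EHAst A :=
  EHAst.mp (h (.imp .bot .bot)) Ent.refl

/-- The premises give realizers for `0` and for the step. Recursion on them need only dominate, and
correctness for standard `n` is again an external induction, now about the matrix. -/
theorem valid_extInduction {Γ : Ctx} {A : Fm (.nat :: Γ)} (h₀ : (A.inst .zero).interp.Valid)
    (hS : (Fm.allSt (.imp A A.next)).interp.Valid) : (Fm.allSt A).interp.Valid := by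
  refine Valid.all (X := (RPred.st (.var .here)).imp A.interp) (Valid.imp ?_)
  have hS := (Valid.of_all (X := (RPred.st (.var .here)).imp (A.interp.imp A.next.interp))
    hS).le_of_imp.uncurry
  rw [Fm.inst, Fm.interp_subst] at h₀
  rw [Fm.next, Fm.interp_subst] at hS
  generalize A.interp = X at *
  obtain ⟨a, ha, h₀⟩ := h₀
  obtain ⟨s, hs, hS⟩ := hS
  obtain ⟨g, hg, h⟩ := exists_recursion ha hs
  -- The statement that `g n` realizes the formula at `n`. It need not be internal, so ordinary
  -- induction would not be available.
  let B : Fm (.nat :: Γ) := X.mat Sub.id (g.comp (Sub.cons (.var .here) Sub.empty))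
  have hB {Δ : Ctx} (θ : Sub (.nat :: Γ) Δ) :
      B.subst θ = X.mat θ (g.comp (Sub.cons (θ .here) Sub.empty)) := by
    simp [B, X.isMatrix.subst]
  have key : EHAst (Fm.allSt B) := by
    refine .extInduction (EHAst.of_ent fun H => ?_) (EHAst.of_ent fun H => ?_)
    · rw [Fm.inst, hB]
      have := h₀ H Sub.id
      simp only [Sub.comp_id] at this
      exact X.isMatrix.mono this (h H).1
    · refine .all_intro fun Δ H₁ η e n => .imp_intro fun H₂ h₂ hn => .imp_intro fun H₃ h₃ hBn => ?_
      rw [Fm.next, Fm.subst_subst, hB]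
      rw [hB] at hBn
      have hn' : MonSt H₃ (Sub.cons n Sub.empty : Tms Δ [.nat]) :=
        .cons (h₃.cut hn) (.le_refl n) (monSt_nil _)
      -- A standard number is a monotone bound of itself, so `n` realizes its own standardness.
      refine X.isMatrix.mono (hS H₃ (Sub.cons n η) (Sub.cons n (g.comp (Sub.cons n Sub.empty)))
        (.cons (h₃.cut hn) (.le_refl n) (hn'.comp hg)) (.and_intro (.le_refl n) hBn)) ((h H₃).2 n)
  refine ⟨g, hg, fun Δ H θ c hc hm => ?_⟩
  have hm : Ent H (.maj .nat (θ .here) (c .here)) := hm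
  have h₁ := Ent.all_elim (Ent.of (key.subst (Sub.wk.comp θ)) : Ent H _) (θ .here)
  rw [Fm.subst_subst, Sub.lift_comp_cons, Sub.comp_id, Sub.cons_here_wk_comp] at h₁
  have h₂ := h₁.mp (.mp (.mp (.standard (.maj _ _)) (hc.1 .here)) hm)
  rw [hB] at h₂
  -- The realizer may use only the bound `c` of `n`, not `n` itself; `n ≤ c` gives `g n ≤* g c`.
  refine X.isMatrix.mono h₂ (hg.comp_maj fun _ x => ?_)
  cases x with
  | here => exact hm
  | there x => cases x

/-! ## Realizers of formulas with quantifiers over tuples -/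

namespace Fm
variable {Γ κ : Ctx} {σ : Ty}

theorem interp_ex_and_internal {B A : Fm (σ :: Γ)} (hB : B.Internal) :
    (ex σ (and B A)).interp = RPred.ex (.and (.internal B) A.interp) :=
  congrArg (fun X => RPred.ex (.and X A.interp)) hB.interp_eq

theorem mon_internal (t : Tm Γ σ) : (mon t).Internal := maj_internal _ _

theorem interp_exMonSt (A : Fm (σ :: Γ)) : (exMonSt A).interp =
    RPred.ex (.and (.and (.st (.var .here)) (.internal (mon (.var .here)))) A.interp) :=
  congrArg (fun X => RPred.ex (.and (.and (.st (.var .here)) X) A.interp)) (mon_internal _).interp_eq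

theorem interp_allMonSt (A : Fm (σ :: Γ)) : (allMonSt A).interp =
    RPred.all (.imp (.and (.st (.var .here)) (.internal (mon (.var .here)))) A.interp) :=
  congrArg (fun X => RPred.all (.imp (.and (.st (.var .here)) X) A.interp))
    (mon_internal _).interp_eq

/-- The internal `B` contributes no realizers, but this is a proved equality of type tuples and not
a definitional one. The translation `r` hides it; the lemmas below use the same device. -/
theorem ex_and_internal_intro {B A : Fm (σ :: Γ)} (hB : B.Internal) :
    ∃ r : Sub (ex σ (and B A)).interp.ty A.interp.ty, SelfMajT r ∧
      ∀ ⦃Δ : Ctx⦄ ⦃H : Fm Δ⦄ ⦃θ : Sub Γ Δ⦄ ⦃d : Tms Δ A.interp.ty⦄ (y : Tm Δ σ),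
        Ent H (B.subst (Sub.cons y θ)) → Ent H (A.interp.mat (Sub.cons y θ) d) →
          Ent H ((ex σ (and B A)).interp.mat θ (r.comp d)) := by
  rw [interp_ex_and_internal hB]
  exact ⟨Sub.id, .id, fun Δ H θ d y hy h => RPred.ex_intro y (.and_intro hy h)⟩

/-- Standardness of the witness is interpreted as the existence of the bound `g`, so it is not
required of `y` itself. -/
theorem exMonSt_intro (A : Fm (σ :: Γ)) :
    ∃ r : Sub (exMonSt A).interp.ty (σ :: A.interp.ty), SelfMajT r ∧
      ∀ ⦃Δ : Ctx⦄ ⦃H : Fm Δ⦄ ⦃θ : Sub Γ Δ⦄ ⦃g y : Tm Δ σ⦄ ⦃d : Tms Δ A.interp.ty⦄,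
        Ent H (.maj σ y g) → Ent H (.maj σ y y) → Ent H (A.interp.mat (Sub.cons y θ) d) →
          Ent H ((exMonSt A).interp.mat θ (r.comp (Sub.cons g d))) := by
  rw [interp_exMonSt]
  refine ⟨Sub.id, .id, fun Δ H θ g y d hyg hy h => RPred.ex_intro y ?_⟩
  exact .and_intro (.and_intro hyg (by simp only [mon_subst]; exact hy)) h

theorem exMonSt_elim (A : Fm (σ :: Γ)) :
    ∃ r : Sub (σ :: A.interp.ty) (exMonSt A).interp.ty, SelfMajT r ∧
      ∀ ⦃Δ : Ctx⦄ ⦃H : Fm Δ⦄ ⦃θ : Sub Γ Δ⦄ ⦃c : Tms Δ (exMonSt A).interp.ty⦄ ⦃C : Fm Δ⦄,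
        Ent H ((exMonSt A).interp.mat θ c) → (∀ (Θ : Ctx) (H' : Fm Θ) (η : Sub Δ Θ),
          Ext H H' η → ∀ y : Tm Θ σ, Ent H' (.maj σ y (r.comp (Sub.comp c η) .here)) →
            Ent H' (.maj σ y y) → Ent H' (A.interp.mat (Sub.cons y (θ.comp η))
              (Sub.wk.comp (r.comp (Sub.comp c η)))) → Ent H' (C.subst η)) → Ent H C := by
  rw [interp_exMonSt]
  refine ⟨Sub.id, .id, fun Δ H θ c C h hC => RPred.ex_elim h fun Θ H' η e y hy => ?_⟩
  have := hy.and_left.and_right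
  simp only [mon_subst] at this
  exact hC Θ H' η e y hy.and_left.and_left this hy.and_right

theorem exSt_elim (A : Fm (σ :: Γ)) :
    ∃ r : Sub (σ :: A.interp.ty) (exSt A).interp.ty, SelfMajT r ∧
      ∀ ⦃Δ : Ctx⦄ ⦃H : Fm Δ⦄ ⦃θ : Sub Γ Δ⦄ ⦃c : Tms Δ (exSt A).interp.ty⦄ ⦃C : Fm Δ⦄,
        Ent H ((exSt A).interp.mat θ c) → (∀ (Θ : Ctx) (H' : Fm Θ) (η : Sub Δ Θ),
          Ext H H' η → ∀ y : Tm Θ σ, Ent H' (.maj σ y (r.comp (Sub.comp c η) .here)) →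
            Ent H' (A.interp.mat (Sub.cons y (θ.comp η))
              (Sub.wk.comp (r.comp (Sub.comp c η)))) → Ent H' (C.subst η)) → Ent H C :=
  ⟨Sub.id, .id, fun _ _ _ _ _ h hC =>
    RPred.ex_elim (X := .and (.st (.var .here)) A.interp) h fun Θ H' η e y hy =>
      hC Θ H' η e y hy.and_left hy.and_right⟩

/-- The premise `st(x)` is realized by the standard bound `c`, so `f` is applied to `c` and not to
`x`. -/
theorem allMonSt_elim (A : Fm (σ :: Γ)) :
    ∃ r : Sub A.interp.ty (σ :: (allMonSt A).interp.ty), SelfMajT r ∧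
      ∀ ⦃Δ : Ctx⦄ ⦃H : Fm Δ⦄ ⦃θ : Sub Γ Δ⦄ ⦃f : Tms Δ (allMonSt A).interp.ty⦄ ⦃x c : Tm Δ σ⦄,
        Ent H ((allMonSt A).interp.mat θ f) → Ent H (.maj σ x x) → Ent H (.maj σ x c) →
          Ent H (.st c) → Ent H (A.interp.mat (Sub.cons x θ) (r.comp (Sub.cons c f))) := by
  rw [interp_allMonSt]
  refine ⟨Tms.apps (ρs := [σ]) Sub.wk (Sub.cons (.var .here) Sub.empty),
    .tmsApps .wk (.cons (.var _) (.nil _)), fun Δ H θ f x c h hx hxc hc => ?_⟩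
  rw [Tms.apps_comp]
  have := RPred.imp_elim (RPred.all_elim h x) (c := Sub.cons c Sub.empty)
    (.cons hc hxc.maj_right (monSt_nil _)) (.and_intro hxc (by simp only [mon_subst]; exact hx))
  simpa [Sub.wk_comp_cons] using this

theorem allMonSt_intro {A : Fm (σ :: Γ)} {s : Sub A.interp.ty (σ :: κ)} (hs : SelfMajT s) :
    ∃ r : Sub (allMonSt A).interp.ty κ, SelfMajT r ∧
      ∀ ⦃Δ : Ctx⦄ ⦃H : Fm Δ⦄ ⦃θ : Sub Γ Δ⦄ ⦃d : Tms Δ κ⦄, MonSt H d →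
        (∀ (Θ : Ctx) (H' : Fm Θ) (η : Sub Δ Θ), Ext H H' η → ∀ c x : Tm Θ σ, Ent H' (.st c) →
          Ent H' (.maj σ x x) → Ent H' (.maj σ x c) → Ent H' (A.interp.mat
            (Sub.cons x (θ.comp η)) (s.comp (Sub.cons c (Sub.comp d η))))) →
          Ent H ((allMonSt A).interp.mat θ (r.comp d)) := by
  rw [interp_allMonSt]
  refine ⟨Sub.lams [σ] s, hs.lams, fun Δ H θ d hd h => RPred.all_intro fun Θ H' η e x => ?_⟩
  rw [Sub.comp_assoc]
  refine RPred.imp_intro_lams hs (hd.ext e) fun Ξ H'' ζ e' c hc hx => ?_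
  have h₁ := hx.and_right
  simp only [mon_subst] at h₁
  have := h Ξ H'' (η.comp ζ) (e.comp e') (c .here) (x.subst ζ) (hc.1 .here) h₁ hx.and_left
  rw [Sub.cons_comp, Sub.comp_assoc, Sub.comp_assoc]
  exact this

variable {ρs τs : List Ty}

theorem exMonSts_intro (A : Fm (τs ++ Γ)) :
    ∃ r : Sub (exMonSts τs A).interp.ty (τs ++ A.interp.ty), SelfMajT r ∧
      ∀ ⦃Δ : Ctx⦄ ⦃H : Fm Δ⦄ ⦃θ : Sub Γ Δ⦄ ⦃g y : Tms Δ τs⦄ ⦃d : Tms Δ A.interp.ty⦄,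
        MajT H y g → MajT H y y → Ent H (A.interp.mat (Sub.append y θ) d) →
          Ent H ((exMonSts τs A).interp.mat θ (r.comp (Sub.append g d))) := by
  induction τs with
  | nil => exact ⟨Sub.id, .id, fun _ _ _ _ _ _ _ _ h => h⟩
  | cons σ τs ih =>
    rw [show exMonSts (σ :: τs) A = exMonSts τs (exMonSt A) from rfl]
    obtain ⟨r, hr, h⟩ := ih (exMonSt A)
    obtain ⟨r₁, hr₁, h₁⟩ := exMonSt_intro A
    refine ⟨r.comp (Sub.append ((vars τs).comp Sub.wk)
      (r₁.comp (Sub.cons (.var .here) ((Sub.wks τs).comp Sub.wk)))),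
      hr.comp (.append (.comp (.vars _) .wk) (hr₁.comp (.cons (.var _) (.comp (.wks _) .wk)))),
      fun Δ H θ g y d hyg hy hA => ?_⟩
    have := h (fun _ x => hyg x.there) (fun _ x => hy x.there) (h₁ (hyg .here) (hy .here) hA)
    simpa [Sub.append] using this

theorem exMonSts_elim (A : Fm (τs ++ Γ)) :
    ∃ (p : Sub τs (exMonSts τs A).interp.ty) (q : Sub A.interp.ty (exMonSts τs A).interp.ty),
      SelfMajT p ∧ SelfMajT q ∧
      ∀ ⦃Δ : Ctx⦄ ⦃H : Fm Δ⦄ ⦃θ : Sub Γ Δ⦄ ⦃c : Tms Δ (exMonSts τs A).interp.ty⦄ ⦃C : Fm Δ⦄,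
        Ent H ((exMonSts τs A).interp.mat θ c) → (∀ (Θ : Ctx) (H' : Fm Θ) (η : Sub Δ Θ),
          Ext H H' η → ∀ y : Tms Θ τs, MajT H' y (p.comp (Sub.comp c η)) → MajT H' y y →
            Ent H' (A.interp.mat (Sub.append y (θ.comp η)) (q.comp (Sub.comp c η))) →
              Ent H' (C.subst η)) → Ent H C := by
  induction τs with
  | nil =>
    refine ⟨Sub.empty, Sub.id, .nil _, .id, fun Δ H θ c C h hC => ?_⟩
    have := hC Δ H Sub.id (.refl H) Sub.empty (fun _ x => nomatch x) (fun _ x => nomatch x)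
      (by simp only [Sub.comp_id]; exact h)
    rwa [Fm.subst_id] at this
  | cons σ τs ih =>
    rw [show exMonSts (σ :: τs) A = exMonSts τs (exMonSt A) from rfl]
    obtain ⟨p, q, hp, hq, h⟩ := ih (exMonSt A)
    obtain ⟨r, hr, h₁⟩ := exMonSt_elim A
    have hrq := hr.comp hq
    refine ⟨Sub.cons (r.comp q .here) p, Sub.wk.comp (r.comp q), .cons (hrq _) hp,
      fun _ x => hrq x.there, fun Δ H θ c C hc hC => ?_⟩
    refine h hc fun Θ H' η e y hy hy' hA => h₁ hA fun Θ' H'' ζ e' z hz hz' hA' => ?_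
    rw [Fm.subst_subst]
    refine hC Θ' H'' _ (e.comp e') (Sub.cons z (Sub.comp y ζ)) ?_ (hy'.ext e' |>.cons hz') ?_
    · rw [Sub.cons_comp]
      have := hy.ext e'
      rw [Sub.comp_assoc, Sub.comp_assoc] at this
      refine this.cons ?_
      rw [Sub.comp_assoc, Sub.comp_assoc, ← Sub.comp_assoc r] at hz
      exact hz
    · rw [Sub.append_comp] at hA'
      simpa [Sub.append] using hA'

theorem exSts_elim (A : Fm (τs ++ Γ)) :
    ∃ (p : Sub τs (exSts τs A).interp.ty) (q : Sub A.interp.ty (exSts τs A).interp.ty),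
      SelfMajT p ∧ SelfMajT q ∧
      ∀ ⦃Δ : Ctx⦄ ⦃H : Fm Δ⦄ ⦃θ : Sub Γ Δ⦄ ⦃c : Tms Δ (exSts τs A).interp.ty⦄ ⦃C : Fm Δ⦄,
        Ent H ((exSts τs A).interp.mat θ c) → (∀ (Θ : Ctx) (H' : Fm Θ) (η : Sub Δ Θ),
          Ext H H' η → ∀ y : Tms Θ τs, MajT H' y (p.comp (Sub.comp c η)) →
            Ent H' (A.interp.mat (Sub.append y (θ.comp η)) (q.comp (Sub.comp c η))) →
              Ent H' (C.subst η)) → Ent H C := by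
  induction τs with
  | nil =>
    refine ⟨Sub.empty, Sub.id, .nil _, .id, fun Δ H θ c C h hC => ?_⟩
    have := hC Δ H Sub.id (.refl H) Sub.empty (fun _ x => nomatch x)
      (by simp only [Sub.comp_id]; exact h)
    rwa [Fm.subst_id] at this
  | cons σ τs ih =>
    rw [show exSts (σ :: τs) A = exSts τs (exSt A) from rfl]
    obtain ⟨p, q, hp, hq, h⟩ := ih (exSt A)
    obtain ⟨r, hr, h₁⟩ := exSt_elim A
    have hrq := hr.comp hq
    refine ⟨Sub.cons (r.comp q .here) p, Sub.wk.comp (r.comp q), .cons (hrq _) hp,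
      fun _ x => hrq x.there, fun Δ H θ c C hc hC => ?_⟩
    refine h hc fun Θ H' η e y hy hA => h₁ hA fun Θ' H'' ζ e' z hz hA' => ?_
    rw [Fm.subst_subst]
    refine hC Θ' H'' _ (e.comp e') (Sub.cons z (Sub.comp y ζ)) ?_ ?_
    · rw [Sub.cons_comp]
      have := hy.ext e'
      rw [Sub.comp_assoc, Sub.comp_assoc] at this
      refine this.cons ?_
      rw [Sub.comp_assoc, Sub.comp_assoc, ← Sub.comp_assoc r] at hz
      exact hz
    · rw [Sub.append_comp] at hA'
      simpa [Sub.append] using hA'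

theorem exMonLes_intro (t : Tms Γ τs) (A : Fm (τs ++ Γ)) :
    ∃ r : Sub (exMonLes τs t A).interp.ty A.interp.ty, SelfMajT r ∧
      ∀ ⦃Δ : Ctx⦄ ⦃H : Fm Δ⦄ ⦃θ : Sub Γ Δ⦄ ⦃y : Tms Δ τs⦄ ⦃d : Tms Δ A.interp.ty⦄,
        MajT H y y → MajT H y (Sub.comp t θ) → Ent H (A.interp.mat (Sub.append y θ) d) →
          Ent H ((exMonLes τs t A).interp.mat θ (r.comp d)) := by
  induction τs with
  | nil => exact ⟨Sub.id, .id, fun _ _ _ _ _ _ _ h => h⟩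
  | cons σ τs ih =>
    rw [show exMonLes (σ :: τs) t A =
      exMonLes τs (fun _ x => t x.there) (exMonLe ((t .here).subst (Sub.wks τs)) A) from rfl]
    obtain ⟨r, hr, h⟩ := ih (fun _ x => t x.there)
      (exMonLe ((t .here).subst (Sub.wks τs)) A)
    obtain ⟨r₁, hr₁, h₁⟩ : ∃ r : Sub (exMonLe ((t .here).subst (Sub.wks τs)) A).interp.ty _, _ :=
      ex_and_internal_intro (A := A)
      (B := .and (mon (.var .here)) (maj σ (.var .here)
        (((t .here).subst (Sub.wks τs)).subst Sub.wk))) ⟨mon_internal _, maj_internal _ _⟩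
    refine ⟨r.comp r₁, hr.comp hr₁, fun Δ H θ y d hy hyt hA => ?_⟩
    rw [Sub.comp_assoc]
    refine h (fun _ x => hy x.there) (fun _ x => hyt x.there) (h₁ (y .here) ?_ hA)
    refine .and_intro ?_ ?_
    · rw [mon_subst]; exact hy .here
    · rw [maj_subst]; simpa [Sub.comp] using hyt .here

theorem exLes_intro (t : Tms Γ τs) (A : Fm (τs ++ Γ)) :
    ∃ r : Sub (exLes τs t A).interp.ty A.interp.ty, SelfMajT r ∧
      ∀ ⦃Δ : Ctx⦄ ⦃H : Fm Δ⦄ ⦃θ : Sub Γ Δ⦄ ⦃y : Tms Δ τs⦄ ⦃d : Tms Δ A.interp.ty⦄,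
        MajT H y (Sub.comp t θ) → Ent H (A.interp.mat (Sub.append y θ) d) →
          Ent H ((exLes τs t A).interp.mat θ (r.comp d)) := by
  induction τs with
  | nil => exact ⟨Sub.id, .id, fun _ _ _ _ _ _ h => h⟩
  | cons σ τs ih =>
    rw [show exLes (σ :: τs) t A =
      exLes τs (fun _ x => t x.there) (exLe ((t .here).subst (Sub.wks τs)) A) from rfl]
    obtain ⟨r, hr, h⟩ := ih (fun _ x => t x.there) (exLe ((t .here).subst (Sub.wks τs)) A)
    obtain ⟨r₁, hr₁, h₁⟩ : ∃ r : Sub (exLe ((t .here).subst (Sub.wks τs)) A).interp.ty _, _ :=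
      ex_and_internal_intro (A := A)
      (B := maj σ (.var .here) (((t .here).subst (Sub.wks τs)).subst Sub.wk)) (maj_internal _ _)
    refine ⟨r.comp r₁, hr.comp hr₁, fun Δ H θ y d hyt hA => ?_⟩
    rw [Sub.comp_assoc]
    refine h (fun _ x => hyt x.there) (h₁ (y .here) ?_ hA)
    rw [maj_subst]; simpa [Sub.comp] using hyt .here

theorem allMonSts_elim (A : Fm (ρs ++ Γ)) :
    ∃ r : Sub A.interp.ty (ρs ++ (allMonSts ρs A).interp.ty), SelfMajT r ∧
      ∀ ⦃Δ : Ctx⦄ ⦃H : Fm Δ⦄ ⦃θ : Sub Γ Δ⦄ ⦃f : Tms Δ (allMonSts ρs A).interp.ty⦄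
        ⦃x c : Tms Δ ρs⦄, Ent H ((allMonSts ρs A).interp.mat θ f) → MajT H x x → MajT H x c →
          StT H c → Ent H (A.interp.mat (Sub.append x θ) (r.comp (Sub.append c f))) := by
  induction ρs with
  | nil => exact ⟨Sub.id, .id, fun _ _ _ _ _ _ h _ _ _ => h⟩
  | cons σ ρs ih =>
    rw [show allMonSts (σ :: ρs) A = allMonSts ρs (allMonSt A) from rfl]
    obtain ⟨r, hr, h⟩ := ih (allMonSt A)
    obtain ⟨r₁, hr₁, h₁⟩ := allMonSt_elim A
    refine ⟨r₁.comp (Sub.cons (.var .here) (r.comp Sub.wk)),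
      hr₁.comp (.cons (.var _) (hr.comp .wk)), fun Δ H θ f x c hf hx hxc hc => ?_⟩
    have := h₁ (h hf (fun _ y => hx y.there) (fun _ y => hxc y.there) (fun _ y => hc y.there))
      (hx .here) (hxc .here) (hc .here)
    simpa [Sub.append] using this

theorem allMonSts_intro {A : Fm (ρs ++ Γ)} {s : Sub A.interp.ty (ρs ++ κ)} (hs : SelfMajT s) :
    ∃ r : Sub (allMonSts ρs A).interp.ty κ, SelfMajT r ∧
      ∀ ⦃Δ : Ctx⦄ ⦃H : Fm Δ⦄ ⦃θ : Sub Γ Δ⦄ ⦃d : Tms Δ κ⦄, MonSt H d →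
        (∀ (Θ : Ctx) (H' : Fm Θ) (η : Sub Δ Θ), Ext H H' η → ∀ c x : Tms Θ ρs, StT H' c →
          MajT H' x x → MajT H' x c → Ent H' (A.interp.mat
            (Sub.append x (θ.comp η)) (s.comp (Sub.append c (Sub.comp d η))))) →
          Ent H ((allMonSts ρs A).interp.mat θ (r.comp d)) := by
  induction ρs with
  | nil =>
    refine ⟨s, hs, fun Δ H θ d hd h => ?_⟩
    have := h Δ H Sub.id (.refl H) Sub.empty Sub.empty (fun _ x => nomatch x)
      (fun _ x => nomatch x) (fun _ x => nomatch x)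
    simp only [Sub.comp_id] at this
    exact this
  | cons σ ρs ih =>
    rw [show allMonSts (σ :: ρs) A = allMonSts ρs (allMonSt A) from rfl]
    obtain ⟨r₁, hr₁, h₁⟩ := allMonSt_intro (κ := ρs ++ κ) hs
    obtain ⟨r, hr, h⟩ := ih hr₁
    refine ⟨r, hr, fun Δ H θ d hd hA => h hd fun Θ H' η e c x hc hx hxc => ?_⟩
    refine h₁ (.append ⟨hc, hxc.right⟩ (hd.ext e)) fun Ξ H'' ζ e' c' x' hc' hx' hxc' => ?_
    have := hA Ξ H'' _ (e.comp e') (Sub.cons c' (Sub.comp c ζ)) (Sub.cons x' (Sub.comp x ζ))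
      ((hc.ext e').cons hc') ((hx.ext e').cons hx') ((hxc.ext e').cons hxc')
    simpa [Sub.append] using this

theorem alls_elim (A : Fm (ρs ++ Γ)) :
    ∃ r : Sub A.interp.ty (alls ρs A).interp.ty, SelfMajT r ∧
      ∀ ⦃Δ : Ctx⦄ ⦃H : Fm Δ⦄ ⦃θ : Sub Γ Δ⦄ ⦃f : Tms Δ (alls ρs A).interp.ty⦄ (x : Tms Δ ρs),
        Ent H ((alls ρs A).interp.mat θ f) →
          Ent H (A.interp.mat (Sub.append x θ) (r.comp f)) := by
  induction ρs with
  | nil => exact ⟨Sub.id, .id, fun _ _ _ _ _ h => h⟩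
  | cons σ ρs ih =>
    rw [show alls (σ :: ρs) A = alls ρs (all σ A) from rfl]
    obtain ⟨r, hr, h⟩ := ih (all σ A)
    exact ⟨r, hr, fun Δ H θ f x hf => RPred.all_elim (X := A.interp) (h _ hf) (x .here)⟩

theorem alls_intro (A : Fm (ρs ++ Γ)) :
    ∃ r : Sub (alls ρs A).interp.ty A.interp.ty, SelfMajT r ∧
      ∀ ⦃Δ : Ctx⦄ ⦃H : Fm Δ⦄ ⦃θ : Sub Γ Δ⦄ ⦃d : Tms Δ A.interp.ty⦄,
        (∀ (Θ : Ctx) (H' : Fm Θ) (η : Sub Δ Θ), Ext H H' η → ∀ x : Tms Θ ρs,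
          Ent H' (A.interp.mat (Sub.append x (θ.comp η)) (Sub.comp d η))) →
          Ent H ((alls ρs A).interp.mat θ (r.comp d)) := by
  induction ρs with
  | nil =>
    refine ⟨Sub.id, .id, fun Δ H θ d h => ?_⟩
    have := h Δ H Sub.id (.refl H) Sub.empty
    simp only [Sub.comp_id] at this
    exact this
  | cons σ ρs ih =>
    rw [show alls (σ :: ρs) A = alls ρs (all σ A) from rfl]
    obtain ⟨r, hr, h⟩ := ih (all σ A)
    refine ⟨r, hr, fun Δ H θ d hA => h fun Θ H' η e x =>
      RPred.all_intro (X := A.interp) fun Ξ H'' ζ e' t => ?_⟩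
    have := hA Ξ H'' _ (e.comp e') (Sub.cons t (Sub.comp x ζ))
    rw [← Sub.comp_assoc, ← Sub.comp_assoc] at this
    rw [Sub.append_comp]
    exact this

end Fm

/-! ## The characteristic principles -/

/-- A monotone standard universal quantifier mentions `st` only in a premise, and an implication
whose conclusion has no realizers has none either. -/
theorem ExFree.bnTypes_eq {Γ : Ctx} {A : Fm Γ} (h : ExFree A) : A.bnTypes = [] := by
  induction h with
  | eq => rfl
  | bot => rfl
  | and _ _ ihA ihB => simp [Fm.bnTypes, ihA, ihB]
  | or _ _ ihA ihB => simp [Fm.bnTypes, ihA, ihB]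
  | imp _ _ _ ihB => simp [Fm.bnTypes, ihB]
  | all _ ih => exact ih
  | ex _ ih => exact ih
  | allMonSt _ ih => simp [Fm.allMonSt, Fm.bnTypes, ih]

namespace Fm
variable {Γ Θ κ : Ctx}

/-- Realizers of a formula as realizers of a substitution instance. -/
theorem exists_realizer_subst (A : Fm Γ) (θ : Sub Γ Θ) {q : Sub A.interp.ty κ}
    (hq : SelfMajT q) : ∃ q' : Sub (A.subst θ).interp.ty κ, SelfMajT q' ∧
      ∀ ⦃Δ : Ctx⦄ ⦃H : Fm Δ⦄ ⦃η : Sub Θ Δ⦄ ⦃c : Tms Δ κ⦄,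
        Ent H (A.interp.mat (θ.comp η) (q.comp c)) →
          Ent H ((A.subst θ).interp.mat η (q'.comp c)) := by
  rw [interp_subst]
  exact ⟨q, hq, fun _ _ _ _ h => h⟩

theorem exists_of_interp_subst {A : Fm Γ} {θ : Sub Γ Θ} {Δ : Ctx} {H : Fm Δ} {η : Sub Θ Δ}
    {d : Tms Δ (A.subst θ).interp.ty} (h : Ent H ((A.subst θ).interp.mat η d)) :
    ∃ d' : Tms Δ A.interp.ty, Ent H (A.interp.mat (θ.comp η) d') := by
  revert d
  rw [interp_subst]
  exact fun h => ⟨_, h⟩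

theorem imp_intro (A : Fm Γ) {B : Fm Γ} {s : Sub B.interp.ty κ} (hs : SelfMajT s) :
    ∃ r : Sub (imp A B).interp.ty κ, SelfMajT r ∧
      ∀ ⦃Δ : Ctx⦄ ⦃H : Fm Δ⦄ ⦃θ : Sub Γ Δ⦄ ⦃d : Tms Δ κ⦄, MonSt H d →
        (∀ (Θ : Ctx) (H' : Fm Θ) (η : Sub Δ Θ), Ext H H' η → ∀ c : Tms Θ A.interp.ty,
          Ent H' (A.interp.mat (θ.comp η) c) →
            Ent H' (B.interp.mat (θ.comp η) (s.comp (Sub.comp d η)))) →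
          Ent H ((imp A B).interp.mat θ (r.comp d)) := by
  have hs' := hs.comp (.wks A.interp.ty)
  refine ⟨_, hs'.lams, fun Δ H θ d hd h => RPred.imp_intro_lams hs' hd
    fun Θ H' η e c _ hA => ?_⟩
  rw [Sub.comp_assoc, Sub.wks_comp_append]
  exact h Θ H' η e c hA

end Fm

/-- The hypothesis computes from a bound of `x` a bound `p` of the witness and realizers `q` of `Φ`.
The choice functional is `p` abstracted over `x`; as a monotone term it also bounds itself. -/
theorem valid_mAC {Γ : Ctx} (ρs τs : List Ty) (Φ : Fm (τs ++ (ρs ++ Γ))) :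
    (mAC ρs τs Φ).interp.Valid := by
  refine Valid.imp (X := (Fm.allMonSts ρs (.exMonSts τs Φ)).interp) (Y := Fm.interp _) ?_
  obtain ⟨e, he, h⟩ := Fm.allMonSts_elim (Fm.exMonSts τs Φ)
  obtain ⟨p, q, hp, hq, hE⟩ := Fm.exMonSts_elim Φ
  have hpe := hp.comp he
  have hqe := hq.comp he
  obtain ⟨q', hq', hΦ⟩ := Fm.exists_realizer_subst Φ
    (((Sub.wks (τs.map (arrs ρs))).lifts ρs).lifts τs) hqe
  obtain ⟨r₁, hr₁, h₁⟩ := Fm.exMonLes_intro (Tms.apps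
    (Sub.comp (vars (τs.map (arrs ρs))) (Sub.wks ρs)) (vars ρs))
    (Φ.subst (((Sub.wks (τs.map (arrs ρs))).lifts ρs).lifts τs))
  obtain ⟨r₂, hr₂, h₂⟩ := Fm.allMonSts_intro (hr₁.comp hq')
  obtain ⟨r₃, hr₃, h₃⟩ := Fm.exMonSts_intro (τs := τs.map (arrs ρs)) (Fm.allMonSts ρs (Fm.exMonLes τs
    (Tms.apps (Sub.comp (vars (τs.map (arrs ρs))) (Sub.wks ρs)) (vars ρs))
    (Φ.subst (((Sub.wks (τs.map (arrs ρs))).lifts ρs).lifts τs))))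
  have hg := hpe.lams
  refine ⟨r₃.comp (Sub.append (Sub.lams ρs (p.comp e)) r₂), hr₃.comp (hg.append hr₂),
    fun Δ H θ c hc hX => ?_⟩
  rw [Sub.comp_assoc, Sub.append_comp]
  have hgc := hg.comp_maj hc.2
  refine h₃ hgc hgc (h₂ hc fun Δ₁ H₁ η₁ e₁ d x hd hx hxd => ?_)
  -- The hypothesis is instantiated with `x` as its own bound instead of the given bound `d`: the
  -- witness then lies below the choice functional at `x`, as required. This `x` is standard because
  -- `d` majorizes it.
  have hxc := h (ext hX e₁) hx hx (hd.of_maj hxd)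
  refine hE hxc fun Δ₂ H₂ η₂ e₂ y hy hy' hΦy => ?_
  rw [RPred.isMatrix _ |>.subst, Sub.comp_assoc, Sub.comp_assoc, Sub.append_comp]
  refine h₁ hy' ?_ (hΦ ?_)
  · refine hy.congr (.refl _) ?_
    simp only [Tms.apps_comp, Sub.comp_assoc, Sub.append_comp, Sub.wks_comp_append,
      Sub.vars_comp_append]
    rw [← Sub.comp_assoc p]
    exact (eqvT_betas _ _ _).symm
  -- The realizers of `Φ` were computed from `x`, but those to be given may depend only on `d`;
  -- monotonicity passes from `x` to `d`.
  · refine Φ.interp.isMatrix.mono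
      (c := q.comp ((e.comp (Sub.append x (Sub.comp c η₁))).comp η₂)) ?_ ?_
    · simp only [Sub.lifts_comp_append, Sub.append_comp, Sub.wks_comp_append]
      simp only [Sub.append_comp] at hΦy
      exact hΦy
    · have := hqe.comp_maj ((MajT.append hxd (hc.ext e₁).2).ext e₂)
      simp only [Sub.comp_assoc, Sub.append_comp] at this ⊢
      exact this

/-- Realizers of a universal statement are uniform in `x`, so the bound they contain already serves
for all `x` at once. -/
theorem valid_realization {Γ : Ctx} (ρs τs : List Ty) (Φ : Fm (τs ++ (ρs ++ Γ))) :
    (realization ρs τs Φ).interp.Valid := by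
  refine Valid.imp (X := (Fm.alls ρs (.exSts τs Φ)).interp) (Y := Fm.interp _) ?_
  obtain ⟨e, he, h⟩ := Fm.alls_elim (Fm.exSts τs Φ)
  obtain ⟨p, q, hp, hq, hE⟩ := Fm.exSts_elim Φ
  have hpe := hp.comp he
  have hqe := hq.comp he
  obtain ⟨q', hq', hΦ⟩ := Fm.exists_realizer_subst Φ (((Sub.wks τs).lifts ρs).lifts τs) hqe
  obtain ⟨r₁, hr₁, h₁⟩ := Fm.exLes_intro (Sub.comp (vars τs) (Sub.wks ρs))
    (Φ.subst (((Sub.wks τs).lifts ρs).lifts τs))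
  obtain ⟨r₂, hr₂, h₂⟩ := Fm.alls_intro (Fm.exLes τs (Sub.comp (vars τs) (Sub.wks ρs))
    (Φ.subst (((Sub.wks τs).lifts ρs).lifts τs)))
  obtain ⟨r₃, hr₃, h₃⟩ := Fm.exMonSts_intro (Fm.alls ρs (Fm.exLes τs
    (Sub.comp (vars τs) (Sub.wks ρs)) (Φ.subst (((Sub.wks τs).lifts ρs).lifts τs))))
  refine ⟨r₃.comp (Sub.append (p.comp e) (r₂.comp (r₁.comp q'))),
    hr₃.comp (hpe.append (hr₂.comp (hr₁.comp hq'))), fun Δ H θ c hc hX => ?_⟩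
  simp only [Sub.comp_assoc, Sub.append_comp]
  have hg := hpe.comp_maj hc.2
  rw [Sub.comp_assoc] at hg
  refine h₃ hg hg (h₂ fun Δ₁ H₁ η₁ e₁ x => ?_)
  refine hE (h x (ext hX e₁)) fun Δ₂ H₂ η₂ e₂ y hy hΦy => ?_
  rw [RPred.isMatrix _ |>.subst]
  simp only [Sub.comp_assoc, Sub.append_comp] at hy hΦy ⊢
  refine h₁ (y := y) ?_ (hΦ ?_)
  · simp only [Sub.comp_assoc, Sub.wks_comp_append, Sub.vars_comp_append]
    exact hy
  · simp only [Sub.comp_assoc, Sub.lifts_comp_append, Sub.wks_comp_append]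
    exact hΦy

/-- Without realizers of the premise, those of the implication are those of the conclusion, up to
the identification that `e` performs. -/
theorem RPred.exists_imp_elim {Γ : Ctx} {X : RPred Γ} (hX : X.ty = []) (Y : RPred Γ) :
    ∃ e : Sub Y.ty (X.imp Y).ty, SelfMajT e ∧
      ∀ ⦃Δ : Ctx⦄ ⦃H : Fm Δ⦄ ⦃θ : Sub Γ Δ⦄ ⦃f : Tms Δ (X.imp Y).ty⦄ ⦃d : Tms Δ X.ty⦄,
        Ent H ((X.imp Y).mat θ f) → Ent H (X.mat θ d) → Ent H (Y.mat θ (e.comp f)) := by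
  obtain ⟨ty, mat, hmat⟩ := X
  subst hX
  refine ⟨Tms.apps Sub.id Sub.empty, .tmsApps .id (.nil _), fun Δ H θ f d hf hd => ?_⟩
  rw [Tms.apps_comp, Sub.empty_comp]
  rw [Sub.eq_empty d] at hd
  exact imp_elim hf (monSt_nil _) hd

/-- Since `A` has no realizers, the realizer of the hypothesis yields the bound of the witness
before `A` is assumed; only the truth of the matrix depends on `A`. -/
theorem valid_indepPremise {Γ : Ctx} (τs : List Ty) {A : Fm Γ} (hA : ExFree A)
    (Ψ : Fm (τs ++ Γ)) : (indepPremise τs A Ψ).interp.Valid := by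
  refine Valid.imp (X := A.interp.imp (Fm.exMonSts τs Ψ).interp) (Y := Fm.interp _) ?_
  obtain ⟨p, q, hp, hq, hE⟩ := Fm.exMonSts_elim Ψ
  obtain ⟨e, he, h⟩ := exists_imp_elim (X := A.interp) hA.bnTypes_eq (Fm.exMonSts τs Ψ).interp
  have hpe := hp.comp he
  have hqe := hq.comp he
  obtain ⟨q', hq', hΨ⟩ := Fm.exists_realizer_subst Ψ ((Sub.wks τs).lifts τs) hqe
  obtain ⟨r₁, hr₁, h₁⟩ := Fm.exMonLes_intro (vars τs) (Ψ.subst ((Sub.wks τs).lifts τs))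
  obtain ⟨r₃, hr₃, h₃⟩ := Fm.exMonSts_intro (.imp (A.subst (Sub.wks τs)) (Fm.exMonLes τs
    (vars τs) (Ψ.subst ((Sub.wks τs).lifts τs))))
  obtain ⟨r₂, hr₂, h₂⟩ := Fm.imp_intro (A.subst (Sub.wks τs)) (hr₁.comp hq')
  refine ⟨r₃.comp (Sub.append (p.comp e) r₂), hr₃.comp (hpe.append hr₂), fun Δ H θ c hc hX => ?_⟩
  have hg := hpe.comp_maj hc.2
  rw [Sub.comp_assoc, Sub.append_comp]
  refine h₃ hg hg (h₂ hc fun Δ₁ H₁ η₁ e₁ d hAd => ?_)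
  obtain ⟨d', hAd⟩ := Fm.exists_of_interp_subst hAd
  rw [Sub.append_comp, Sub.wks_comp_append] at hAd
  refine hE (h (ext hX e₁) hAd) fun Δ₂ H₂ η₂ e₂ y hy hy' hΨy => ?_
  rw [RPred.isMatrix _ |>.subst]
  simp only [Sub.comp_assoc, Sub.append_comp] at hy hΨy ⊢
  refine h₁ (y := y) hy' ?_ (hΨ ?_)
  · rw [Sub.vars_comp_append]
    exact hy
  · simp only [Sub.comp_assoc, Sub.lifts_comp_append, Sub.wks_comp_append]
    exact hΨy

/-- The realizer `c` of `st(x)` majorizes `x`. It is chosen as the witness, and being monotone it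
realizes its own standardness. -/
theorem valid_majAx {Γ : Ctx} (σ : Ty) : (majAx σ : Fm Γ).interp.Valid := by
  have hM := (Fm.maj_internal (Tm.var (.there .here)) (Tm.var .here) :
    (Fm.maj σ _ _ : Fm (σ :: σ :: Γ)).Internal).interp_eq
  refine Valid.all (X := (RPred.st (.var .here)).imp (RPred.ex (.and (.st (.var .here))
    (Fm.interp _)))) (Valid.imp ?_)
  rw [hM]
  refine ⟨Sub.id, .id, fun Δ H θ c hc h => RPred.ex_intro (c .here) (.and_intro (hc.2 .here) ?_)⟩
  simp only [Fm.maj_subst]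
  exact h

/-! ### Soundness of the whole calculus and the closed realizers -/

theorem CharAx.valid {Γ : Ctx} {A : Fm Γ} (h : CharAx Γ A) : A.interp.Valid := by
  cases h with
  | mAC ρs τs Φ => exact valid_mAC ρs τs Φ
  | realization ρs τs Φ => exact valid_realization ρs τs Φ
  | indepPremise τs A hA Ψ => exact valid_indepPremise τs hA Ψ
  | majAx σ => exact valid_majAx σ

/-- Soundness: every theorem is realized by monotone closed terms. -/
theorem Prov.valid {Γ : Ctx} {A : Fm Γ} (h : Prov CharAx A) : A.interp.Valid := by
  induction h with
  | logic h => exact h.valid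
  | arith h => exact h.valid
  | standard h => exact h.valid
  | extra h => exact h.valid
  | @mp Γ A B _ _ ihAB ihA => exact ihA.mono (Valid.le_of_imp (Y := B.interp) ihAB)
  | @allI Γ σ A B _ ih =>
    refine Valid.imp (X := A.interp) (Y := B.interp.all) (le_all ?_)
    rw [← Fm.interp_subst]
    exact Valid.le_of_imp ih
  | @exE Γ σ A B _ ih =>
    refine Valid.imp (X := B.interp.ex) (Y := A.interp) (ex_le ?_)
    rw [← Fm.interp_subst]
    exact Valid.le_of_imp ih
  | extInduction _ _ ih₀ ih => exact valid_extInduction ih₀ ih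

end BNR

theorem mainTheorem3 {Γ : BNR.Ctx} (Φ : BNR.Fm Γ) (hΦ : BNR.Prov BNR.CharAx Φ) :
    ∃ t : BNR.Tms [] Φ.bnTypes,
      (∀ (σ : BNR.Ty) (i : BNR.Var Φ.bnTypes σ), BNR.EHAst (BNR.Fm.mon (t i))) ∧
      BNR.EHAst (Φ.bn BNR.Sub.id (BNR.Sub.comp t BNR.Sub.empty)) := by
  obtain ⟨t, ht, h⟩ := hΦ.valid
  refine ⟨t, fun σ i => .of_ent fun H => ?_, .of_ent fun H => h H BNR.Sub.id⟩
  -- In the empty context the hypothesis of majorized arguments is void, and the identity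
  -- substitution leaves the statement that the closed term majorizes itself.
  have := (ht.comp_maj (H := H) (c := BNR.Sub.id) (BNR.monSt_nil _).2) i
  rwa [BNR.Sub.comp_id] at this
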